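/- Let $R$ be a Noetherian commutative ring of Krull dimension $\le 4$, let $P_0$ be a finitely generated projective $R$-module of constant rank $2$, and let $\theta_0\colon R\xrightarrow{\cong}\det(P_0)=\Lambda^2P_0$ be an isomorphism. **Notation.** For a finitely generated projective $R$-module $P$, let $Um(P)$ be the set of epimorphisms $P\to R$ and $SL(P)$ the group of automorphisms of $P$ of determinant $1$. Let $E(P_0\oplus R)\le Aut(P_0\oplus R)$ be the subgroup generated by the automorphisms $\mathrm{id}+g$ with $g\colon R\to P_0$ or $g\colon P_0\to R$ linear; it acts on $Um(P_0\oplus R)$ on the right by composition, with orbit space $Um(P_0\oplus R)/E(P_0\oplus R)$. Write $P_4=P_0\oplus Re_3\oplus Re_4$ with $Re_3\cong Re_4\cong R$, and identify $P_0\oplus R$ with $P_0\oplus Re_3$. Let $\psi_2=\begin{pmatrix}0&1\\-1&0\end{pmatrix}$ and $\psi_{2n}=\psi_2\perp\dots\perp\psi_2$ ($n$ summands). For a form $f$ on $Q$ and an isomorphism $h\colon P\to Q$, let $h^tfh$ be the form $(p,q)\mapsto f(h(p),h(q))$ on $P$. *The group $\tilde V_{SL}(R)$.* Let $V_{SL}(R)$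 be the quotient of the free abelian group on isometry classes $[P,g,f]$ of triples, where $P$ is a finitely generated projective $R$-module and $g,f$ are non-degenerate alternating forms on $P$, by the relations $[P\oplus P',g\perp g',f\perp f']=[P,g,f]+[P',g',f']$, $[P,f_0,f_1]+[P,f_1,f_2]=[P,f_0,f_2]$, and $[P,g,f]=[P,g,\varphi^t f\varphi]$ for $\varphi\in SL(P)$. Let $\tilde V_{SL}(R)\le V_{SL}(R)$ be the subgroup generated by the classes $[R^{2n},\psi_{2n},M]$ with $M$ an alternating invertible $2n\times 2n$ matrix of Pfaffian $1$. *The Vaserstein symbol.* Let $\chi_0(p,q)=\theta_0^{-1}(p\wedge q)$ on $P_0$. For $a\in Um(P_0\oplus R)$ with a section $s$ of $a$, let $i_s\colon P_0\oplus R\to\ker(a)\oplus R$, $p\mapsto(p-s(a(p)),a(p))$, and let $\chi_a$ be the non-degenerate alternating form on $\ker(a)$ sending $(p,q)$ to the image of $p\wedge q\wedge s(1)$ under $\det(P_0\oplus R)\cong\det(P_0)\xrightarrow{\theta_0^{-1}}R$, where the first isomorphism is inverse to $x\wedge y\mapsto x\wedge y\wedge(0,1)$. Put $$V(a,s)=(i_s\oplus1)^t(\chi_a\perp\psi_2)(i_s\oplus1),$$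 a non-degenerate alternating form on $P_4$. The generalized Vaserstein symbol of $a$ is $V(a)=[P_4,\chi_0\perp\psi_2,V(a,s)]$; it lies in $\tilde V_{SL}(R)$, does not depend on $s$, and depends only on the class of $a$ in $Um(P_0\oplus R)/E(P_0\oplus R)$. **Theorem.** There is a well-defined right action of the group $SL(P_4)$ on $Um(P_0\oplus R)/E(P_0\oplus R)$ for which, for $a\in Um(P_0\oplus R)$, any section $s$ of $a$, and $\varphi\in SL(P_4)$, the element $a\cdot\varphi$ is the class of the epimorphism $$P_0\oplus R\to R,\qquad p\mapsto\big(\varphi^tV(a,s)\varphi\big)(p,e_4).$$ For all $a,a'\in Um(P_0\oplus R)$ one has $V(a)=V(a')$ in $\tilde V_{SL}(R)$ if and only if $a\cdot\varphi=a'$ in $Um(P_0\oplus R)/E(P_0\oplus R)$ for some $\varphi\in SL(P_4)$. -/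

import Mathlib

universe u

noncomputable section

namespace Vaserstein

/-! ### Determinants and the group `SL(P)` -/

section Det

variable {R : Type u} [CommRing R] {P : Type u} [AddCommGroup P] [Module R P]

/-- The endomorphism `φ ⊕ id` of the free module `R^n ≅ P ⊕ ker r`, for a retraction `r` of
`i : P → R^n`. -/
def extendEnd {n : ℕ} (i : P →ₗ[R] (Fin n → R)) (r : (Fin n → R) →ₗ[R] P) (φ : P →ₗ[R] P) :
    (Fin n → R) →ₗ[R] (Fin n → R) :=
  i ∘ₗ φ ∘ₗ r + (LinearMap.id - i ∘ₗ r)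

theorem extendEnd_one {n : ℕ} (i : P →ₗ[R] (Fin n → R)) (r : (Fin n → R) →ₗ[R] P) :
    extendEnd i r 1 = 1 := by
  refine LinearMap.ext fun x => ?_
  simp [extendEnd]

theorem extendEnd_mul {n : ℕ} (i : P →ₗ[R] (Fin n → R)) (r : (Fin n → R) →ₗ[R] P)
    (hr : r ∘ₗ i = LinearMap.id) (φ ψ : P →ₗ[R] P) :
    extendEnd i r (φ * ψ) = extendEnd i r φ * extendEnd i r ψ := by
  have hr' : ∀ x, r (i x) = x := fun x => LinearMap.congr_fun hr x
  refine LinearMap.ext fun x => ?_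
  simp only [extendEnd, LinearMap.comp_apply, LinearMap.add_apply,
    LinearMap.sub_apply, LinearMap.id_apply, Module.End.mul_apply, map_add, map_sub, hr']
  abel

/-- The determinant of the extended endomorphism does not depend on the complement. -/
theorem det_extendEnd_eq {m n : ℕ} (i : P →ₗ[R] (Fin n → R)) (r : (Fin n → R) →ₗ[R] P)
    (j : P →ₗ[R] (Fin m → R)) (q : (Fin m → R) →ₗ[R] P)
    (hr : r ∘ₗ i = LinearMap.id) (hq : q ∘ₗ j = LinearMap.id) (φ : P →ₗ[R] P) :
    LinearMap.det (extendEnd i r φ) = LinearMap.det (extendEnd j q φ) := by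
  have hr' : ∀ x, r (i x) = x := fun x => LinearMap.congr_fun hr x
  have hq' : ∀ x, q (j x) = x := fun x => LinearMap.congr_fun hq x
  have h1 : extendEnd i r φ
      = LinearMap.id + (i ∘ₗ q) ∘ₗ (j ∘ₗ (φ - LinearMap.id) ∘ₗ r) := by
    ext1 k
    simp only [extendEnd, LinearMap.ext_iff, LinearMap.comp_apply, LinearMap.add_apply,
      LinearMap.sub_apply, LinearMap.id_apply, hq', map_sub]
    intros; abel
  have h2 : extendEnd j q φ
      = LinearMap.id + (j ∘ₗ (φ - LinearMap.id) ∘ₗ r) ∘ₗ (i ∘ₗ q) := by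
    ext1 k
    simp only [extendEnd, LinearMap.ext_iff, LinearMap.comp_apply, LinearMap.add_apply,
      LinearMap.sub_apply, LinearMap.id_apply, hr', map_sub]
    intros; abel
  rw [h1, h2, ← LinearMap.det_toMatrix', ← LinearMap.det_toMatrix', map_add, map_add,
    LinearMap.toMatrix'_comp, LinearMap.toMatrix'_comp (j ∘ₗ (φ - LinearMap.id) ∘ₗ r),
    LinearMap.toMatrix'_id, LinearMap.toMatrix'_id, Matrix.det_one_add_mul_comm]

variable (R P) [Module.Finite R P] [Module.Projective R P]

theorem exists_retraction : ∃ (n : ℕ) (i : P →ₗ[R] (Fin n → R)) (r : (Fin n → R) →ₗ[R] P),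
    r ∘ₗ i = LinearMap.id := by
  obtain ⟨n, f, g, -, -, h⟩ := Module.Finite.exists_comp_eq_id_of_projective R P
  exact ⟨n, g, f, h⟩

/-- The determinant of an endomorphism of a finitely generated projective module `P`: the
determinant of `φ ⊕ id_Q` on `P ⊕ Q ≅ R^n`. -/
def projDet : (P →ₗ[R] P) →* R where
  toFun φ := LinearMap.det (extendEnd (exists_retraction R P).choose_spec.choose
    (exists_retraction R P).choose_spec.choose_spec.choose φ)
  map_one' := by
    rw [extendEnd_one, map_one]
  map_mul' φ ψ := by
    rw [← map_mul, extendEnd_mul _ _ (exists_retraction R P).choose_spec.choose_spec.choose_spec]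

/-- `projDet` may be computed with any presentation of `P` as a direct summand of `R^n`. -/
theorem projDet_eq {n : ℕ} (i : P →ₗ[R] (Fin n → R)) (r : (Fin n → R) →ₗ[R] P)
    (hr : r ∘ₗ i = LinearMap.id) (φ : P →ₗ[R] P) :
    projDet R P φ = LinearMap.det (extendEnd i r φ) :=
  det_extendEnd_eq _ _ _ _ (exists_retraction R P).choose_spec.choose_spec.choose_spec hr φ

/-- `SL(P)`: the automorphisms of `P` of determinant one. -/
def SL : Subgroup (P ≃ₗ[R] P) :=
  ((projDet R P).comp (LinearEquiv.automorphismGroup.toLinearMapMonoidHom (R := R) (M := P))).ker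

end Det

/-! ### Unimodular elements and elementary automorphisms -/

section Um

variable (R : Type u) [CommRing R] (P Q : Type u) [AddCommGroup P] [Module R P]
  [AddCommGroup Q] [Module R Q]

/-- `Um(P)`: the epimorphisms `P → R`. -/
def Um : Type u := {a : P →ₗ[R] R // Function.Surjective a}

/-- `E(P, Q)`: the subgroup of `Aut(P ⊕ Q)` generated by all `id + g` with `g : Q → P` or
`g : P → Q` linear. -/
def elemGroup : Subgroup ((P × Q) ≃ₗ[R] (P × Q)) :=
  Subgroup.closure
    ({φ | ∃ g : Q →ₗ[R] P, ∀ x, φ x = x + (g x.2, 0)} ∪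
     {φ | ∃ g : P →ₗ[R] Q, ∀ x, φ x = x + (0, g x.1)})

/-- The orbit relation of the right action of `E(P, Q)` on `Um(P ⊕ Q)` by composition. -/
def elemSetoid : Setoid (Um R (P × Q)) where
  r a b := ∃ φ ∈ elemGroup R P Q, b.1 = a.1 ∘ₗ φ.toLinearMap
  iseqv :=
    { refl := fun a => ⟨1, one_mem _, rfl⟩
      symm := by
        rintro a b ⟨φ, hφ, h⟩
        refine ⟨φ⁻¹, inv_mem hφ, ?_⟩
        rw [h]
        ext1
        · ext1 x
          simp [LinearEquiv.coe_inv]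
        · ext1 x
          simp [LinearEquiv.coe_inv]
      trans := by
        rintro a b c ⟨φ, hφ, h⟩ ⟨ψ, hψ, h'⟩
        exact ⟨φ * ψ, mul_mem hφ hψ, by rw [h', h]; rfl⟩ }

/-- The orbit space `Um(P ⊕ Q)/E(P ⊕ Q)`. -/
def UmE : Type u := Quotient (elemSetoid R P Q)

variable {R P Q} in
/-- The class of a unimodular element in the orbit space. -/
def UmE.mk (a : Um R (P × Q)) : UmE R P Q := Quotient.mk (elemSetoid R P Q) a

end Um

/-! ### Alternating isomorphisms -/

/-- A non-degenerate alternating form on `P`, i.e. an alternating isomorphism `P ≅ P^∨`. -/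
structure AltIso (R : Type u) [CommRing R] (P : Type u) [AddCommGroup P] [Module R P] where
  /-- the bilinear form -/
  form : P →ₗ[R] P →ₗ[R] R
  alt : ∀ p, form p p = 0
  bij : Function.Bijective form

namespace AltIso

variable {R : Type u} [CommRing R] {P Q : Type u} [AddCommGroup P] [Module R P]
  [AddCommGroup Q] [Module R Q]

/-- The form `h^t f h` on `P`. -/
def pull (h : P ≃ₗ[R] Q) (f : AltIso R Q) : AltIso R P where
  form := f.form.compl₁₂ h.toLinearMap h.toLinearMap
  alt p := f.alt (h p)
  bij := by
    constructor
    · intro x y hxy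
      apply h.injective
      apply f.bij.1
      ext q
      simpa using LinearMap.congr_fun hxy (h.symm q)
    · intro l
      obtain ⟨x, hx⟩ := f.bij.2 (l ∘ₗ h.symm.toLinearMap)
      refine ⟨h.symm x, ?_⟩
      ext p
      simp [hx]

theorem pull_symm_pull (h : P ≃ₗ[R] Q) (f : AltIso R Q) : (f.pull h).pull h.symm = f := by
  cases f
  simp only [pull, AltIso.mk.injEq]
  ext p q
  simp

/-- The orthogonal sum `f ⟂ g`. -/
def perp (f : AltIso R P) (g : AltIso R Q) : AltIso R (P × Q) where
  form := f.form.compl₁₂ (LinearMap.fst R P Q) (LinearMap.fst R P Q) +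
    g.form.compl₁₂ (LinearMap.snd R P Q) (LinearMap.snd R P Q)
  alt p := by simp [f.alt, g.alt]
  bij := by
    constructor
    · intro x y hxy
      refine Prod.ext (f.bij.1 ?_) (g.bij.1 ?_)
      · ext p
        simpa using LinearMap.congr_fun hxy (p, 0)
      · ext q
        simpa using LinearMap.congr_fun hxy (0, q)
    · intro l
      obtain ⟨x, hx⟩ := f.bij.2 (l ∘ₗ LinearMap.inl R P Q)
      obtain ⟨y, hy⟩ := g.bij.2 (l ∘ₗ LinearMap.inr R P Q)
      refine ⟨(x, y), ?_⟩
      ext p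
      · simp [hx]
      · simp [hy]

/-- The standard form `ψ_{2n}`, the orthogonal sum of `n` copies of `(0 1; -1 0)`, on `R^{2n}`
with its basis indexed by pairs `(i, k)` in lexicographic order. -/
def psi (R : Type u) [CommRing R] (n : ℕ) : AltIso R (Fin n × Fin 2 → R) where
  form := LinearMap.mk₂ R (fun x y => ∑ i, (x (i, 0) * y (i, 1) - x (i, 1) * y (i, 0)))
    (fun x x' y => by simp only [Pi.add_apply, ← Finset.sum_add_distrib]; congr 1; ext; ring)
    (fun c x y => by
      simp only [Pi.smul_apply, smul_eq_mul, Finset.mul_sum]; congr 1; ext; ring)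
    (fun x y y' => by simp only [Pi.add_apply, ← Finset.sum_add_distrib]; congr 1; ext; ring)
    (fun c x y => by
      simp only [Pi.smul_apply, smul_eq_mul, Finset.mul_sum]; congr 1; ext; ring)
  alt p := by
    simp only [LinearMap.mk₂_apply]
    exact Finset.sum_eq_zero fun i _ => by ring
  bij := by
    constructor
    · rw [injective_iff_map_eq_zero]
      intro x hx
      ext ⟨i, k⟩
      fin_cases k
      · simpa [Pi.single_apply, Prod.ext_iff] using LinearMap.congr_fun hx (Pi.single (i, 1) 1)
      · simpa [Pi.single_apply, Prod.ext_iff] using LinearMap.congr_fun hx (Pi.single (i, 0) 1)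
    · intro l
      refine ⟨fun ik => if ik.2 = 0 then l (Pi.single (ik.1, 1) 1)
        else - l (Pi.single (ik.1, 0) 1), ?_⟩
      refine LinearMap.pi_ext' ?_
      rintro ⟨i, k⟩
      fin_cases k <;> (ext; simp [Pi.single_apply, Prod.ext_iff])

/-- The form `ψ_2 = (0 1; -1 0)` on `R ⊕ R`. -/
def psi2 (R : Type u) [CommRing R] : AltIso R (R × R) where
  form := LinearMap.mk₂ R (fun x y => x.1 * y.2 - x.2 * y.1)
    (fun x x' y => by simp only [Prod.fst_add, Prod.snd_add]; ring)
    (fun c x y => by simp only [Prod.smul_fst, Prod.smul_snd, smul_eq_mul]; ring)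
    (fun x y y' => by simp only [Prod.fst_add, Prod.snd_add]; ring)
    (fun c x y => by simp only [Prod.smul_fst, Prod.smul_snd, smul_eq_mul]; ring)
  alt p := by simp only [LinearMap.mk₂_apply]; ring
  bij := by
    constructor
    · rw [injective_iff_map_eq_zero]
      intro x hx
      refine Prod.ext ?_ ?_
      · simpa using LinearMap.congr_fun hx (0, 1)
      · simpa using LinearMap.congr_fun hx (1, 0)
    · intro l
      refine ⟨(l (0, 1), - l (1, 0)), ?_⟩
      ext <;> simp

/-- The Pfaffian of the Gram matrix of a form on `R^{2n}`: the sum over all perfect matchings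
`{σ(0,0), σ(0,1)}, …, {σ(n-1,0), σ(n-1,1)}`, normalised by `σ(i,0) < σ(i,1)` and
`σ(0,0) < σ(1,0) < …`, of the signed products of entries. -/
def pfaffian {n : ℕ} (f : AltIso R (Fin n × Fin 2 → R)) : R :=
  ∑ σ : Equiv.Perm (Fin n × Fin 2) with
      (∀ i, finProdFinEquiv (σ (i, 0)) < finProdFinEquiv (σ (i, 1))) ∧
      (∀ i j, i < j → finProdFinEquiv (σ (i, 0)) < finProdFinEquiv (σ (j, 0))),
    ((Equiv.Perm.sign σ : ℤ) : R) *
      ∏ i, f.form (Pi.single (σ (i, 0)) 1) (Pi.single (σ (i, 1)) 1)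

end AltIso

/-! ### The groups `V_SL(R)` and `Ṽ_SL(R)` -/

section VSL

/-- A triple `(P, g, f)`: two alternating isomorphisms on a finitely generated projective
module. -/
structure Triple (R : Type u) [CommRing R] where
  P : Type u
  [addCommGroup : AddCommGroup P]
  [module : Module R P]
  [finite : Module.Finite R P]
  [projective : Module.Projective R P]
  g : AltIso R P
  f : AltIso R P

attribute [instance] Triple.addCommGroup Triple.module Triple.finite Triple.projective

variable (R : Type u) [CommRing R]

/-- Isometry of triples. -/
def Triple.setoid : Setoid (Triple R) where
  r T T' := ∃ h : T.P ≃ₗ[R] T'.P, T.g = T'.g.pull h ∧ T.f = T'.f.pull h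
  iseqv :=
    { refl := fun T => ⟨LinearEquiv.refl R T.P, rfl, rfl⟩
      symm := by
        rintro T T' ⟨h, h1, h2⟩
        refine ⟨h.symm, ?_, ?_⟩
        · rw [h1, AltIso.pull_symm_pull]
        · rw [h2, AltIso.pull_symm_pull]
      trans := by
        rintro T T' T'' ⟨h, h1, h2⟩ ⟨k, k1, k2⟩
        refine ⟨h.trans k, ?_, ?_⟩
        · rw [h1, k1]; rfl
        · rw [h2, k2]; rfl }

/-- The free abelian group on isometry classes of triples. -/
abbrev FreeTriples : Type (u + 1) := FreeAbelianGroup (Quotient (Triple.setoid R))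

variable {R} in
/-- The generator of the free abelian group given by the isometry class of `(P, g, f)`. -/
def gen {P : Type u} [AddCommGroup P] [Module R P] [Module.Finite R P] [Module.Projective R P]
    (g f : AltIso R P) : FreeTriples R :=
  FreeAbelianGroup.of (Quotient.mk (Triple.setoid R) ⟨P, g, f⟩)

/-- The defining relations of `V_SL(R)`, written as elements of the free abelian group that have
to vanish. -/
inductive VRel : FreeTriples R → Prop
  | sum {P Q : Type u} [AddCommGroup P] [Module R P] [Module.Finite R P] [Module.Projective R P]
      [AddCommGroup Q] [Module R Q] [Module.Finite R Q] [Module.Projective R Q]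
      (g f : AltIso R P) (g' f' : AltIso R Q) :
      VRel (gen (g.perp g') (f.perp f') - (gen g f + gen g' f'))
  | chain {P : Type u} [AddCommGroup P] [Module R P] [Module.Finite R P]
      [Module.Projective R P] (f₀ f₁ f₂ : AltIso R P) :
      VRel (gen f₀ f₁ + gen f₁ f₂ - gen f₀ f₂)
  | sl {P : Type u} [AddCommGroup P] [Module R P] [Module.Finite R P]
      [Module.Projective R P] (g f : AltIso R P) (φ : P ≃ₗ[R] P) (hφ : φ ∈ SL R P) :
      VRel (gen g f - gen g (f.pull φ))

/-- The group `V_SL(R)`. -/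
abbrev VSL : Type (u + 1) := FreeTriples R ⧸ AddSubgroup.closure {x | VRel R x}

variable {R} in
/-- The class `[P, g, f]` in `V_SL(R)`. -/
def cls {P : Type u} [AddCommGroup P] [Module R P] [Module.Finite R P] [Module.Projective R P]
    (g f : AltIso R P) : VSL R :=
  QuotientAddGroup.mk (gen g f)

/-- The subgroup `Ṽ_SL(R)` of `V_SL(R)`. The isomorphism `W'_SL(R) ≅ V_SL(R)` sends the class of
an alternating invertible matrix `M` of size `2n` to `[R^{2n}, ψ_{2n}, M]`, and `W_SL(R)` consists
of the classes of the matrices of Pfaffian one. -/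
def VSLtilde : AddSubgroup (VSL R) :=
  AddSubgroup.closure
    {x | ∃ (n : ℕ) (f : AltIso R (Fin n × Fin 2 → R)),
      f.pfaffian = 1 ∧ x = cls (AltIso.psi R n) f}

end VSL

/-! ### Forms on modules of rank two -/

section RankTwo

variable {R : Type u} [CommRing R] {P : Type u} [AddCommGroup P] [Module R P]

theorem eq_zero_of_local {N : Type u} [AddCommGroup N] [Module R N] (x : N)
    (h : ∀ m : Ideal R, m.IsPrime → ∃ c, c ∉ m ∧ c • x = 0) : x = 0 := by
  by_contra hx
  have hne : LinearMap.ker (LinearMap.toSpanSingleton R N x) ≠ ⊤ := by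
    intro ht
    apply hx
    have : (1 : R) ∈ LinearMap.ker (LinearMap.toSpanSingleton R N x) := by rw [ht]; trivial
    simpa using this
  obtain ⟨m, hm, hle⟩ := Ideal.exists_le_maximal _ hne
  obtain ⟨c, hc, hcx⟩ := h m hm.isPrime
  exact hc (hle (by simpa using hcx))

/-- Locally, a projective module of rank two is generated by two elements. -/
theorem exists_local_gens [Module.Finite R P] [Module.Projective R P]
    (hP : ∀ p : PrimeSpectrum R, Module.rankAtStalk P p = 2) (m : Ideal R) (hm : m.IsPrime) :
    ∃ e₀ e₁ : P, ∀ p : P, ∃ c, c ∉ m ∧ ∃ r₀ r₁ : R, c • p = r₀ • e₀ + r₁ • e₁ := by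
  let Rm := Localization.AtPrime m
  let Pm := LocalizedModule m.primeCompl P
  let F : P →ₗ[R] Pm := LocalizedModule.mkLinearMap m.primeCompl P
  have hfree : Module.Free Rm Pm := Module.free_of_flat_of_isLocalRing
  have hrk : Module.finrank Rm Pm = 2 := hP ⟨m, hm⟩
  let b : Module.Basis (Fin 2) Rm Pm := Module.finBasisOfFinrankEq Rm Pm hrk
  obtain ⟨⟨e₀, u₀⟩, h₀⟩ := IsLocalizedModule.surj m.primeCompl F (b 0)
  obtain ⟨⟨e₁, u₁⟩, h₁⟩ := IsLocalizedModule.surj m.primeCompl F (b 1)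
  refine ⟨e₀, e₁, fun p => ?_⟩
  obtain ⟨⟨x₀, v₀⟩, k₀⟩ := IsLocalization.surj m.primeCompl (b.repr (F p) 0)
  obtain ⟨⟨x₁, v₁⟩, k₁⟩ := IsLocalization.surj m.primeCompl (b.repr (F p) 1)
  have hsum : F p = b.repr (F p) 0 • b 0 + b.repr (F p) 1 • b 1 := by
    conv_lhs => rw [← b.sum_repr (F p), Fin.sum_univ_two]
  have h₀' : F e₀ = algebraMap R Rm u₀ • b 0 := by
    rw [algebraMap_smul]; exact h₀.symm
  have h₁' : F e₁ = algebraMap R Rm u₁ • b 1 := by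
    rw [algebraMap_smul]; exact h₁.symm
  simp only at k₀ k₁
  have key : F (((v₀ * v₁ * u₀ * u₁ : m.primeCompl) : R) • p)
      = F ((x₀ * v₁ * u₁ : R) • e₀ + (x₁ * v₀ * u₀ : R) • e₁) := by
    rw [map_add, map_smul, map_smul, map_smul, h₀', h₁', hsum,
      ← algebraMap_smul Rm (_ : R) (_ + _), ← algebraMap_smul Rm (x₀ * v₁ * u₁) (_ : Pm),
      ← algebraMap_smul Rm (x₁ * v₀ * u₀) (_ : Pm), smul_add, smul_smul, smul_smul, smul_smul,
      smul_smul]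
    simp only [Submonoid.coe_mul, map_mul, ← k₀, ← k₁]
    congr 1
    · congr 1; ring
    · congr 1; ring
  obtain ⟨c, hc⟩ := (IsLocalizedModule.eq_iff_exists m.primeCompl F).1 key
  refine ⟨(c * (v₀ * v₁ * u₀ * u₁) : m.primeCompl), (c * (v₀ * v₁ * u₀ * u₁)).2,
    c * (x₀ * v₁ * u₁), c * (x₁ * v₀ * u₀), ?_⟩
  simpa [Submonoid.smul_def, smul_smul, mul_assoc] using hc

theorem form_swap {B : P →ₗ[R] P →ₗ[R] R} (hB : ∀ p, B p p = 0) (p q : P) : B q p = - B p q := by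
  have h := hB (p + q)
  simp only [map_add, LinearMap.add_apply, hB, zero_add, add_zero] at h
  linear_combination h

/-- The third exterior power of a projective module of rank two vanishes. -/
theorem cyclic_identity [Module.Finite R P] [Module.Projective R P]
    (hP : ∀ p : PrimeSpectrum R, Module.rankAtStalk P p = 2)
    {B : P →ₗ[R] P →ₗ[R] R} (hB : ∀ p, B p p = 0) (p q r : P) :
    B p q • r + B q r • p + B r p • q = 0 := by
  refine eq_zero_of_local (R := R) _ fun m hm => ?_
  obtain ⟨e₀, e₁, he⟩ := exists_local_gens hP m hm
  obtain ⟨c, hc, a₀, a₁, h1⟩ := he p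
  obtain ⟨d, hd, b₀, b₁, h2⟩ := he q
  obtain ⟨e, hee, d₀, d₁, h3⟩ := he r
  refine ⟨c * d * e, hm.mul_notMem (hm.mul_notMem hc hd) hee, ?_⟩
  have : (c * d * e) • (B p q • r + B q r • p + B r p • q)
      = B (c • p) (d • q) • (e • r) + B (d • q) (e • r) • (c • p)
        + B (e • r) (c • p) • (d • q) := by
    simp only [map_smul, LinearMap.smul_apply, smul_eq_mul]
    module
  rw [this, h1, h2, h3]
  have hs := form_swap hB e₀ e₁
  simp only [map_add, map_smul, LinearMap.smul_apply, LinearMap.add_apply, smul_eq_mul, hB, hs]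
  module

/-- An alternating form on a projective module of rank two whose values generate the unit ideal is
non-degenerate. -/
theorem bijective_of_span [Module.Finite R P] [Module.Projective R P]
    (hP : ∀ p : PrimeSpectrum R, Module.rankAtStalk P p = 2)
    {B : P →ₗ[R] P →ₗ[R] R} (hB : ∀ p, B p p = 0)
    (h1 : Ideal.span (Set.range fun x : P × P => B x.1 x.2) = ⊤) : Function.Bijective B := by
  constructor
  · rw [injective_iff_map_eq_zero]
    intro r hr
    have hle : Ideal.span (Set.range fun x : P × P => B x.1 x.2)
        ≤ LinearMap.ker (LinearMap.toSpanSingleton R P r) := by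
      refine Ideal.span_le.2 ?_
      rintro _ ⟨⟨x, y⟩, rfl⟩
      have h := cyclic_identity hP hB x y r
      rw [form_swap hB r y, hr] at h
      simpa using h
    have : (1 : R) ∈ LinearMap.ker (LinearMap.toSpanSingleton R P r) := hle (by rw [h1]; trivial)
    simpa using this
  · intro l
    have hle : Ideal.span (Set.range fun x : P × P => B x.1 x.2)
        ≤ (LinearMap.range B).comap (LinearMap.toSpanSingleton R (P →ₗ[R] R) l) := by
      refine Ideal.span_le.2 ?_
      rintro _ ⟨⟨x, y⟩, rfl⟩
      refine ⟨l y • x - l x • y, ?_⟩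
      ext r
      have h := congrArg l (cyclic_identity hP hB x y r)
      simp only [map_add, map_smul, smul_eq_mul, map_zero] at h
      simp only [map_sub, map_smul, LinearMap.sub_apply, LinearMap.smul_apply, smul_eq_mul,
        LinearMap.toSpanSingleton_apply]
      rw [form_swap hB x r] at h
      linear_combination -h
    have : (1 : R) ∈ (LinearMap.range B).comap (LinearMap.toSpanSingleton R (P →ₗ[R] R) l) :=
      hle (by rw [h1]; trivial)
    simpa using this

end RankTwo

/-! ### The generalized Vaserstein symbol -/

section Symbol

variable {R : Type u} [CommRing R] {P₀ : Type u} [AddCommGroup P₀] [Module R P₀]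

theorem wedge_val (p q : P₀) : ((exteriorPower.ιMulti R 2 ![p, q] : ⋀[R]^2 P₀) :
    ExteriorAlgebra R P₀) = ExteriorAlgebra.ι R p * ExteriorAlgebra.ι R q := by
  simp [ExteriorAlgebra.ιMulti_apply]

/-- The bilinear form `(p, q) ↦ θ₀⁻¹(p ∧ q)`. -/
def chi0Form (θ₀ : R ≃ₗ[R] ⋀[R]^2 P₀) : P₀ →ₗ[R] P₀ →ₗ[R] R :=
  LinearMap.mk₂ R (fun p q => θ₀.symm (exteriorPower.ιMulti R 2 ![p, q]))
    (fun p p' q => by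
      rw [← map_add]; congr 1; ext1
      simp only [wedge_val, Submodule.coe_add, map_add, add_mul])
    (fun c p q => by
      rw [← map_smul]; congr 1; ext1
      simp only [wedge_val, Submodule.coe_smul, map_smul, smul_mul_assoc])
    (fun p q q' => by
      rw [← map_add]; congr 1; ext1
      simp only [wedge_val, Submodule.coe_add, map_add, mul_add])
    (fun c p q => by
      rw [← map_smul]; congr 1; ext1
      simp only [wedge_val, Submodule.coe_smul, map_smul, mul_smul_comm])

theorem chi0Form_alt (θ₀ : R ≃ₗ[R] ⋀[R]^2 P₀) (p : P₀) : chi0Form θ₀ p p = 0 := by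
  have : (exteriorPower.ιMulti R 2 ![p, p] : ⋀[R]^2 P₀) = 0 := by
    ext1; rw [wedge_val]; simp
  simp [chi0Form, this]

theorem chi0Form_span (θ₀ : R ≃ₗ[R] ⋀[R]^2 P₀) :
    Ideal.span (Set.range fun x : P₀ × P₀ => chi0Form θ₀ x.1 x.2) = ⊤ := by
  have h := congrArg (Submodule.map θ₀.symm.toLinearMap) (exteriorPower.ιMulti_span R 2 P₀)
  rw [Submodule.map_span, Submodule.map_top, LinearEquiv.range] at h
  rw [eq_top_iff, ← h]
  refine Submodule.span_mono ?_
  rintro _ ⟨_, ⟨v, rfl⟩, rfl⟩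
  refine ⟨(v 0, v 1), ?_⟩
  have : v = ![v 0, v 1] := by ext i; fin_cases i <;> rfl
  simp only [chi0Form, LinearMap.mk₂_apply, LinearEquiv.coe_coe]
  rw [← this]

/-- The alternating form `χ₀` on `P₀`. -/
def chi0 [Module.Finite R P₀] [Module.Projective R P₀]
    (hP : ∀ p : PrimeSpectrum R, Module.rankAtStalk P₀ p = 2) (θ₀ : R ≃ₗ[R] ⋀[R]^2 P₀) :
    AltIso R P₀ where
  form := chi0Form θ₀
  alt := chi0Form_alt θ₀
  bij := bijective_of_span hP (chi0Form_alt θ₀) (chi0Form_span θ₀)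

/-- The image of `p ∧ q ∧ w` under the isomorphism `det(P₀ ⊕ R) ≅ det(P₀) ≅ R` given by
`x ∧ y ∧ (0, 1) ↦ x ∧ y` and `θ₀⁻¹`, as a bilinear form in `p` and `q`. -/
def volForm (θ₀ : R ≃ₗ[R] ⋀[R]^2 P₀) (w : P₀ × R) : (P₀ × R) →ₗ[R] (P₀ × R) →ₗ[R] R :=
  LinearMap.mk₂ R (fun p q => w.2 * chi0Form θ₀ p.1 q.1 + p.2 * chi0Form θ₀ q.1 w.1
      + q.2 * chi0Form θ₀ w.1 p.1)
    (fun p p' q => by simp only [Prod.fst_add, Prod.snd_add, map_add, LinearMap.add_apply]; ring)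
    (fun c p q => by
      simp only [Prod.smul_fst, Prod.smul_snd, map_smul, LinearMap.smul_apply, smul_eq_mul]; ring)
    (fun p q q' => by simp only [Prod.fst_add, Prod.snd_add, map_add, LinearMap.add_apply]; ring)
    (fun c p q => by
      simp only [Prod.smul_fst, Prod.smul_snd, map_smul, LinearMap.smul_apply, smul_eq_mul]; ring)

theorem volForm_apply (θ₀ : R ≃ₗ[R] ⋀[R]^2 P₀) (w p q : P₀ × R) :
    volForm θ₀ w p q = w.2 * chi0Form θ₀ p.1 q.1 + p.2 * chi0Form θ₀ q.1 w.1
      + q.2 * chi0Form θ₀ w.1 p.1 := rfl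

theorem volForm_alt (θ₀ : R ≃ₗ[R] ⋀[R]^2 P₀) (w p : P₀ × R) : volForm θ₀ w p p = 0 := by
  rw [volForm_apply, chi0Form_alt, form_swap (chi0Form_alt θ₀) p.1 w.1]; ring

theorem volForm_expand (θ₀ : R ≃ₗ[R] ⋀[R]^2 P₀) (u v w t : P₀ × R) (α β γ : R) :
    volForm θ₀ (u + α • t) (v + β • t) (w + γ • t) = volForm θ₀ u v w + α * volForm θ₀ t v w
      + β * volForm θ₀ t w u + γ * volForm θ₀ t u v := by
  have h1 := form_swap (chi0Form_alt θ₀) u.1 t.1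
  have h2 := form_swap (chi0Form_alt θ₀) v.1 t.1
  have h3 := form_swap (chi0Form_alt θ₀) w.1 t.1
  have h5 := form_swap (chi0Form_alt θ₀) u.1 w.1
  simp only [volForm_apply, Prod.smul_fst, Prod.smul_snd,
    Prod.fst_add, Prod.snd_add, map_add, LinearMap.add_apply, map_smul,
    LinearMap.smul_apply, smul_eq_mul, chi0Form_alt, h1, h2, h3, h5]
  ring

/-- The sections of a unimodular element `a : P → R`. -/
def Sect {P : Type u} [AddCommGroup P] [Module R P] (a : Um R P) : Type u :=
  {s : R →ₗ[R] P // a.1 ∘ₗ s = LinearMap.id}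

theorem Sect.apply {P : Type u} [AddCommGroup P] [Module R P] {a : Um R P} (s : Sect a) (x : R) :
    a.1 (s.1 x) = x := LinearMap.congr_fun s.2 x

/-- The isomorphism `i_s : P ≅ ker(a) ⊕ R`, `p ↦ (p - s(a(p)), a(p))`. -/
def splitEquiv {P : Type u} [AddCommGroup P] [Module R P] (a : Um R P) (s : Sect a) :
    P ≃ₗ[R] (LinearMap.ker a.1 × R) where
  toFun p := (⟨p - s.1 (a.1 p), by simp [s.apply]⟩, a.1 p)
  map_add' p q := by
    refine Prod.ext (Subtype.ext ?_) (by simp)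
    simp only [map_add, Prod.fst_add, Submodule.coe_add]; abel
  map_smul' c p := by
    refine Prod.ext (Subtype.ext ?_) (by simp)
    simp only [map_smul, Prod.smul_fst, Submodule.coe_smul, RingHom.id_apply, smul_sub]
  invFun x := x.1 + s.1 x.2
  left_inv p := by simp
  right_inv x := by
    have h : a.1 x.1 = 0 := x.1.2
    refine Prod.ext (Subtype.ext ?_) ?_ <;> simp [s.apply, h]

theorem ker_finite [Module.Finite R P₀] (a : Um R (P₀ × R)) (s : Sect a) : Module.Finite R (LinearMap.ker a.1) :=
  Module.Finite.of_surjective (LinearMap.fst R _ R ∘ₗ (splitEquiv a s).toLinearMap)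
    (Prod.fst_surjective.comp (splitEquiv a s).surjective)

theorem ker_projective [Module.Projective R P₀] (a : Um R (P₀ × R)) (s : Sect a) :
    Module.Projective R (LinearMap.ker a.1) := by
  refine Module.Projective.of_split (LinearMap.ker a.1).subtype
    (LinearMap.fst R _ R ∘ₗ (splitEquiv a s).toLinearMap) ?_
  refine LinearMap.ext fun x => Subtype.ext ?_
  have h : a.1 x = 0 := x.2
  simp [splitEquiv, h]

section

variable [Module.Finite R P₀] [Module.Projective R P₀]

theorem ker_rank (hP : ∀ p : PrimeSpectrum R, Module.rankAtStalk P₀ p = 2)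
    (a : Um R (P₀ × R)) (s : Sect a) (p : PrimeSpectrum R) :
    Module.rankAtStalk (LinearMap.ker a.1) p = 2 := by
  have := ker_finite a s
  have := ker_projective a s
  have h := congrFun (Module.rankAtStalk_eq_of_equiv (splitEquiv a s)) p
  rw [Module.rankAtStalk_prod, Module.rankAtStalk_prod] at h
  simp only [Pi.add_apply, hP] at h
  omega

theorem volForm_ker (hP : ∀ p : PrimeSpectrum R, Module.rankAtStalk P₀ p = 2)
    (θ₀ : R ≃ₗ[R] ⋀[R]^2 P₀) (a : Um R (P₀ × R)) (s : Sect a)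
    (p q r : LinearMap.ker a.1) : volForm θ₀ r p q = 0 := by
  have := ker_finite a s
  have := ker_projective a s
  refine eq_zero_of_local (R := R) _ fun m hm => ?_
  obtain ⟨e₀, e₁, he⟩ := exists_local_gens (ker_rank hP a s) m hm
  obtain ⟨c, hc, a₀, a₁, h1⟩ := he p
  obtain ⟨d, hd, b₀, b₁, h2⟩ := he q
  obtain ⟨e, hee, d₀, d₁, h3⟩ := he r
  refine ⟨c * d * e, hm.mul_notMem (hm.mul_notMem hc hd) hee, ?_⟩
  have : (c * d * e) • volForm θ₀ r p q
      = volForm θ₀ (e • r : LinearMap.ker a.1) (c • p : LinearMap.ker a.1)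
        (d • q : LinearMap.ker a.1) := by
    simp only [volForm_apply, Submodule.coe_smul, Prod.smul_fst, Prod.smul_snd, map_smul,
      LinearMap.smul_apply, smul_eq_mul]
    ring
  rw [this, h1, h2, h3]
  have hs := form_swap (chi0Form_alt θ₀) e₀.1.1 e₁.1.1
  simp only [volForm_apply, Submodule.coe_smul, Submodule.coe_add, Prod.smul_fst, Prod.smul_snd,
    Prod.fst_add, Prod.snd_add, map_add, LinearMap.add_apply, map_smul,
    LinearMap.smul_apply, smul_eq_mul, chi0Form_alt, hs]
  ring

theorem volForm_ker_span (hP : ∀ p : PrimeSpectrum R, Module.rankAtStalk P₀ p = 2)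
    (θ₀ : R ≃ₗ[R] ⋀[R]^2 P₀) (a : Um R (P₀ × R)) (s : Sect a) :
    Ideal.span (Set.range fun x : LinearMap.ker a.1 × LinearMap.ker a.1 =>
      (volForm θ₀ (s.1 1)).compl₁₂ (LinearMap.ker a.1).subtype (LinearMap.ker a.1).subtype
        x.1 x.2) = ⊤ := by
  have hdec : ∀ v : P₀ × R, ∃ k : LinearMap.ker a.1, v = (k : P₀ × R) + a.1 v • s.1 1 := by
    intro v
    refine ⟨(splitEquiv a s v).1, ?_⟩
    rw [← map_smul, smul_eq_mul, mul_one]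
    exact ((splitEquiv a s).symm_apply_apply v).symm
  rw [eq_top_iff, ← chi0Form_span θ₀, Ideal.span_le]
  rintro _ ⟨⟨x, y⟩, rfl⟩
  have hxy : chi0Form θ₀ x y = volForm θ₀ (0, 1) (x, 0) (y, 0) := by simp [volForm_apply]
  obtain ⟨u, hu⟩ := hdec (0, 1)
  obtain ⟨v, hv⟩ := hdec (x, 0)
  obtain ⟨w, hw⟩ := hdec (y, 0)
  simp only [SetLike.mem_coe]
  rw [hxy, hu, hv, hw, volForm_expand, volForm_ker hP θ₀ a s, zero_add]
  refine add_mem (add_mem ?_ ?_) ?_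
  · exact Ideal.mul_mem_left _ _ (Ideal.subset_span ⟨(v, w), rfl⟩)
  · exact Ideal.mul_mem_left _ _ (Ideal.subset_span ⟨(w, u), rfl⟩)
  · exact Ideal.mul_mem_left _ _ (Ideal.subset_span ⟨(u, v), rfl⟩)

/-- The alternating form `χ_a` on `ker(a)`: it sends `(p, q)` to the image of `p ∧ q` under
`det(ker a) ≅ det(P₀ ⊕ R) ≅ det(P₀) ≅ R`, where the first isomorphism is
`p ∧ q ↦ p ∧ q ∧ s(1)` and does not depend on the section `s`. -/
def chiA (hP : ∀ p : PrimeSpectrum R, Module.rankAtStalk P₀ p = 2) (θ₀ : R ≃ₗ[R] ⋀[R]^2 P₀)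
    (a : Um R (P₀ × R)) (s : Sect a) : AltIso R (LinearMap.ker a.1) where
  form := (volForm θ₀ (s.1 1)).compl₁₂ (LinearMap.ker a.1).subtype (LinearMap.ker a.1).subtype
  alt p := volForm_alt θ₀ _ _
  bij := by
    have hf := ker_finite a s
    have hp := ker_projective a s
    exact bijective_of_span (ker_rank hP a s) (fun p => volForm_alt θ₀ _ _)
      (volForm_ker_span hP θ₀ a s)

/-- The form `V(a, s) = (i_s ⊕ 1)^t (χ_a ⟂ ψ_2) (i_s ⊕ 1)` on `P₀ ⊕ R ⊕ R`. -/
def vForm (hP : ∀ p : PrimeSpectrum R, Module.rankAtStalk P₀ p = 2) (θ₀ : R ≃ₗ[R] ⋀[R]^2 P₀)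
    (a : Um R (P₀ × R)) (s : Sect a) : AltIso R (P₀ × R × R) :=
  ((chiA hP θ₀ a s).perp (AltIso.psi2 R)).pull
    ((LinearEquiv.prodAssoc R P₀ R R).symm.trans
      (((splitEquiv a s).prodCongr (LinearEquiv.refl R R)).trans
        (LinearEquiv.prodAssoc R (LinearMap.ker a.1) R R)))

end

/-- The unimodular element `χ(-, e₄) : P₀ ⊕ R → R` of a non-degenerate alternating form `χ` on
`P₄ = P₀ ⊕ R e₃ ⊕ R e₄`. -/
def lastRow (χ : AltIso R (P₀ × R × R)) : Um R (P₀ × R) :=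
  ⟨χ.form.flip (0, 0, 1) ∘ₗ
      LinearMap.prod (LinearMap.fst R P₀ R)
        (LinearMap.prod (LinearMap.snd R P₀ R) (0 : (P₀ × R) →ₗ[R] R)), by
    obtain ⟨w, hw⟩ := χ.bij.2 (LinearMap.snd R R R ∘ₗ LinearMap.snd R P₀ (R × R))
    have h1 : χ.form w (0, 0, 1) = 1 := by rw [hw]; simp
    have h2 : χ.form (w.1, w.2.1, 0) (0, 0, 1) = 1 := by
      have hd : w = (w.1, w.2.1, 0) + w.2.2 • ((0, 0, 1) : P₀ × R × R) := by
        ext <;> simp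
      rw [hd, map_add, map_smul, LinearMap.add_apply, LinearMap.smul_apply, χ.alt] at h1
      simpa using h1
    intro c
    refine ⟨c • (w.1, w.2.1), ?_⟩
    rw [map_smul]
    simp [h2]⟩

end Symbol

end Vaserstein

end

/-! Alternating forms on `P₄ = P₀ ⊕ Re₃ ⊕ Re₄` with the right Pfaffian are exactly the forms `V(a,
s)`, and `a` is recovered from `V(a, s)` as its pairing with `e₄` (`lastRow_vForm`). The action of
`SL(P₄)` is therefore pullback of forms, read through this correspondence.

Pfaffians make this precise without a free `P₄`. The form `χ₀ ⟂ ψ₂` is a summand of some `ψ_{2n}`,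
so after adding a fixed complement every form on `P₄` has a Pfaffian relative to the basis in which
`χ₀ ⟂ ψ₂` has Pfaffian one. Each `V(a, s)` then has Pfaffian one (`relPf_vForm`), each form of
Pfaffian one is a `V(a, s)` (`exists_eq_vForm`), and pulling back by `φ` multiplies the Pfaffian by
`det φ` (`relPf_pull`). Hence `SL(P₄)` preserves the set of these forms, and any isometry between
two of them has determinant one.

Orbits under `E(P₀ ⊕ R)` match orbits of forms under the group generated by transvections along
unimodular vectors of `P₄`: elementary changes of `a`, and changes of `s`, pull `V(a, s)` back by
such a product (`exists_pull_of_mk_eq`), while such a product does not change the class of the last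
row (`mk_lastRow_pull`). The second fact needs generation by transvections along and towards `e₄`,
which rests on `hasTransvection_of_unimodular`. As the group is normal in `Aut(P₄)`, the action is
well defined.

If the symbols agree, the map `[P, g, f] ↦ [f] - [g]` into the Grothendieck group of forms shows
that the two forms on `P₄` are stably isometric. Since `P₄` has rank 4 and `dim R ≤ 4`, Bass'
theorem gives transitivity on unimodular vectors after a hyperbolic plane is added, so stable
isometry implies isometry (`isometric_of_perp`). By the Pfaffian this isometry lies in `SL(P₄)`. The
converse is a defining relation of `V_SL(R)`. -/

noncomputable section
namespace Vaserstein

/-! ### Kronecker's theorem and Bass' stable range theorem for projective modules -/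

section Kronecker

/-- The boundary ideal of `b`: generated by `b` and the elements `x` with `x * b` nilpotent. -/
def boundaryIdeal {A : Type u} [CommRing A] (b : A) : Ideal A :=
  Ideal.span {b} ⊔ Submodule.comap (LinearMap.mulLeft A b) (nilradical A)

theorem mem_boundaryIdeal {A : Type u} [CommRing A] {b y : A} :
    y ∈ boundaryIdeal b ↔ ∃ z x, IsNilpotent (b * x) ∧ y = z * b + x := by
  rw [boundaryIdeal, Submodule.mem_sup]
  constructor
  · rintro ⟨_, h, x, hx, rfl⟩
    obtain ⟨z, rfl⟩ := Ideal.mem_span_singleton'.1 h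
    exact ⟨z, x, hx, rfl⟩
  · rintro ⟨z, x, hx, rfl⟩
    exact ⟨z * b, Ideal.mem_span_singleton'.2 ⟨z, rfl⟩, x, hx, rfl⟩

/-- In the localization at a minimal prime `p` every element of `p` is nilpotent, so `b ∈ p` forces
`b * x` to be nilpotent for some `x ∉ p`. Otherwise a prime avoiding `b` and the complement of `p`
would lie strictly inside `p`. -/
theorem boundaryIdeal_not_le_minimal {A : Type u} [CommRing A] (b : A) {p : Ideal A}
    (hp : p ∈ minimalPrimes A) : ¬ boundaryIdeal b ≤ p := by
  intro hle
  have hprime : p.IsPrime := hp.1.1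
  have hb : b ∈ p := hle (mem_boundaryIdeal.2 ⟨1, 0, by simp, by simp⟩)
  have hx : ∃ x ∉ p, IsNilpotent (b * x) := by
    by_contra! hcon
    have hdisj : Disjoint (((⊥ : Ideal A) : Set A))
        (Submonoid.powers b ⊔ p.primeCompl : Submonoid A) := by
      rw [Set.disjoint_left]
      rintro x hx0 hx
      obtain ⟨y, ⟨k, rfl⟩, z, hz, rfl⟩ := Submonoid.mem_sup.1 hx
      refine hcon z hz ⟨k + 1, ?_⟩
      have h0 : b ^ k * z = 0 := hx0
      rw [mul_pow, pow_succ, pow_succ]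
      linear_combination (b * z ^ k * z) * h0 - (b * z ^ k * z) * h0 + z ^ k * b * h0
    obtain ⟨q, hq, -, hqd⟩ := Ideal.exists_le_prime_disjoint _ _ hdisj
    have hqp : q ≤ p := by
      intro x hxq
      by_contra hxp
      exact Set.disjoint_left.1 hqd hxq (Submonoid.mem_sup_right (show x ∈ p.primeCompl from hxp))
    have hpq : p ≤ q := hp.2 ⟨hq, bot_le⟩ hqp
    exact Set.disjoint_left.1 hqd (hpq hb)
      (Submonoid.mem_sup_left (Submonoid.mem_powers b))
  obtain ⟨x, hxp, hx⟩ := hx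
  exact hxp (hle (mem_boundaryIdeal.2 ⟨0, x, hx, by simp⟩))

/-- A chain of primes above the boundary ideal never starts at a minimal prime, so it can be
prolonged downwards by one. -/
theorem ringKrullDim_boundary_lt {A : Type u} [CommRing A] (b : A) {n : ℕ}
    (h : ringKrullDim A < (n + 1 : ℕ)) : ringKrullDim (A ⧸ boundaryIdeal b) < (n : ℕ) := by
  rw [ringKrullDim_quotient]
  by_contra! hcon
  obtain ⟨l, hl⟩ := Order.le_krullDim_iff.1 hcon
  obtain ⟨p, hp, hp'⟩ := Ideal.exists_minimalPrimes_le (J := l.head.1.asIdeal) bot_le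
  let p' : PrimeSpectrum A := ⟨p, hp.1.1⟩
  have hlt : p' < l.head := lt_of_le_of_ne hp' fun h => by
    refine boundaryIdeal_not_le_minimal b hp ?_
    have := l.head.2
    rw [← h] at this
    exact this
  have h2 := Order.LTSeries.length_le_krullDim ((l.map Subtype.val (Subtype.strictMono_coe _)).cons p' hlt)
  refine absurd h (not_lt.2 ?_)
  have h3 : ((l.map Subtype.val (Subtype.strictMono_coe _)).cons p' hlt).length = n + 1 := by
    exact (RelSeries.cons_length _ _ _).trans (congrArg (· + 1) hl)
  rw [h3] at h2
  exact_mod_cast h2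

/-- Kronecker's theorem, by induction on the dimension: passing to the quotient by the boundary
ideal of the last element lowers the dimension by one and uses up that element. -/
theorem exists_mem_radical_span {n : ℕ} : ∀ {A : Type u} [CommRing A]
    (_ : ringKrullDim A < (n : ℕ)) (b : Fin n → A) (a : A),
    ∃ x : Fin n → A, a ∈ (Ideal.span (Set.range fun i => b i + a * x i)).radical := by
  induction n with
  | zero =>
    intro A _ h b a
    -- Dimension less than zero means the zero ring.
    have : Subsingleton A := by
      by_contra hn
      rw [not_subsingleton_iff_nontrivial] at hn
      exact absurd h (not_lt.2 (by simpa using ringKrullDim_nonneg_of_nontrivial))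
    exact ⟨0, by rw [Subsingleton.elim a 0]; exact zero_mem _⟩
  | succ n ih =>
    intro A _ h b a
    let N := boundaryIdeal (b (Fin.last n))
    obtain ⟨x', k, hk⟩ := ih (ringKrullDim_boundary_lt (b (Fin.last n)) h)
      (fun i => Ideal.Quotient.mk N (b i.castSucc)) (Ideal.Quotient.mk N a)
    choose x hx using fun i => Ideal.Quotient.mk_surjective (x' i)
    obtain rfl : x' = fun i => Ideal.Quotient.mk N (x i) := by ext i; rw [hx]
    let I := Ideal.span (Set.range fun i : Fin n => b i.castSucc + a * x i)
    have hI : Ideal.span (Set.range fun i : Fin n => Ideal.Quotient.mk N (b i.castSucc)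
        + Ideal.Quotient.mk N a * Ideal.Quotient.mk N (x i)) = I.map (Ideal.Quotient.mk N) := by
      rw [Ideal.map_span]
      congr 1
      rw [← Set.range_comp]
      congr 1
    rw [hI, ← map_pow, ← Ideal.mem_comap, Ideal.comap_map_of_surjective _ Ideal.Quotient.mk_surjective,
      ← RingHom.ker_eq_comap_bot, Ideal.mk_ker, Submodule.mem_sup] at hk
    obtain ⟨y, hy, w, hw, hyw⟩ := hk
    obtain ⟨z, t, ht, rfl⟩ := mem_boundaryIdeal.1 hw
    -- Lifting the relation for `a ^ k` leaves a boundary element `z * b + t` with `b * t`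
    -- nilpotent, and `t` is the last coefficient. A prime containing all the new generators
    -- contains `b` or `t`, and containing `b + a * t` it then contains `a` or both of them.
    refine ⟨Fin.snoc x t, ?_⟩
    rw [Ideal.radical_eq_sInf, Ideal.mem_sInf]
    rintro p ⟨hp, hprime⟩
    have hmem : ∀ i, b i + a * (Fin.snoc x t : Fin (n + 1) → A) i ∈ p := fun i =>
      hp (Ideal.subset_span ⟨i, rfl⟩)
    have h1 : y ∈ p := by
      refine (Ideal.span_le.2 ?_ : I ≤ p) hy
      rintro _ ⟨i, rfl⟩
      simpa using hmem i.castSucc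
    have h2 := hmem (Fin.last n)
    rw [Fin.snoc_last] at h2
    have h3 : b (Fin.last n) * t ∈ p := by
      obtain ⟨m, hm⟩ := ht
      exact hprime.mem_of_pow_mem m (by rw [hm]; exact zero_mem _)
    rcases hprime.mem_or_mem h3 with hb | ht'
    · have h4 : a * t ∈ p := by simpa using sub_mem h2 hb
      rcases hprime.mem_or_mem h4 with h5 | h5
      · exact h5
      · exact hprime.mem_of_pow_mem k
          (hyw ▸ add_mem h1 (add_mem (Ideal.mul_mem_left _ _ hb) h5))
    · have hb : b (Fin.last n) ∈ p := by
        simpa using sub_mem h2 (Ideal.mul_mem_left _ a ht')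
      exact hprime.mem_of_pow_mem k
        (hyw ▸ add_mem h1 (add_mem (Ideal.mul_mem_left _ _ hb) ht'))

end Kronecker

/-! ### Bass' theorem for modules with local frames -/

section Bass

variable {R : Type u} [CommRing R]

/-- A partial frame of size `n` of `P` with multiplier `s`: the two families are dual to each other
up to `s`, and together they factor multiplication by `s`. -/
structure IsFrame {P : Type u} [AddCommGroup P] [Module R P] {n : ℕ} (s : R) (v : Fin n → P)
    (l : Fin n → Module.Dual R P) : Prop where
  dual : ∀ i j, l i (v j) = if i = j then s else 0
  expand : ∀ x, s • x = ∑ i, l i x • v i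

variable (R) in
/-- `P` has frames of size `n` around each prime. -/
def HasFrames (P : Type u) [AddCommGroup P] [Module R P] (n : ℕ) : Prop :=
  ∀ m : Ideal R, m.IsPrime → ∃ s ∉ m, ∃ (v : Fin n → P) (l : Fin n → Module.Dual R P),
    IsFrame s v l

/-- The ideal of values of linear forms at an element. -/
def orderIdeal {P : Type u} [AddCommGroup P] [Module R P] (p : P) : Ideal R :=
  LinearMap.range (Module.Dual.eval R P p)

theorem mem_orderIdeal {P : Type u} [AddCommGroup P] [Module R P] {p : P} {r : R} :
    r ∈ orderIdeal p ↔ ∃ l : Module.Dual R P, l p = r := Iff.rfl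

variable {P Q : Type u} [AddCommGroup P] [Module R P] [AddCommGroup Q] [Module R Q]

theorem HasFrames.prod {n : ℕ} (h : HasFrames R P n) : HasFrames R (P × R) (n + 1) := by
  intro m hm
  obtain ⟨s, hs, v, l, hvl⟩ := h m hm
  refine ⟨s, hs, Fin.snoc (fun i => (v i, 0)) (0, 1),
    Fin.snoc (fun i => l i ∘ₗ LinearMap.fst R P R) (s • LinearMap.snd R P R), ?_, ?_⟩
  · intro i j
    refine Fin.lastCases ?_ (fun i => ?_) i <;> refine Fin.lastCases ?_ (fun j => ?_) j
    · simp
    · simp [(Fin.castSucc_lt_last j).ne']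
    · simp [(Fin.castSucc_lt_last i).ne]
    · simp [hvl.dual]
  · rintro ⟨x, r⟩
    rw [Fin.sum_univ_castSucc]
    simp only [Fin.snoc_castSucc, Fin.snoc_last]
    refine Prod.ext ?_ ?_
    · simp [Prod.fst_sum, hvl.expand x]
    · simp [Prod.snd_sum]

theorem HasFrames.congr {n : ℕ} (h : HasFrames R P n) (e : P ≃ₗ[R] Q) : HasFrames R Q n := by
  intro m hm
  obtain ⟨s, hs, v, l, hvl⟩ := h m hm
  refine ⟨s, hs, fun i => e (v i), fun i => l i ∘ₗ e.symm.toLinearMap, ?_, ?_⟩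
  · intro i j; simp [hvl.dual]
  · intro x
    apply e.symm.injective
    simp [hvl.expand]

/-- One step in the proof of Bass' theorem: make `p` unimodular on the basic open set `D(s)`. -/
theorem exists_unimodular_on {n : ℕ} (hn : ringKrullDim R < (n : ℕ)) {s : R} {v : Fin n → P}
    {l : Fin n → Module.Dual R P} (hvl : IsFrame s v l) (p : P) (r : R)
    (h : orderIdeal p ⊔ Ideal.span {r} = ⊤) :
    ∃ q : P, (∀ m : Ideal R, m.IsPrime → orderIdeal (p + r • q) ≤ m →
      s ∈ m ∧ orderIdeal p ≤ m) := by
  -- One factor `s` comes from `l i (v i) = s`, the other from the coefficient `s` in the witness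
  -- below. That coefficient makes the change invisible modulo primes containing `s`, so nothing
  -- already achieved there is lost.
  obtain ⟨t, ht⟩ := exists_mem_radical_span hn (fun i => l i p) (s * s * r)
  refine ⟨s • ∑ i, t i • v i, fun m hm hle => ?_⟩
  set p' := p + r • s • ∑ i, t i • v i with hp'
  have hl : ∀ i, l i p' = l i p + s * s * r * t i := by
    intro i
    simp only [hp', map_add, map_smul, map_sum, smul_eq_mul, hvl.dual, mul_ite, mul_zero,
      Finset.sum_ite_eq, Finset.mem_univ, if_true]
    ring
  have hI : Ideal.span (Set.range fun i => l i p + s * s * r * t i) ≤ m := by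
    refine Ideal.span_le.2 ?_
    rintro _ ⟨i, rfl⟩
    exact hle ⟨l i, hl i⟩
  have hsr : s * s * r ∈ m := by
    rw [Ideal.mem_radical_iff] at ht
    obtain ⟨k, hk⟩ := ht
    exact hm.mem_of_pow_mem k (hI hk)
  have key : s ∈ m ∨ (orderIdeal p ≤ m ∧ r ∈ m) := by
    by_cases hs : s ∈ m
    · exact Or.inl hs
    refine Or.inr ?_
    have hr : r ∈ m := by
      rcases hm.mem_or_mem hsr with h1 | h1
      · exact absurd ((hm.mem_or_mem h1).elim id id) hs
      · exact h1
    refine ⟨?_, hr⟩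
    rintro _ ⟨f, rfl⟩
    have h1 : s * f p ∈ m := by
      have := congrArg f (hvl.expand p)
      rw [map_smul, smul_eq_mul, map_sum] at this
      rw [this]
      refine sum_mem fun i _ => ?_
      rw [map_smul, smul_eq_mul]
      refine Ideal.mul_mem_right _ _ ?_
      have h2 := hI (Ideal.subset_span ⟨i, rfl⟩)
      simpa using sub_mem h2 (Ideal.mul_mem_right (t i) _ (Ideal.mul_mem_left _ (s * s) hr))
    exact (hm.mem_or_mem h1).resolve_left hs
  rcases key with hs | ⟨h1, h2⟩
  · refine ⟨hs, ?_⟩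
    rintro _ ⟨f, rfl⟩
    have h1 : f p' ∈ m := hle ⟨f, rfl⟩
    have h2 : f p' = f p + s * (r * f (∑ i, t i • v i)) := by
      simp only [hp', map_add, map_smul, smul_eq_mul]; ring
    rw [h2] at h1
    exact (Ideal.add_mem_iff_left _ (Ideal.mul_mem_right _ _ hs)).1 h1
  · exfalso
    refine hm.ne_top (top_le_iff.1 (h ▸ sup_le h1 ?_))
    exact (Ideal.span_singleton_le_iff_mem _).2 h2

/-- Keeps the hypothesis on `p` and `r` valid for the next basic open set. -/
theorem orderIdeal_add_sup (p q : P) (r : R) :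
    orderIdeal p ⊔ Ideal.span {r} ≤ orderIdeal (p + r • q) ⊔ Ideal.span {r} := by
  refine sup_le ?_ le_sup_right
  rintro _ ⟨f, rfl⟩
  have : f p = f (p + r • q) + -(f q * r) := by simp [mul_comm]
  change f p ∈ _
  rw [this]
  exact add_mem (Ideal.mem_sup_left ⟨f, rfl⟩)
    (neg_mem (Ideal.mem_sup_right (Ideal.mul_mem_left _ _ (Ideal.mem_span_singleton_self r))))

/-- Finitely many sets `D(s)` with frames cover the spectrum. They are treated one at a time, and no
step creates a new prime at which the vector fails to be unimodular. -/
theorem exists_orderIdeal_add_eq_top {n : ℕ} (hn : ringKrullDim R < (n : ℕ))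
    (hP : HasFrames R P n) (p : P) (r : R) (h : orderIdeal p ⊔ Ideal.span {r} = ⊤) :
    ∃ q : P, orderIdeal (R := R) (p + r • q) = ⊤ := by
  classical
  let S : Set R := {s | ∃ (v : Fin n → P) (l : Fin n → Module.Dual R P), IsFrame s v l}
  have hS : Ideal.span S = ⊤ := by
    by_contra hne
    obtain ⟨m, hm, hle⟩ := Ideal.exists_le_maximal _ hne
    obtain ⟨s, hs, v, l, hvl⟩ := hP m hm.isPrime
    exact hs (hle (Ideal.subset_span ⟨v, l, hvl⟩))
  obtain ⟨T, hTS, hT⟩ := Submodule.mem_span_finite_of_mem_span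
    (show (1 : R) ∈ Submodule.span R S by rw [show Submodule.span R S = ⊤ from hS]; trivial)
  have main : ∀ T : Finset R, (T : Set R) ⊆ S → ∃ q : P, ∀ m : Ideal R, m.IsPrime →
      orderIdeal (R := R) (p + r • q) ≤ m → ∀ s ∈ T, s ∈ m := by
    intro T
    induction T using Finset.induction_on with
    | empty => exact fun _ => ⟨0, by simp⟩
    | insert s T _ ih =>
      intro hT
      rw [Finset.coe_insert, Set.insert_subset_iff] at hT
      obtain ⟨⟨v, l, hvl⟩, hT⟩ := hT
      obtain ⟨q, hq⟩ := ih hT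
      obtain ⟨q', hq'⟩ := exists_unimodular_on hn hvl (p + r • q) r
        (top_le_iff.1 (h ▸ orderIdeal_add_sup p q r))
      refine ⟨q + q', fun m hm hle => ?_⟩
      rw [smul_add, ← add_assoc] at hle
      obtain ⟨h1, h2⟩ := hq' m hm hle
      intro t ht
      rcases Finset.mem_insert.1 ht with rfl | ht
      · exact h1
      · exact hq m hm h2 t ht
  obtain ⟨q, hq⟩ := main T hTS
  refine ⟨q, ?_⟩
  by_contra hne
  obtain ⟨m, hm, hle⟩ := Ideal.exists_le_maximal _ hne
  have h1 : (1 : R) ∈ m :=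
    (Submodule.span_le.2 (hq m hm.isPrime hle) : Submodule.span R (T : Set R) ≤ m) hT
  exact hm.ne_top ((Ideal.eq_top_iff_one _).2 h1)

end Bass

end Vaserstein
end

noncomputable section
namespace Vaserstein

/-! ### Transvections along unimodular vectors are elementary -/

section Transvections

variable {R : Type u} [CommRing R] {W : Type u} [AddCommGroup W] [Module R W]

open Module (Dual)

/-- The map `x ↦ x + f(x) u` belongs to `H`. -/
def HasTransvection (H : Subgroup (W ≃ₗ[R] W)) (u : W) (f : Dual R W) : Prop :=
  ∃ φ ∈ H, ∀ x, φ x = x + f x • u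

variable {H : Subgroup (W ≃ₗ[R] W)}

theorem HasTransvection.of_eq {u u' : W} {f f' : Dual R W} (h : HasTransvection H u f)
    (e : ∀ x, f x • u = f' x • u') : HasTransvection H u' f' := by
  obtain ⟨φ, hφ, h⟩ := h
  exact ⟨φ, hφ, fun x => by rw [h, e]⟩

theorem HasTransvection.add_left {u u' : W} {f : Dual R W} (h : HasTransvection H u f)
    (h' : HasTransvection H u' f) (hu : f u' = 0) : HasTransvection H (u + u') f := by
  obtain ⟨φ, hφ, h⟩ := h
  obtain ⟨φ', hφ', h'⟩ := h'
  refine ⟨φ * φ', mul_mem hφ hφ', fun x => ?_⟩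
  simp only [LinearEquiv.mul_apply, h, h', map_add, map_smul, hu, smul_zero, add_zero]
  module

theorem HasTransvection.add_right {u : W} {f g : Dual R W} (h : HasTransvection H u f)
    (h' : HasTransvection H u g) (hu : f u = 0) : HasTransvection H u (f + g) := by
  obtain ⟨φ, hφ, h⟩ := h
  obtain ⟨φ', hφ', h'⟩ := h'
  refine ⟨φ * φ', mul_mem hφ hφ', fun x => ?_⟩
  simp only [LinearEquiv.mul_apply, h, h', map_add, map_smul, hu, smul_zero, add_zero,
    LinearMap.add_apply]
  module

/-- The commutator of `1 + u ⊗ f` and `1 + v ⊗ g` is `1 + f(v) u ⊗ g` when the other three pairings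
vanish. -/
theorem HasTransvection.commutator {u v : W} {f g : Dual R W} (h : HasTransvection H u f)
    (h' : HasTransvection H v g) (hfu : f u = 0) (hgu : g u = 0) (hgv : g v = 0) :
    HasTransvection H (f v • u) g := by
  obtain ⟨φ, hφ, h⟩ := h
  obtain ⟨ψ, hψ, h'⟩ := h'
  have hi : ∀ x, φ⁻¹ x = x - f x • u := fun x => by
    apply φ.injective
    rw [← LinearEquiv.mul_apply, mul_inv_cancel, h]
    simp [hfu]
  have hi' : ∀ x, ψ⁻¹ x = x - g x • v := fun x => by
    apply ψ.injective
    rw [← LinearEquiv.mul_apply, mul_inv_cancel, h']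
    simp [hgv]
  refine ⟨φ * ψ * φ⁻¹ * ψ⁻¹, mul_mem (mul_mem (mul_mem hφ hψ) (inv_mem hφ)) (inv_mem hψ),
    fun x => ?_⟩
  simp only [LinearEquiv.mul_apply, h, h', hi, hi', map_sub, map_add, map_smul, hfu, hgu, hgv,
    smul_eq_mul]
  module

variable {e : W} {d : Dual R W} (hde : d e = 1)
  (hrow : ∀ f : Dual R W, f e = 0 → HasTransvection H e f)
  (hcol : ∀ u : W, d u = 0 → HasTransvection H u d)

include hde hrow hcol

/-- In the decomposition `W = Re ⊕ ker d`, `hrow` supplies the elementary maps into `Re` and `hcol`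
those out of it. As `d e = 1`, the commutator of the column along `u` and the row with form `f` is
the transvection sought. -/
theorem hasTransvection_of_complement {u : W} {f : Dual R W} (hu : d u = 0) (hf : f e = 0)
    (hfu : f u = 0) : HasTransvection H u f :=
  ((hcol u hu).commutator (hrow f hf) hu hfu hf).of_eq fun x => by rw [hde, one_smul]

/-- The vector `u` is split into its components in `ker d` and `Re`. -/
theorem hasTransvection_of_form {u : W} {f : Dual R W} (hf : f e = 0) (hfu : f u = 0) :
    HasTransvection H u f := by
  have h1 : HasTransvection H (u - d u • e) f :=
    hasTransvection_of_complement hde hrow hcol (by simp [hde]) hf (by simp [hf, hfu])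
  have h2 : HasTransvection H (d u • e) f :=
    (hrow (d u • f) (by simp [hf])).of_eq fun x => by
      simp only [LinearMap.smul_apply, smul_eq_mul]; module
  exact (h1.add_left h2 (by simp [hf])).of_eq fun x => by module

/-- Dually, `f` is split into a form vanishing at `e` and a multiple of `d`. -/
theorem hasTransvection_of_vector {u : W} {f : Dual R W} (hu : d u = 0) (hfu : f u = 0) :
    HasTransvection H u f := by
  have h1 : HasTransvection H u (f - f e • d) :=
    hasTransvection_of_complement hde hrow hcol hu (by simp [hde]) (by simp [hu, hfu])
  have h2 : HasTransvection H u (f e • d) :=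
    (hcol (f e • u) (by simp [hu])).of_eq fun x => by
      simp only [LinearMap.smul_apply, smul_eq_mul]; module
  exact (h1.add_right h2 (by simp [hu, hfu])).of_eq fun x => by simp

/-- The transvections along `w` with a form in the plane of `m` and `d` vanishing at `w`. -/
theorem hasTransvection_of_pair (w : W) {s : R} {v₁ v₂ : W} {l₁ l₂ : Dual R W}
    (hv₁ : d v₁ = 0) (hv₂ : d v₂ = 0) (hl₁ : l₁ e = 0) (hl₂ : l₂ e = 0)
    (h11 : l₁ v₁ = s) (h12 : l₁ v₂ = 0) (h21 : l₂ v₁ = 0) (h22 : l₂ v₂ = s) (c : R) :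
    HasTransvection H w (c • s • s • (d w • l₁ - l₁ w • d)) := by
  -- The vector `u` satisfies `g u = 0` and has the same `d` as `s • w`. So `s • w - u` falls under
  -- the case of vectors in `ker d`, and `u` itself is reached by a commutator through the second
  -- frame vector `v₂`, on which `g` vanishes and `l₂` takes the value `s`.
  set g : Dual R W := c • (d w • l₁ - l₁ w • d) with hg
  set u : W := l₁ w • v₁ + (s * d w) • e with hu
  have hgv : g v₂ = 0 := by simp [hg, h12, hv₂]
  have hgu : g u = 0 := by simp [hg, hu, h11, hl₁, hv₁, hde]; ring
  have hl2u : l₂ u = 0 := by simp [hu, h21, hl₂]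
  have h1 : HasTransvection H u l₂ := hasTransvection_of_form hde hrow hcol hl₂ hl2u
  have h2 : HasTransvection H v₂ g := hasTransvection_of_vector hde hrow hcol hv₂ hgv
  have h3 : HasTransvection H u (s • g) := (h1.commutator h2 hl2u hgu hgv).of_eq fun x => by
    rw [h22, show (s • g) x = s * g x from rfl]; module
  have h4 : HasTransvection H (s • w - u) (s • g) :=
    hasTransvection_of_vector hde hrow hcol (by simp [hu, hv₁, hde])
      (by simp [hg, hu, hv₁, hde, h11, hl₁]; ring)
  refine (h3.add_left h4 ?_).of_eq fun x => ?_
  · simp [hg, hu, hv₁, hde, h11, hl₁]; ring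
  · simp only [hg, LinearMap.smul_apply, smul_eq_mul]; module

/-- If the complement of `e` has frames of size at least two, then the transvections along
unimodular vectors are generated by the elementary ones. -/
theorem hasTransvection_of_unimodular
    (hfr : ∀ m : Ideal R, m.IsPrime → ∃ s ∉ m, ∃ (n : ℕ) (v : Fin n → W) (l : Fin n → Dual R W),
      2 ≤ n ∧ (∀ i, d (v i) = 0) ∧ (∀ i, l i e = 0) ∧
      (∀ i j, l i (v j) = if i = j then s else 0) ∧
      ∀ x, s • x = ∑ i, l i x • v i + (s * d x) • e)
    {w : W} {a f : Dual R W} (ha : a w = 1) (hf : f w = 0) : HasTransvection H w f := by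
  have plane : ∀ m : Dual R W, m e = 0 → HasTransvection H w (d w • m - m w • d) := by
    intro m hm
    -- Asking for all multiples `c` makes the good forms a submodule, so that membership of `m` can
    -- be tested locally. There `s ^ 3 • m` is a combination of the forms `s • s • l i`.
    let A : Submodule R (Dual R W) :=
      { carrier := {m | ∀ c : R, HasTransvection H w (c • (d w • m - m w • d))}
        add_mem' := fun {m m'} h h' c => ((h c).add_right (h' c) (by simp; ring)).of_eq fun x => by
          simp only [LinearMap.add_apply, LinearMap.sub_apply, LinearMap.smul_apply, smul_eq_mul]
          module
        zero_mem' := fun c => ⟨1, one_mem _, by simp⟩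
        smul_mem' := fun r m h c => (h (c * r)).of_eq fun x => by
          simp only [LinearMap.sub_apply, LinearMap.smul_apply, smul_eq_mul]
          module }
    suffices hmA : m ∈ A by simpa using hmA 1
    by_contra hmA
    have hne : A.comap (LinearMap.toSpanSingleton R (Dual R W) m) ≠ ⊤ := by
      intro ht
      apply hmA
      have : (1 : R) ∈ A.comap (LinearMap.toSpanSingleton R (Dual R W) m) := by
        rw [ht]; trivial
      simpa using this
    obtain ⟨p, hp, hle⟩ := Ideal.exists_le_maximal _ hne
    obtain ⟨s, hs, n, v, l, hn, hv, hl, hvl, hx⟩ := hfr p hp.isPrime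
    refine hs (hp.isPrime.mem_of_pow_mem 3 (hle ?_))
    rw [Submodule.mem_comap]
    have h3 : LinearMap.toSpanSingleton R (Dual R W) m (s ^ 3)
        = ∑ i, m (v i) • (s • s • l i) := by
      ext x
      have := congrArg m (hx x)
      simp only [map_add, map_smul, map_sum, smul_eq_mul, hm, mul_zero, add_zero] at this
      simp only [LinearMap.toSpanSingleton_apply, LinearMap.smul_apply, smul_eq_mul,
        LinearMap.sum_apply]
      calc s ^ 3 * m x = s * s * (s * m x) := by ring
        _ = _ := by
          rw [this, Finset.mul_sum]
          exact Finset.sum_congr rfl fun i _ => by ring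
    rw [h3]
    refine sum_mem fun i _ => A.smul_mem _ fun c => ?_
    -- Rank at least two supplies the auxiliary index `j`.
    have : Nontrivial (Fin n) := Fin.nontrivial_iff_two_le.2 hn
    obtain ⟨j, hj⟩ := exists_ne i
    refine (hasTransvection_of_pair (s := s) hde hrow hcol w (hv i) (hv j) (hl i) (hl j)
      (by simp [hvl]) (by simp [hvl, hj.symm]) (by simp [hvl, hj]) (by simp [hvl]) c).of_eq
      fun x => ?_
    simp only [LinearMap.sub_apply, LinearMap.smul_apply, smul_eq_mul]
    module
  -- Since `a w = 1` and `f w = 0`, one has `f = a(w) f - f(w) a`. Removing the `d`-components from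
  -- `a` and `f` splits this into a part vanishing at `e` and a part treated by `plane`.
  set a₀ : Dual R W := a - a e • d with ha₀
  set f₀ : Dual R W := f - f e • d with hf₀
  have ha₀e : a₀ e = 0 := by simp [ha₀, hde]
  have hf₀e : f₀ e = 0 := by simp [hf₀, hde]
  have h1 : HasTransvection H w (a₀ w • f₀ - f₀ w • a₀) :=
    hasTransvection_of_form hde hrow hcol (by simp [ha₀e, hf₀e]) (by simp; ring)
  have h2 := plane (a e • f₀ - f e • a₀) (by simp [ha₀e, hf₀e])
  refine (h1.add_right h2 (by simp; ring)).of_eq fun x => ?_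
  congr 1
  simp only [ha₀, hf₀, LinearMap.add_apply, LinearMap.sub_apply, LinearMap.smul_apply,
    smul_eq_mul, ha, hf]
  ring

end Transvections

end Vaserstein
end

noncomputable section
namespace Vaserstein

/-! ### Pfaffians -/

section Pfaffian

open Equiv

variable {n : ℕ}

/-- A permutation of `Fin n × Fin 2` describing a perfect matching in its normal form. -/
def IsNormalized (σ : Perm (Fin n × Fin 2)) : Prop :=
  (∀ i, finProdFinEquiv (σ (i, 0)) < finProdFinEquiv (σ (i, 1))) ∧
    (∀ i j, i < j → finProdFinEquiv (σ (i, 0)) < finProdFinEquiv (σ (j, 0)))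

instance : DecidablePred (IsNormalized (n := n)) := fun _ => instDecidableAnd

/-- The fixed-point free involution exchanging the partners of the standard matching. -/
def partner (n : ℕ) : Perm (Fin n × Fin 2) := prodCongrRight fun _ => swap 0 1

theorem partner_zero (i : Fin n) : partner n (i, 0) = (i, 1) := by simp [partner]

theorem partner_one (i : Fin n) : partner n (i, 1) = (i, 0) := by simp [partner]

theorem partner_ne (a : Fin n × Fin 2) : partner n a ≠ a := by
  obtain ⟨i, k⟩ := a
  fin_cases k <;> simp [partner]

/-- Sortedness inside the pairs forces `η` to preserve first entries, so `η` only permutes the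
pairs. Sortedness of the pairs makes that permutation monotone, hence trivial. Thus each matching, a
coset of the centralizer of `partner`, has one normal form. -/
theorem eq_one_of_isNormalized {σ η : Perm (Fin n × Fin 2)} (hη : Commute η (partner n))
    (h : IsNormalized σ) (h' : IsNormalized (σ * η)) : η = 1 := by
  have hc : ∀ a, η (partner n a) = partner n (η a) := fun a => Perm.congr_fun hη a
  have h0 : ∀ i, (η (i, 0)).2 = 0 := by
    intro i
    by_contra hk
    have hk1 : η (i, 0) = ((η (i, 0)).1, 1) := Prod.ext rfl (Fin.eq_one_of_ne_zero _ hk)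
    have h1 : η (i, 1) = ((η (i, 0)).1, 0) := by
      rw [← partner_zero, hc, hk1, partner_one]
    have h2 := h'.1 i
    rw [Perm.mul_apply, Perm.mul_apply, h1, hk1] at h2
    exact lt_asymm h2 (h.1 _)
  let π : Fin n → Fin n := fun i => (η (i, 0)).1
  have hπ0 : ∀ i, η (i, 0) = (π i, 0) := fun i => Prod.ext rfl (h0 i)
  have hπ1 : ∀ i, η (i, 1) = (π i, 1) := fun i => by
    rw [← partner_zero, hc, hπ0, partner_zero]
  have hσ : StrictMono fun i => finProdFinEquiv (σ (i, 0)) := fun i j hij => h.2 i j hij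
  have hmono : StrictMono π := by
    intro i j hij
    have := h'.2 i j hij
    rw [Perm.mul_apply, Perm.mul_apply, hπ0, hπ0] at this
    exact hσ.lt_iff_lt.1 this
  have hid : π = id := hmono.eq_id
  ext1 ⟨i, k⟩
  fin_cases k
  · simpa [hid] using hπ0 i
  · simpa [hid] using hπ1 i

/-- The factor that sorts each pair of the matching. -/
def sortPairs (σ : Perm (Fin n × Fin 2)) : Perm (Fin n × Fin 2) :=
  prodCongrRight fun i =>
    if finProdFinEquiv (σ (i, 0)) < finProdFinEquiv (σ (i, 1)) then 1 else swap 0 1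

/-- The factor that sorts the pairs of the matching by their first elements. -/
def sortBlocks (σ : Perm (Fin n × Fin 2)) : Perm (Fin n × Fin 2) :=
  prodCongrLeft fun _ => Tuple.sort fun i => finProdFinEquiv (σ (i, 0))

theorem commute_sortPairs (σ : Perm (Fin n × Fin 2)) : Commute (sortPairs σ) (partner n) := by
  ext1 ⟨i, k⟩
  simp only [sortPairs, partner, Perm.mul_apply, prodCongrRight_apply]
  split_ifs <;> simp

theorem commute_sortBlocks (σ : Perm (Fin n × Fin 2)) : Commute (sortBlocks σ) (partner n) := by
  ext1 ⟨i, k⟩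
  simp [sortBlocks, partner, Perm.mul_apply]

/-- The normal form of the perfect matching described by `σ`. -/
def normalize (σ : Perm (Fin n × Fin 2)) : Perm (Fin n × Fin 2) :=
  σ * sortPairs σ * sortBlocks (σ * sortPairs σ)

theorem isNormalized_normalize (σ : Perm (Fin n × Fin 2)) : IsNormalized (normalize σ) := by
  set σ' := σ * sortPairs σ with hσ'
  have h1 : ∀ i, finProdFinEquiv (σ' (i, 0)) < finProdFinEquiv (σ' (i, 1)) := by
    intro i
    simp only [hσ', Perm.mul_apply, sortPairs, prodCongrRight_apply]
    split_ifs with h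
    · simpa using h
    · refine lt_of_le_of_ne (by simpa using h) ?_
      simp
  refine ⟨fun i => ?_, fun i j hij => ?_⟩
  · simpa [normalize, ← hσ', sortBlocks] using h1 _
  · have hm := Tuple.monotone_sort fun i => finProdFinEquiv (σ' (i, 0))
    have hi : Function.Injective ((fun i => finProdFinEquiv (σ' (i, 0))) ∘
        Tuple.sort fun i => finProdFinEquiv (σ' (i, 0))) := by
      refine Function.Injective.comp (fun a b hab => ?_) (Equiv.injective _)
      simpa using hab
    simpa [normalize, ← hσ', sortBlocks] using hm.strictMono_of_injective hi hij

theorem exists_normalize_eq (σ : Perm (Fin n × Fin 2)) :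
    ∃ η, Commute η (partner n) ∧ normalize σ = σ * η :=
  ⟨_, (commute_sortPairs σ).mul_left (commute_sortBlocks _), mul_assoc _ _ _⟩

theorem normalize_mul {σ η : Perm (Fin n × Fin 2)} (hσ : IsNormalized σ)
    (hη : Commute η (partner n)) : normalize (σ * η) = σ := by
  obtain ⟨θ, hθ, h⟩ := exists_normalize_eq (σ * η)
  rw [h, mul_assoc, eq_one_of_isNormalized (hη.mul_left hθ) hσ, mul_one]
  rw [← mul_assoc, ← h]
  exact isNormalized_normalize _

variable {R : Type*} [CommRing R] {V : Type*} [AddCommGroup V] [Module R V]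

/-- The contribution of a perfect matching to the Pfaffian. -/
def pfTerm (f : V →ₗ[R] V →ₗ[R] R) (σ : Perm (Fin n × Fin 2)) (x : Fin n × Fin 2 → V) : R :=
  ((Perm.sign σ : ℤ) : R) * ∏ i, f (x (σ (i, 0))) (x (σ (i, 1)))

/-- Permuting the pairs acts twice by the same permutation, so its sign is a square. -/
theorem pfTerm_mul_prodCongrLeft (f : V →ₗ[R] V →ₗ[R] R) (σ : Perm (Fin n × Fin 2))
    (x : Fin n × Fin 2 → V) (π : Perm (Fin n)) :
    pfTerm f (σ * prodCongrLeft fun _ => π) x = pfTerm f σ x := by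
  have hs : Perm.sign (prodCongrLeft fun _ : Fin 2 => π) = 1 := by
    rw [Perm.sign_prodCongrLeft]
    simp
  simp only [pfTerm, Perm.sign_mul, hs, mul_one, Perm.mul_apply, prodCongrLeft_apply]
  congr 1
  exact Equiv.prod_comp π fun i => f (x (σ (i, 0))) (x (σ (i, 1)))

/-- Exchanging the entries of a pair changes the sign of the permutation and the sign of one factor.
-/
theorem pfTerm_mul_prodCongrRight {f : V →ₗ[R] V →ₗ[R] R} (hf : ∀ v, f v v = 0)
    (σ : Perm (Fin n × Fin 2)) (x : Fin n × Fin 2 → V) (τ : Fin n → Perm (Fin 2)) :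
    pfTerm f (σ * prodCongrRight τ) x = pfTerm f σ x := by
  have hswap : ∀ v w, f v w = - f w v := fun v w => by
    have h := hf (v + w)
    simp only [map_add, LinearMap.add_apply, hf, zero_add, add_zero] at h
    linear_combination h
  have ht : ∀ i, f (x (σ (i, τ i 0))) (x (σ (i, τ i 1)))
      = ((Perm.sign (τ i) : ℤ) : R) * f (x (σ (i, 0))) (x (σ (i, 1))) := by
    intro i
    have : τ i = 1 ∨ τ i = swap 0 1 := by
      generalize τ i = t
      revert t
      decide
    rcases this with h | h
    · simp [h]
    · rw [h, swap_apply_left, swap_apply_right, Perm.sign_swap (by decide), hswap]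
      simp
  simp only [pfTerm, Perm.sign_mul, Perm.sign_prodCongrRight, Perm.mul_apply, prodCongrRight_apply,
    ht, Finset.prod_mul_distrib]
  rw [← mul_assoc]
  congr 1
  have h2 : (∏ i, ((Perm.sign (τ i) : ℤ) : R)) * ∏ i, ((Perm.sign (τ i) : ℤ) : R) = 1 := by
    rw [← Finset.prod_mul_distrib]
    refine Finset.prod_eq_one fun i _ => ?_
    rw [← Int.cast_mul, ← Units.val_mul, Int.units_mul_self]
    simp
  push_cast
  rw [mul_assoc, h2, mul_one]

theorem pfTerm_normalize {f : V →ₗ[R] V →ₗ[R] R} (hf : ∀ v, f v v = 0)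
    (σ : Perm (Fin n × Fin 2)) (x : Fin n × Fin 2 → V) :
    pfTerm f (normalize σ) x = pfTerm f σ x := by
  rw [normalize, sortBlocks, pfTerm_mul_prodCongrLeft, sortPairs, pfTerm_mul_prodCongrRight hf]

/-- Each vector enters exactly one factor of the product. -/
theorem pfTerm_update_linear (f : V →ₗ[R] V →ₗ[R] R) (σ : Perm (Fin n × Fin 2))
    (x : Fin n × Fin 2 → V) (a : Fin n × Fin 2) :
    ∃ l : V →ₗ[R] R, ∀ v, pfTerm f σ (Function.update x a v) = l v := by
  obtain ⟨⟨j, k⟩, rfl⟩ := σ.surjective a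
  have hne : ∀ i ≠ j, ∀ k', σ (i, k') ≠ σ (j, k) := fun i hi k' h => by
    simp only [EmbeddingLike.apply_eq_iff_eq, Prod.mk.injEq] at h
    exact hi h.1
  have h : ∀ v, pfTerm f σ (Function.update x (σ (j, k)) v)
      = (((Perm.sign σ : ℤ) : R) * ∏ i ∈ Finset.univ.erase j, f (x (σ (i, 0))) (x (σ (i, 1))))
        * f (Function.update x (σ (j, k)) v (σ (j, 0)))
          (Function.update x (σ (j, k)) v (σ (j, 1))) := by
    intro v
    rw [pfTerm, ← Finset.prod_erase_mul _ _ (Finset.mem_univ j), ← mul_assoc]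
    congr 2
    refine Finset.prod_congr rfl fun i hi => ?_
    rw [Function.update_of_ne (hne i (Finset.ne_of_mem_erase hi) 0),
      Function.update_of_ne (hne i (Finset.ne_of_mem_erase hi) 1)]
  have hk : k = 0 ∨ k = 1 := by omega
  rcases hk with rfl | rfl
  · refine ⟨(((Perm.sign σ : ℤ) : R) * ∏ i ∈ Finset.univ.erase j,
      f (x (σ (i, 0))) (x (σ (i, 1)))) • f.flip (x (σ (j, 1))), fun v => ?_⟩
    rw [h]
    simp
  · refine ⟨(((Perm.sign σ : ℤ) : R) * ∏ i ∈ Finset.univ.erase j,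
      f (x (σ (i, 0))) (x (σ (i, 1)))) • f (x (σ (j, 0))), fun v => ?_⟩
    rw [h]
    simp

/-- The Pfaffian of the Gram matrix, as an alternating map. -/
def pfMap (f : V →ₗ[R] V →ₗ[R] R) (hf : ∀ v, f v v = 0) (n : ℕ) :
    V [⋀^Fin n × Fin 2]→ₗ[R] R where
  toFun x := ∑ σ : Perm (Fin n × Fin 2) with IsNormalized σ, pfTerm f σ x
  map_update_add' {dec} x a v w := by
    obtain rfl : dec = instDecidableEqProd := Subsingleton.elim _ _
    rw [← Finset.sum_add_distrib]
    refine Finset.sum_congr rfl fun σ _ => ?_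
    obtain ⟨l, hl⟩ := pfTerm_update_linear f σ x a
    simp only [hl, map_add]
  map_update_smul' {dec} x a c v := by
    obtain rfl : dec = instDecidableEqProd := Subsingleton.elim _ _
    rw [smul_eq_mul, Finset.mul_sum]
    refine Finset.sum_congr rfl fun σ _ => ?_
    obtain ⟨l, hl⟩ := pfTerm_update_linear f σ x a
    simp only [hl, map_smul, smul_eq_mul]
  map_eq_zero_of_eq' x a b hab hne := by
    have hsymm : ∀ σ, pfTerm f (swap a b * σ) x = - pfTerm f σ x := by
      intro σ
      have hx : ∀ c, x (swap a b c) = x c := by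
        intro c
        rw [swap_apply_def]
        split_ifs with h1 h2
        · rw [h1, hab]
        · rw [h2, hab]
        · rfl
      simp [pfTerm, Perm.sign_mul, Perm.sign_swap hne, Perm.mul_apply, hx]
    -- Exchanging `a` and `b` in a matching pairs off terms of opposite sign. A matching fixed by
    -- this contains the pair `{a, b}`, so its term has a factor of `f` on two equal vectors.
    refine Finset.sum_involution (fun σ _ => normalize (swap a b * σ)) ?_ ?_ ?_ ?_
    · intro σ _
      rw [pfTerm_normalize hf, hsymm, add_neg_cancel]
    · intro σ _ h0 hfix
      apply h0
      obtain ⟨η, hη, h⟩ := exists_normalize_eq (swap a b * σ)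
      obtain ⟨c, rfl⟩ := σ.surjective a
      obtain ⟨d, rfl⟩ := σ.surjective b
      have hcd : c ≠ d := fun h => hne (by rw [h])
      have hη' : η = swap c d := by
        rw [hfix, mul_assoc] at h
        have h2 : swap (σ c) (σ d) * σ = σ * η := by
          refine (congrArg (swap (σ c) (σ d) * ·) h).trans ?_
          simp only [← mul_assoc, swap_mul_self, one_mul]
        rw [← mul_swap_eq_swap_mul] at h2
        exact (mul_left_cancel h2).symm
      have hpart : partner n c = d := by
        have h3 := Perm.congr_fun hη c
        rw [hη', Perm.mul_apply, Perm.mul_apply, swap_apply_left] at h3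
        by_contra hcon
        rw [swap_apply_of_ne_of_ne (partner_ne c) hcon] at h3
        exact hcd ((partner n).injective h3)
      rw [pfTerm]
      refine mul_eq_zero_of_right _ (Finset.prod_eq_zero (Finset.mem_univ c.1) ?_)
      obtain ⟨i, k⟩ := c
      have hk : k = 0 ∨ k = 1 := by omega
      rcases hk with rfl | rfl
      · rw [partner_zero] at hpart
        rw [← hpart] at hab
        rw [hab, hf]
      · rw [partner_one] at hpart
        rw [← hpart] at hab
        rw [hab, hf]
    · intro σ _
      simpa using isNormalized_normalize _
    · intro σ hσ
      obtain ⟨η, hη, h⟩ := exists_normalize_eq (swap a b * σ)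
      simp only [h]
      rw [← mul_assoc, ← mul_assoc, swap_mul_self, one_mul]
      exact normalize_mul (by simpa using hσ) hη

theorem pfMap_apply (f : V →ₗ[R] V →ₗ[R] R) (hf : ∀ v, f v v = 0) (x : Fin n × Fin 2 → V) :
    pfMap f hf n x = ∑ σ : Perm (Fin n × Fin 2) with IsNormalized σ, pfTerm f σ x := rfl

theorem pfMap_smul (c : R) (f : V →ₗ[R] V →ₗ[R] R) (hf : ∀ v, f v v = 0)
    (hf' : ∀ v, (c • f) v v = 0) (x : Fin n × Fin 2 → V) :
    pfMap (c • f) hf' n x = c ^ n * pfMap f hf n x := by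
  rw [pfMap_apply, pfMap_apply, Finset.mul_sum]
  refine Finset.sum_congr rfl fun σ _ => ?_
  simp [pfTerm, Finset.prod_mul_distrib]
  ring

/-- An alternating map of top degree is a multiple of the determinant of the basis. -/
theorem pfMap_comp_end (b : Module.Basis (Fin n × Fin 2) R V) (f : V →ₗ[R] V →ₗ[R] R)
    (hf : ∀ v, f v v = 0) (N : V →ₗ[R] V) (x : Fin n × Fin 2 → V) :
    pfMap f hf n (N ∘ x) = LinearMap.det N * pfMap f hf n x := by
  have h := (pfMap f hf n).eq_smul_basis_det b
  rw [h, AlternatingMap.smul_apply, AlternatingMap.smul_apply, Module.Basis.det_comp]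
  simp only [smul_eq_mul]
  ring

end Pfaffian

theorem AltIso.pfaffian_eq {R : Type u} [CommRing R] {n : ℕ} (f : AltIso R (Fin n × Fin 2 → R)) :
    f.pfaffian = pfMap f.form f.alt n (fun a => Pi.single a 1) := rfl

/-- Only the standard matching avoids zero entries. -/
theorem AltIso.pfaffian_psi {R : Type u} [CommRing R] (n : ℕ) : (AltIso.psi R n).pfaffian = 1 := by
  have hpsi : ∀ a b : Fin n × Fin 2, b ≠ partner n a →
      (AltIso.psi R n).form (Pi.single a 1) (Pi.single b 1) = 0 := by
    rintro ⟨i, k⟩ ⟨j, k'⟩ h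
    have hk : k = 0 ∨ k = 1 := by omega
    have hk' : k' = 0 ∨ k' = 1 := by omega
    rcases hk with rfl | rfl <;> rcases hk' with rfl | rfl <;>
      simp [AltIso.psi, partner, Pi.single_apply, Prod.ext_iff] at h ⊢ <;>
      (intro h1; exact absurd h1 h)
  rw [AltIso.pfaffian_eq, pfMap_apply, Finset.sum_eq_single 1]
  · simp [pfTerm, AltIso.psi, Pi.single_apply, Prod.ext_iff]
  · intro σ hσ hne
    have hn : ¬ Commute σ (partner n) := by
      intro hc
      refine hne (eq_one_of_isNormalized (σ := 1) hc ?_ (by simpa using hσ))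
      refine ⟨fun i => ?_, fun i j hij => ?_⟩
      · simp [finProdFinEquiv]
      · rw [Fin.lt_def] at hij ⊢
        simpa [finProdFinEquiv] using hij
    have : ∃ i, σ (i, 1) ≠ partner n (σ (i, 0)) := by
      by_contra! hcon
      refine hn (Equiv.ext fun a => ?_)
      obtain ⟨i, k⟩ := a
      have hk : k = 0 ∨ k = 1 := by omega
      have hinv : ∀ a, partner n (partner n a) = a := by
        rintro ⟨i, k⟩
        simp [partner]
      rcases hk with rfl | rfl
      · simp [Equiv.Perm.mul_apply, partner_zero, hcon]
      · simp [Equiv.Perm.mul_apply, partner_one, hcon, hinv]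
    obtain ⟨i, hi⟩ := this
    exact mul_eq_zero_of_right _ (Finset.prod_eq_zero (Finset.mem_univ i) (hpsi _ _ hi))
  · intro h
    refine absurd ?_ h
    simp only [Finset.mem_filter, Finset.mem_univ, true_and]
    refine ⟨fun i => ?_, fun i j hij => ?_⟩
    · simp [finProdFinEquiv]
    · rw [Fin.lt_def] at hij ⊢
      simpa [finProdFinEquiv] using hij

end Vaserstein
end

noncomputable section
namespace Vaserstein

/-! ### Isometries of alternating forms and cancellation -/

section Isometries

variable {R : Type u} [CommRing R] {P Q P' Q' : Type u} [AddCommGroup P] [Module R P]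
  [AddCommGroup Q] [Module R Q] [AddCommGroup P'] [Module R P'] [AddCommGroup Q'] [Module R Q']

namespace AltIso

theorem ext_form {f g : AltIso R P} (h : ∀ p q, f.form p q = g.form p q) : f = g := by
  cases f
  cases g
  simp only [AltIso.mk.injEq]
  exact LinearMap.ext₂ h

@[simp] theorem pull_form (h : P ≃ₗ[R] Q) (f : AltIso R Q) (p q : P) :
    (f.pull h).form p q = f.form (h p) (h q) := rfl

@[simp] theorem perp_form (f : AltIso R P) (g : AltIso R Q) (x y : P × Q) :
    (f.perp g).form x y = f.form x.1 y.1 + g.form x.2 y.2 := rfl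

@[simp] theorem psi2_form (x y : R × R) :
    (AltIso.psi2 R).form x y = x.1 * y.2 - x.2 * y.1 := rfl

theorem psi_form (n : ℕ) (x y : Fin n × Fin 2 → R) :
    (AltIso.psi R n).form x y = ∑ i, (x (i, 0) * y (i, 1) - x (i, 1) * y (i, 0)) := rfl

theorem form_neg (f : AltIso R P) (p q : P) : f.form q p = - f.form p q := form_swap f.alt p q

theorem form_injective (f : AltIso R P) {p : P} (h : ∀ q, f.form p q = 0) : p = 0 :=
  (injective_iff_map_eq_zero f.form).1 f.bij.1 p (LinearMap.ext h)

/-- Two alternating forms are isometric. -/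
def Isometric (f : AltIso R P) (g : AltIso R Q) : Prop := ∃ h : P ≃ₗ[R] Q, f = g.pull h

theorem Isometric.refl (f : AltIso R P) : f.Isometric f := ⟨LinearEquiv.refl R P, rfl⟩

theorem Isometric.symm {f : AltIso R P} {g : AltIso R Q} (h : f.Isometric g) : g.Isometric f := by
  obtain ⟨h, rfl⟩ := h
  exact ⟨h.symm, (pull_symm_pull h g).symm⟩

theorem Isometric.trans {f : AltIso R P} {g : AltIso R Q} {k : AltIso R P'} (h : f.Isometric g)
    (h' : g.Isometric k) : f.Isometric k := by
  obtain ⟨h, rfl⟩ := h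
  obtain ⟨h', rfl⟩ := h'
  exact ⟨h.trans h', rfl⟩

theorem Isometric.perp {f : AltIso R P} {f' : AltIso R P'} {g : AltIso R Q} {g' : AltIso R Q'}
    (h : f.Isometric f') (h' : g.Isometric g') : (f.perp g).Isometric (f'.perp g') := by
  obtain ⟨h, rfl⟩ := h
  obtain ⟨h', rfl⟩ := h'
  exact ⟨h.prodCongr h', rfl⟩

theorem isometric_perp_comm (f : AltIso R P) (g : AltIso R Q) :
    (f.perp g).Isometric (g.perp f) :=
  ⟨LinearEquiv.prodComm R P Q, ext_form fun p q => by simp [add_comm]⟩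

theorem isometric_perp_assoc (f : AltIso R P) (g : AltIso R Q) (k : AltIso R P') :
    ((f.perp g).perp k).Isometric (f.perp (g.perp k)) :=
  ⟨LinearEquiv.prodAssoc R P Q P', ext_form fun p q => by simp [add_assoc]⟩

theorem isometric_perp_psi_succ (f : AltIso R P) (n : ℕ) :
    (f.perp (AltIso.psi R (n + 1))).Isometric
      ((f.perp (AltIso.psi2 R)).perp (AltIso.psi R n)) := by
  let h : (P × (Fin (n + 1) × Fin 2 → R)) ≃ₗ[R] ((P × (R × R)) × (Fin n × Fin 2 → R)) :=
    { toFun := fun x => ((x.1, (x.2 (0, 0), x.2 (0, 1))), fun a => x.2 (a.1.succ, a.2))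
      map_add' := fun _ _ => rfl
      map_smul' := fun _ _ => rfl
      invFun := fun x => (x.1.1, fun a =>
        (Fin.cons ![x.1.2.1, x.1.2.2] (fun i k => x.2 (i, k)) : Fin (n + 1) → Fin 2 → R) a.1 a.2)
      left_inv := by
        rintro ⟨p, z⟩
        refine Prod.ext rfl (funext ?_)
        rintro ⟨i, k⟩
        refine Fin.cases ?_ (fun i => ?_) i
        · fin_cases k <;> simp
        · simp
      right_inv := by
        rintro ⟨⟨p, x, y⟩, z⟩
        simp }
  refine ⟨h, ext_form fun p q => ?_⟩
  simp only [perp_form, psi_form, pull_form, psi2_form, Fin.sum_univ_succ, h, LinearEquiv.coe_mk,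
    LinearMap.coe_mk, AddHom.coe_mk]
  ring

/-- A form that embeds isometrically is an orthogonal summand. -/
theorem exists_complement {W : Type u} [AddCommGroup W] [Module R W] [Module.Finite R W]
    [Module.Projective R W] (g : AltIso R W) (f : AltIso R P) (J : P →ₗ[R] W)
    (hJ : ∀ p q, g.form (J p) (J q) = f.form p q) :
    ∃ (Q : Type u) (_ : AddCommGroup Q) (_ : Module R Q) (_ : Module.Finite R Q)
      (_ : Module.Projective R Q) (q : AltIso R Q), g.Isometric (f.perp q) := by
  let fe : P ≃ₗ[R] (P →ₗ[R] R) := LinearEquiv.ofBijective f.form f.bij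
  -- The orthogonal projection onto the image of `J`. Its kernel is the orthogonal complement.
  let ρ : W →ₗ[R] P := fe.symm.toLinearMap ∘ₗ g.form.compl₂ J
  have hρ : ∀ z p, f.form (ρ z) p = g.form z (J p) := fun z p => by
    have : f.form (ρ z) = g.form.compl₂ J z := fe.apply_symm_apply _
    rw [this]; rfl
  have hρJ : ∀ p, ρ (J p) = p := fun p => by
    apply f.bij.1
    ext q
    rw [hρ, hJ]
  let K := LinearMap.ker ρ
  have hK : ∀ k : K, ρ k = 0 := fun k => k.2
  let E : W ≃ₗ[R] P × K :=
    { toFun := fun z => (ρ z, ⟨z - J (ρ z), by simp [K, hρJ]⟩)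
      map_add' := fun x y => by
        refine Prod.ext (map_add _ _ _) (Subtype.ext ?_)
        simp only [map_add, Prod.snd_add, Submodule.coe_add]; abel
      map_smul' := fun c x => by
        refine Prod.ext (map_smul _ _ _) (Subtype.ext ?_)
        simp [smul_sub]
      invFun := fun x => J x.1 + x.2
      left_inv := fun z => by simp
      right_inv := fun x => by
        refine Prod.ext ?_ (Subtype.ext ?_) <;> simp [hρJ, hK] }
  have hfin : Module.Finite R K :=
    Module.Finite.of_surjective (LinearMap.snd R P K ∘ₗ E.toLinearMap)
      (Prod.snd_surjective.comp E.surjective)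
  have hproj : Module.Projective R K := by
    refine Module.Projective.of_split K.subtype (LinearMap.snd R P K ∘ₗ E.toLinearMap) ?_
    refine LinearMap.ext fun x => Subtype.ext ?_
    simp [E, hK]
  have horth : ∀ (k : K) p, g.form k (J p) = 0 := fun k p => by rw [← hρ, hK]; simp
  have horth' : ∀ (k : K) p, g.form (J p) k = 0 := fun k p => by rw [form_neg, horth, neg_zero]
  have hdec : ∀ z, z = J (ρ z) + ((E z).2 : W) := fun z => (E.symm_apply_apply z).symm
  let q : AltIso R K :=
    { form := g.form.compl₁₂ K.subtype K.subtype
      alt := fun p => g.alt _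
      bij := by
        constructor
        · rw [injective_iff_map_eq_zero]
          intro k hk
          refine Subtype.ext (g.form_injective fun z => ?_)
          rw [hdec z, map_add, horth, zero_add]
          exact LinearMap.congr_fun hk (E z).2
        · intro l
          obtain ⟨w, hw⟩ := g.bij.2 (l ∘ₗ LinearMap.snd R P K ∘ₗ E.toLinearMap)
          have hwK : ρ w = 0 := f.form_injective fun p => by
            rw [hρ, hw]
            have : (E (J p)).2 = 0 := Subtype.ext (by simp [E, hρJ])
            simp [this]
          refine ⟨⟨w, hwK⟩, ?_⟩
          ext k
          have : (E k).2 = k := Subtype.ext (by simp [E, hK])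
          simp [hw, this] }
  refine ⟨K, inferInstance, inferInstance, hfin, hproj, q, E, ext_form fun x y => ?_⟩
  rw [pull_form, perp_form]
  conv_lhs => rw [hdec x, hdec y]
  simp only [map_add, LinearMap.add_apply, horth, horth', hJ, add_zero, zero_add]
  rfl

/-- Every alternating form on a finitely generated projective module is an orthogonal summand of
some `ψ_{2n}`. -/
theorem exists_perp_isometric_psi [Module.Finite R P] [Module.Projective R P] (f : AltIso R P) :
    ∃ (n : ℕ) (Q : Type u) (_ : AddCommGroup Q) (_ : Module R Q) (_ : Module.Finite R Q)
      (_ : Module.Projective R Q) (q : AltIso R Q),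
      (AltIso.psi R n).Isometric (f.perp q) := by
  obtain ⟨n, i, r, hr⟩ := exists_retraction R P
  let v : Fin n → P := fun k => r (Pi.single k 1)
  have hv : ∀ p, p = ∑ k, i p k • v k := fun p => by
    have h1 : i p = ∑ k, i p k • (Pi.single k 1 : Fin n → R) := pi_eq_sum_univ' _
    calc p = r (i p) := (LinearMap.congr_fun hr p).symm
      _ = _ := by conv_lhs => rw [h1, map_sum]
                  simp [v]
  have hf : ∀ p q, f.form p q = ∑ k, ∑ j, i p k * i q j * f.form (v k) (v j) := fun p q => by
    conv_lhs => rw [hv p, hv q]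
    simp only [map_sum, map_smul, LinearMap.sum_apply, LinearMap.smul_apply, smul_eq_mul,
      Finset.mul_sum]
    rw [Finset.sum_comm]
    exact Finset.sum_congr rfl fun k _ => Finset.sum_congr rfl fun j _ => by ring
  -- Pulled back to `R^n`, the form is `U - Uᵗ` with `U` the strictly upper triangular part of its
  -- matrix. The map `x ↦ (x, Ux)` turns `ψ_{2n}` into exactly this difference.
  let J : P →ₗ[R] (Fin n × Fin 2 → R) := LinearMap.pi fun a =>
    if a.2 = 0 then LinearMap.proj a.1 ∘ₗ i
    else ∑ j, (if a.1 < j then f.form (v a.1) (v j) else 0) • (LinearMap.proj j ∘ₗ i)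
  have hJ0 : ∀ p k, J p (k, 0) = i p k := fun p k => rfl
  have hJ1 : ∀ p k, J p (k, 1) = ∑ j, (if k < j then f.form (v k) (v j) else 0) * i p j :=
    fun p k => by
      simp only [J, LinearMap.pi_apply]
      rw [if_neg one_ne_zero]
      simp only [LinearMap.sum_apply, LinearMap.smul_apply, smul_eq_mul, LinearMap.comp_apply,
        LinearMap.proj_apply]
  have key : ∀ p q, (AltIso.psi R n).form (J p) (J q) = f.form p q := fun p q => by
    simp only [psi_form, hJ0, hJ1]
    rw [Finset.sum_sub_distrib, hf]
    simp only [Finset.mul_sum, Finset.sum_mul]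
    rw [Finset.sum_comm (f := fun k j => _ * i p j * i q k), ← Finset.sum_sub_distrib]
    refine Finset.sum_congr rfl fun k _ => ?_
    rw [← Finset.sum_sub_distrib]
    refine Finset.sum_congr rfl fun j _ => ?_
    rcases lt_trichotomy k j with h | rfl | h
    · rw [if_pos h, if_neg h.asymm]; ring
    · simp [f.alt]
    · rw [if_neg h.asymm, if_pos h, f.form_neg]; ring
  obtain ⟨Q, i1, i2, i3, i4, q, hq⟩ := exists_complement (AltIso.psi R n) f J key
  exact ⟨n, Q, i1, i2, i3, i4, q, hq⟩

end AltIso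

end Isometries

/-! ### Symplectic transitivity and cancellation -/

section Cancellation

variable {R : Type u} [CommRing R]

namespace AltIso

variable {W : Type u} [AddCommGroup W] [Module R W]

/-- The orbit relation of the isometry group of a form. -/
def OrbitRel (g : AltIso R W) (z z' : W) : Prop :=
  ∃ φ : W ≃ₗ[R] W, g.pull φ = g ∧ φ z = z'

theorem OrbitRel.trans {g : AltIso R W} {x y z : W} (h : g.OrbitRel x y) (h' : g.OrbitRel y z) :
    g.OrbitRel x z := by
  obtain ⟨φ, hφ, rfl⟩ := h
  obtain ⟨ψ, hψ, rfl⟩ := h'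
  refine ⟨φ.trans ψ, ?_, rfl⟩
  conv_rhs => rw [← hφ, ← hψ]
  rfl

/-- Symplectic transvections. -/
theorem orbitRel_transvection (g : AltIso R W) (c : R) (u z : W) :
    g.OrbitRel z (z + (c * g.form u z) • u) := by
  have h : (c • g.form u) u = 0 := by simp [g.alt]
  refine ⟨LinearEquiv.transvection h, ext_form fun p q => ?_, rfl⟩
  simp only [pull_form, LinearEquiv.transvection.apply, LinearMap.smul_apply, map_add, map_smul,
    LinearMap.add_apply, smul_eq_mul, g.alt, g.form_neg u p]
  ring

/-- Eichler transformations. -/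
theorem orbitRel_eichler (g : AltIso R W) {u v : W} (huv : g.form u v = 0) (z : W) :
    g.OrbitRel z (z + g.form v z • u + g.form u z • v) := by
  -- For orthogonal `u` and `v`, polarization writes the Eichler map through the transvections along
  -- `u`, `v` and `u + v`.
  refine ((g.orbitRel_transvection (-1) u z).trans ((g.orbitRel_transvection (-1) v _).trans
    (g.orbitRel_transvection 1 (u + v) _))).trans ?_
  have hvu : g.form v u = 0 := by rw [g.form_neg, huv, neg_zero]
  refine ⟨LinearEquiv.refl R W, rfl, ?_⟩
  simp only [LinearEquiv.refl_apply, map_add, map_smul, LinearMap.add_apply, smul_eq_mul, g.alt,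
    huv, hvu]
  module

variable {P P' : Type u} [AddCommGroup P] [Module R P] [AddCommGroup P'] [Module R P']

/-- The stable range hypothesis makes the first two components unimodular after multiples of `y` are
added. They can then be used to change the last component to one, and that entry clears the others.
All moves are Eichler maps and transvections. -/
theorem orbitRel_hyperbolic (f : AltIso R P)
    (hB : ∀ (p : P × R) (r : R), orderIdeal p ⊔ Ideal.span {r} = ⊤ →
      ∃ q : P × R, orderIdeal (R := R) (p + r • q) = ⊤)
    {z : P × (R × R)} (hz : orderIdeal (R := R) z = ⊤) :
    (f.perp (psi2 R)).OrbitRel z (0, (0, 1)) := by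
  set Ω := f.perp (psi2 R)
  have E1 : ∀ (v p : P) (x y : R), Ω.OrbitRel (p, x, y) (p + y • v, x + f.form v p, y) := by
    intro v p x y
    have h : Ω.form (0, 1, 0) (v, 0, 0) = 0 := by simp [Ω]
    convert Ω.orbitRel_eichler h (p, x, y) using 1
    simp [Ω]
  have E2 : ∀ (c : R) (p : P) (x y : R), Ω.OrbitRel (p, x, y) (p, x + c * y, y) := by
    intro c p x y
    convert Ω.orbitRel_transvection c (0, 1, 0) (p, x, y) using 1
    simp [Ω]
  have F1 : ∀ (v p : P) (x y : R), Ω.OrbitRel (p, x, y) (p + x • v, x, y - f.form v p) := by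
    intro v p x y
    have h : Ω.form (0, 0, -1) (v, 0, 0) = 0 := by simp [Ω]
    convert Ω.orbitRel_eichler h (p, x, y) using 1
    simp [Ω, sub_eq_add_neg]
  have F2 : ∀ (c : R) (p : P) (x y : R), Ω.OrbitRel (p, x, y) (p, x, y + c * x) := by
    intro c p x y
    convert Ω.orbitRel_transvection (-c) (0, 0, 1) (p, x, y) using 1
    simp [Ω]
  obtain ⟨p, x, y⟩ := z
  obtain ⟨L, hL⟩ := mem_orderIdeal.1 (show (1 : R) ∈ orderIdeal (R := R) (p, x, y) by
    rw [hz]; trivial)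
  obtain ⟨⟨v, c⟩, hvc⟩ := hB (p, x) y <| by
    rw [Ideal.eq_top_iff_one, ← hL]
    let L₀ := L ∘ₗ LinearMap.prod (LinearMap.fst R P R)
      (LinearMap.prod (LinearMap.snd R P R) 0)
    have : L (p, x, y) = L₀ (p, x) + L (0, 0, 1) * y := by
      rw [mul_comm, ← smul_eq_mul, ← map_smul, LinearMap.comp_apply, ← map_add]
      simp
    rw [this]
    exact add_mem (Ideal.mem_sup_left (mem_orderIdeal.2 ⟨L₀, rfl⟩))
      (Ideal.mem_sup_right (Ideal.mul_mem_left _ _ (Ideal.mem_span_singleton_self y)))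
  obtain ⟨M, hM⟩ := mem_orderIdeal.1 (show (1 : R) ∈ orderIdeal (R := R)
    ((p, x) + y • (v, c)) by rw [hvc]; trivial)
  set p₁ := p + y • v with hp₁
  set x₂ := x + f.form v p + c * y with hx₂
  have hp : f.form v p = f.form v p₁ := by simp [hp₁, f.alt]
  set d := M (0, 1)
  have hM' : M (p₁, 0) + d * (x + y * c) = 1 := by
    rw [← hM, mul_comm d, ← smul_eq_mul, ← map_smul, ← map_add]
    simp [hp₁]
  -- The Eichler map also added `f(v, p)` to `x`. Subtracting `d • f.form v` compensates for this,
  -- so that `w` and `d` witness the unimodularity of `(p₁, x₂)`.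
  obtain ⟨w, hw⟩ := f.bij.2 (M ∘ₗ LinearMap.inl R P R - d • f.form v)
  have hw1 : f.form w p₁ + d * x₂ = 1 := by
    rw [hw, ← hM', hx₂, hp]
    simp
    ring
  refine (E1 v p x y).trans ((E2 c _ _ _).trans ((F1 (-(1 - y) • w) _ _ _).trans
    ((F2 ((1 - y) * d) _ _ _).trans ?_)))
  have h1 : y - f.form (-(1 - y) • w) p₁ + (1 - y) * d * x₂ = 1 := by
    simp only [map_smul, LinearMap.smul_apply, smul_eq_mul]
    linear_combination (1 - y) * hw1
  rw [h1]
  set p₂ := p₁ + x₂ • -(1 - y) • w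
  have h2 := E1 (-p₂) p₂ x₂ 1
  rw [map_neg, LinearMap.neg_apply, f.alt, neg_zero, add_zero, one_smul, add_neg_cancel] at h2
  have h3 := E2 (-x₂) 0 x₂ 1
  rw [mul_one, add_neg_cancel] at h3
  exact h2.trans h3

/-- Cancellation of a hyperbolic plane. -/
theorem isometric_of_perp_psi2 (f : AltIso R P) (f' : AltIso R P')
    (hB : ∀ (p : P' × R) (r : R), orderIdeal p ⊔ Ideal.span {r} = ⊤ →
      ∃ q : P' × R, orderIdeal (R := R) (p + r • q) = ⊤)
    (h : (f.perp (psi2 R)).Isometric (f'.perp (psi2 R))) : f.Isometric f' := by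
  obtain ⟨e, he⟩ := h
  have hu : orderIdeal (R := R) (e (0, 0, 1)) = ⊤ := by
    rw [Ideal.eq_top_iff_one]
    exact ⟨LinearMap.snd R R R ∘ₗ LinearMap.snd R P (R × R) ∘ₗ e.symm.toLinearMap, by simp⟩
  obtain ⟨φ, hφ, hφe⟩ := orbitRel_hyperbolic f' hB hu
  set α := e.trans φ
  have hα0 : α (0, 0, 1) = (0, 0, 1) := hφe
  have hα0' : α.symm (0, 0, 1) = (0, 0, 1) := by rw [LinearEquiv.symm_apply_eq, hα0]
  have hα : ∀ z z', (f'.perp (psi2 R)).form (α z) (α z') = (f.perp (psi2 R)).form z z' := by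
    intro z z'
    calc _ = ((f'.perp (psi2 R)).pull φ).form (e z) (e z') := rfl
      _ = (f'.perp (psi2 R)).form (e z) (e z') := by rw [hφ]
      _ = _ := by rw [he]; rfl
  -- The isometry `α` fixes `e = (0, 0, 1)`, so it preserves the complement `e^⊥`, where the middle
  -- coordinate vanishes. It therefore induces an isometry of the quotients `e^⊥ / Re`, which are
  -- `P` and `P'`.
  have hx : ∀ p, (α (p, 0, 0)).2.1 = 0 := fun p => by
    have := hα (p, 0, 0) (0, 0, 1)
    rw [hα0] at this
    simpa using this
  have hx' : ∀ p, (α.symm (p, 0, 0)).2.1 = 0 := fun p => by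
    have := hα (α.symm (p, 0, 0)) (α.symm (0, 0, 1))
    rw [α.apply_symm_apply, α.apply_symm_apply, hα0'] at this
    simpa using this.symm
  have hs : ∀ p, α (p, 0, 0) = ((α (p, 0, 0)).1, 0, 0) + (α (p, 0, 0)).2.2 • (0, 0, 1) :=
    fun p => by ext <;> simp [hx]
  have hs' : ∀ p, α.symm (p, 0, 0)
      = ((α.symm (p, 0, 0)).1, 0, 0) + (α.symm (p, 0, 0)).2.2 • (0, 0, 1) :=
    fun p => by ext <;> simp [hx']
  refine ⟨LinearEquiv.ofLinearMap
    (LinearMap.fst R P' (R × R) ∘ₗ α.toLinearMap ∘ₗ LinearMap.inl R P (R × R))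
    (LinearMap.fst R P (R × R) ∘ₗ α.symm.toLinearMap ∘ₗ LinearMap.inl R P' (R × R))
    (LinearMap.ext fun p => ?_) (LinearMap.ext fun p => ?_), ext_form fun p q => ?_⟩
  · have h1 := congrArg α (hs' p)
    rw [map_add, map_smul, hα0, α.apply_symm_apply] at h1
    change (α ((α.symm (p, 0, 0)).1, 0, 0)).1 = p
    simpa using (congrArg Prod.fst h1).symm
  · have h1 := congrArg α.symm (hs p)
    rw [map_add, map_smul, hα0', α.symm_apply_apply] at h1
    change (α.symm ((α (p, 0, 0)).1, 0, 0)).1 = p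
    simpa using (congrArg Prod.fst h1).symm
  · have h1 := hα (p, 0, 0) (q, 0, 0)
    change f.form p q = f'.form (α (p, 0, 0)).1 (α (q, 0, 0)).1
    simpa [hx] using h1.symm

/-- One hyperbolic plane is absorbed into the modules and the others are cancelled by induction. The
rank grows by two, so the bound on the dimension persists. -/
theorem isometric_of_perp_psi (n : ℕ) : ∀ {P P' : Type u} [AddCommGroup P] [Module R P]
    [AddCommGroup P'] [Module R P'] (f : AltIso R P) (f' : AltIso R P') (k : ℕ)
    (_ : ringKrullDim R < (k + 1 : ℕ)) (_ : HasFrames R P' k)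
    (_ : (f.perp (psi R n)).Isometric (f'.perp (psi R n))), f.Isometric f' := by
  induction n with
  | zero =>
    intro P P' _ _ _ _ f f' k _ _ ⟨h, hh⟩
    refine ⟨LinearEquiv.prodUnique.symm.trans (h.trans LinearEquiv.prodUnique),
      ext_form fun p q => ?_⟩
    have := congrArg (fun g => g.form (p, 0) (q, 0)) hh
    have hd : (default : Fin 0 × Fin 2 → R) = 0 := Subsingleton.elim _ _
    simpa [psi_form, hd] using this
  | succ n ih =>
    intro P P' _ _ _ _ f f' k hk hP' h
    have h1 : (f.perp (psi2 R)).Isometric (f'.perp (psi2 R)) := by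
      refine ih _ _ (k + 1 + 1) (hk.trans (by exact_mod_cast by omega))
        (hP'.prod.prod.congr (LinearEquiv.prodAssoc R P' R R)) ?_
      exact (isometric_perp_psi_succ f n).symm.trans (h.trans (isometric_perp_psi_succ f' n))
    exact isometric_of_perp_psi2 f f'
      (fun p r hpr => exists_orderIdeal_add_eq_top hk hP'.prod p r hpr) h1

/-- Stably isometric forms are isometric if the rank is large. -/
theorem isometric_of_perp {Q : Type u} [AddCommGroup Q] [Module R Q] [Module.Finite R Q]
    [Module.Projective R Q] (f : AltIso R P) (f' : AltIso R P') (g : AltIso R Q) {k : ℕ}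
    (hk : ringKrullDim R < (k + 1 : ℕ)) (hP' : HasFrames R P' k)
    (h : (f.perp g).Isometric (f'.perp g)) : f.Isometric f' := by
  obtain ⟨n, Q', _, _, _, _, q, hq⟩ := g.exists_perp_isometric_psi
  refine isometric_of_perp_psi n f f' k hk hP' ?_
  exact ((Isometric.refl f).perp hq).trans ((isometric_perp_assoc f g q).symm.trans
    ((h.perp (Isometric.refl q)).trans ((isometric_perp_assoc f' g q).trans
      ((Isometric.refl f').perp hq.symm))))

end AltIso

end Cancellation

end Vaserstein
end

noncomputable section
namespace Vaserstein

/-! ### The Grothendieck group of alternating forms -/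

section Grothendieck

/-- A non-degenerate alternating form on a finitely generated projective module. -/
structure FormSpace (R : Type u) [CommRing R] where
  P : Type u
  [addCommGroup : AddCommGroup P]
  [module : Module R P]
  [finite : Module.Finite R P]
  [projective : Module.Projective R P]
  f : AltIso R P

attribute [instance] FormSpace.addCommGroup FormSpace.module FormSpace.finite FormSpace.projective

variable (R : Type u) [CommRing R]

/-- Isometry of alternating forms. -/
instance FormSpace.setoid : Setoid (FormSpace R) where
  r T T' := T.f.Isometric T'.f
  iseqv := ⟨fun T => AltIso.Isometric.refl T.f, fun h => h.symm, fun h h' => h.trans h'⟩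

/-- The isometry classes of non-degenerate alternating forms. -/
def FormClass : Type (u + 1) := Quotient (FormSpace.setoid R)

/-- The zero form. -/
def AltIso.zeroForm : AltIso R PUnit.{u + 1} where
  form := 0
  alt _ := rfl
  bij := by
    constructor
    · intro x y _
      rfl
    · intro l
      refine ⟨0, LinearMap.ext fun x => ?_⟩
      rw [Subsingleton.elim x 0, map_zero, map_zero]

variable {R} in
/-- The isometry class of a form. -/
def FormClass.mk {P : Type u} [AddCommGroup P] [Module R P] [Module.Finite R P]
    [Module.Projective R P] (f : AltIso R P) : FormClass R :=
  Quotient.mk (FormSpace.setoid R) ⟨P, f⟩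

instance : Add (FormClass R) where
  add := Quotient.map₂ (fun T T' => ⟨T.P × T'.P, T.f.perp T'.f⟩)
    fun _ _ h _ _ h' => AltIso.Isometric.perp h h'

instance : Zero (FormClass R) where
  zero := FormClass.mk (AltIso.zeroForm R)

instance : AddCommMonoid (FormClass R) where
  add_assoc := by
    rintro ⟨a⟩ ⟨b⟩ ⟨c⟩
    exact Quotient.sound (AltIso.isometric_perp_assoc a.f b.f c.f)
  zero_add := by
    rintro ⟨a⟩
    refine Quotient.sound ⟨LinearEquiv.uniqueProd, AltIso.ext_form fun p q => ?_⟩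
    simp [AltIso.zeroForm]
  add_zero := by
    rintro ⟨a⟩
    refine Quotient.sound ⟨LinearEquiv.prodUnique, AltIso.ext_form fun p q => ?_⟩
    simp [AltIso.zeroForm]
  add_comm := by
    rintro ⟨a⟩ ⟨b⟩
    exact Quotient.sound (AltIso.isometric_perp_comm a.f b.f)
  nsmul := nsmulRec

variable {R}

variable {P Q : Type u} [AddCommGroup P] [Module R P] [Module.Finite R P]
    [Module.Projective R P] [AddCommGroup Q] [Module R Q] [Module.Finite R Q]
    [Module.Projective R Q]

theorem FormClass.mk_perp (f : AltIso R P) (g : AltIso R Q) :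
    FormClass.mk (f.perp g) = FormClass.mk f + FormClass.mk g := rfl

theorem FormClass.mk_eq_mk {f : AltIso R P} {g : AltIso R Q} :
    FormClass.mk f = FormClass.mk g ↔ f.Isometric g :=
  Quotient.eq (r := FormSpace.setoid R)

open Algebra

/-- The class of a form in the Grothendieck group. -/
def formClass (f : AltIso R P) : GrothendieckAddGroup (FormClass R) :=
  GrothendieckAddGroup.of (FormClass.mk f)

theorem formClass_perp (f : AltIso R P) (g : AltIso R Q) :
    formClass (f.perp g) = formClass f + formClass g := by
  rw [formClass, FormClass.mk_perp, map_add]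
  rfl

theorem formClass_eq_of_isometric {f : AltIso R P} {g : AltIso R Q} (h : f.Isometric g) :
    formClass f = formClass g := by
  rw [formClass, formClass, FormClass.mk_eq_mk.2 h]

/-- Equality in a Grothendieck group means equality after a common summand is added. -/
theorem exists_isometric_perp {f : AltIso R P} {g : AltIso R Q} (h : formClass f = formClass g) :
    ∃ T : FormSpace R, (f.perp T.f).Isometric (g.perp T.f) := by
  obtain ⟨⟨c, _⟩, hc⟩ := (AddLocalization.addMonoidOf
    (⊤ : AddSubmonoid (FormClass R))).eq_iff_exists.1 h
  obtain ⟨T, rfl⟩ := Quotient.exists_rep c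
  refine ⟨T, FormClass.mk_eq_mk.1 ?_⟩
  rw [FormClass.mk_perp, FormClass.mk_perp, add_comm, add_comm (FormClass.mk g)]
  exact hc

variable (R) in
/-- The homomorphism sending `[P, g, f]` to `[f] - [g]`. -/
def freeDiff : FreeTriples R →+ GrothendieckAddGroup (FormClass R) :=
  FreeAbelianGroup.lift (Quotient.lift (fun T => formClass T.f - formClass T.g) (by
    rintro T T' ⟨h, h1, h2⟩
    rw [formClass_eq_of_isometric (f := T.f) (g := T'.f) ⟨h, h2⟩,
      formClass_eq_of_isometric (f := T.g) (g := T'.g) ⟨h, h1⟩]))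

theorem freeDiff_gen (g f : AltIso R P) : freeDiff R (gen g f) = formClass f - formClass g :=
  FreeAbelianGroup.lift_apply_of _ _

/-- The difference `[f] - [g]` is additive and telescopes, and pulling `f` back by any automorphism
keeps its isometry class. -/
theorem closure_le_ker_freeDiff : AddSubgroup.closure {x | VRel R x} ≤ (freeDiff R).ker := by
  rw [AddSubgroup.closure_le]
  rintro x (⟨g, f, g', f'⟩ | ⟨f₀, f₁, f₂⟩ | ⟨g, f, φ, hφ⟩)
  · simp only [SetLike.mem_coe, AddMonoidHom.mem_ker, map_sub, map_add, freeDiff_gen,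
      formClass_perp]
    abel
  · simp only [SetLike.mem_coe, AddMonoidHom.mem_ker, map_sub, map_add, freeDiff_gen]
    abel
  · simp only [SetLike.mem_coe, AddMonoidHom.mem_ker, map_sub, freeDiff_gen]
    rw [formClass_eq_of_isometric (f := f.pull φ) (g := f) ⟨φ, rfl⟩]
    abel

/-- Forms with equal classes in `V_SL(R)` are stably isometric. -/
theorem exists_isometric_of_cls_eq {g f f' : AltIso R P} (h : cls g f = cls g f') :
    ∃ T : FormSpace R, (f.perp T.f).Isometric (f'.perp T.f) := by
  apply exists_isometric_perp
  have := congrArg (QuotientAddGroup.lift _ (freeDiff R) closure_le_ker_freeDiff) h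
  simp only [cls, QuotientAddGroup.lift_mk, freeDiff_gen] at this
  simpa using this

theorem cls_self (f : AltIso R P) : cls f f = 0 := by
  have h : cls f f + cls f f - cls f f = 0 :=
    (QuotientAddGroup.eq_zero_iff _).2 (AddSubgroup.subset_closure (VRel.chain f f f))
  simpa using h

theorem cls_perp (g f : AltIso R P) (g' f' : AltIso R Q) :
    cls (g.perp g') (f.perp f') = cls g f + cls g' f' := by
  have h : cls (g.perp g') (f.perp f') - (cls g f + cls g' f') = 0 :=
    (QuotientAddGroup.eq_zero_iff _).2 (AddSubgroup.subset_closure (VRel.sum g f g' f'))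
  exact sub_eq_zero.1 h

theorem cls_pull_of_mem_SL (g f : AltIso R P) {φ : P ≃ₗ[R] P} (hφ : φ ∈ SL R P) :
    cls g (f.pull φ) = cls g f := by
  have h : cls g f - cls g (f.pull φ) = 0 :=
    (QuotientAddGroup.eq_zero_iff _).2 (AddSubgroup.subset_closure (VRel.sl g f φ hφ))
  exact (sub_eq_zero.1 h).symm

theorem cls_pull (h : P ≃ₗ[R] Q) (g f : AltIso R Q) : cls (g.pull h) (f.pull h) = cls g f :=
  congrArg QuotientAddGroup.mk (congrArg FreeAbelianGroup.of
    (Quotient.sound (s := Triple.setoid R) ⟨h, rfl, rfl⟩))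

end Grothendieck

end Vaserstein
end

noncomputable section
namespace Vaserstein

/-! ### Relative Pfaffians -/

section RelativePfaffian

variable {R : Type u} [CommRing R]

/-- The local-to-global principle by which Pfaffian identities are checked after multiplication by
powers of the values of a unimodular form. -/
theorem eq_zero_of_span_pow_mul {S : Set R} (hS : Ideal.span S = ⊤) (k : ℕ) {x : R}
    (h : ∀ s ∈ S, s ^ k * x = 0) : x = 0 := by
  have h1 := Ideal.span_pow_eq_top S hS k
  have hle : Ideal.span ((fun s => s ^ k) '' S)
      ≤ LinearMap.ker (LinearMap.toSpanSingleton R R x) := by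
    rw [Ideal.span_le]
    rintro _ ⟨s, hs, rfl⟩
    simpa using h s hs
  have h2 : (1 : R) ∈ LinearMap.ker (LinearMap.toSpanSingleton R R x) := hle (by rw [h1]; trivial)
  simpa using h2

/-- This is the characteristic polynomial of a matrix of rank one, evaluated at `s`. -/
theorem det_smul_id_add_smulRight {V ι : Type*} [AddCommGroup V] [Module R V] [Fintype ι]
    [DecidableEq ι] (b : Module.Basis ι R V) (s : R) (f : Module.Dual R V) (v : V) :
    LinearMap.det (s • LinearMap.id + f.smulRight v)
      = s ^ Fintype.card ι + f v * s ^ (Fintype.card ι - 1) := by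
  have hM : LinearMap.toMatrix b b (s • LinearMap.id + f.smulRight v)
      = Matrix.scalar ι s - Matrix.vecMulVec (-b.equivFun v) (f ∘ b) := by
    ext i j
    simp [LinearMap.toMatrix_apply, Matrix.vecMulVec_apply, Finsupp.single_apply,
      Matrix.diagonal_apply, eq_comm, mul_comm]
  rw [← LinearMap.det_toMatrix b, hM, ← Matrix.eval_charpoly, Matrix.charpoly_vecMulVec]
  have hf : f v = b.equivFun v ⬝ᵥ (f ∘ b) := by
    conv_lhs => rw [← b.sum_equivFun v]
    simp only [map_sum, map_smul, smul_eq_mul, dotProduct, Function.comp_apply]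
  simp [hf]

variable {V : Type u} [AddCommGroup V] [Module R V] {n : ℕ}

/-- The Pfaffian of the Gram matrix of a bilinear form with respect to a basis. -/
def relPf (b : Module.Basis (Fin n × Fin 2) R V) (B : V →ₗ[R] V →ₗ[R] R) : R :=
  ∑ σ : Equiv.Perm (Fin n × Fin 2) with IsNormalized σ, pfTerm B σ b

variable (b : Module.Basis (Fin n × Fin 2) R V)

theorem relPf_compl₁₂ {B : V →ₗ[R] V →ₗ[R] R} (hB : ∀ v, B v v = 0) (N : V →ₗ[R] V) :
    relPf b (B.compl₁₂ N N) = LinearMap.det N * relPf b B :=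
  pfMap_comp_end b B hB N b

theorem relPf_smul {B : V →ₗ[R] V →ₗ[R] R} (hB : ∀ v, B v v = 0) (c : R) :
    relPf b (c • B) = c ^ n * relPf b B :=
  pfMap_smul c B hB (fun v => by simp [hB]) b

theorem relPf_compl₁₂_transvection {B : V →ₗ[R] V →ₗ[R] R} (hB : ∀ v, B v v = 0)
    (f : Module.Dual R V) (v : V) :
    relPf b (B.compl₁₂ (LinearMap.transvection f v) (LinearMap.transvection f v))
      = (1 + f v) * relPf b B := by
  have := Module.Free.of_basis b
  have := Module.Finite.of_basis b
  rw [relPf_compl₁₂ b hB, LinearMap.transvection.det]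

/-- Rescaling a summand of rank two. -/
theorem pow_mul_relPf_smul_add {κ ρ : V →ₗ[R] V →ₗ[R] R} (hκ : ∀ v, κ v v = 0)
    (hρ : ∀ v, ρ v v = 0) (y : R) (f : Module.Dual R V) (v : V)
    (hf : ∀ p q, f v * κ p q = f p * κ v q - f q * κ v p) (hv : ρ v = 0) :
    f v ^ (2 * n + 1) * (relPf b (y • κ + ρ) - y * relPf b (κ + ρ)) = 0 := by
  set s := f v
  -- Up to the factor `s = f v`, this map scales the direction `v` by `y` and is the identity on
  -- `ker f`. The relation `hf` expresses that `κ` has rank two, and `hv` keeps `ρ` unaffected.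
  set N : V →ₗ[R] V := s • LinearMap.id + ((y - 1) • f).smulRight v with hN
  have hv' : ∀ p, ρ p v = 0 := fun p => by rw [form_swap hρ v p, hv]; simp
  have hB : ∀ v, (κ + ρ) v v = 0 := fun v => by simp [hκ, hρ]
  have hB' : ∀ v, (y • κ + ρ) v v = 0 := fun v => by simp [hκ, hρ]
  have h1 : (κ + ρ).compl₁₂ N N = s ^ 2 • (y • κ + ρ) := by
    ext p q
    simp only [hN, LinearMap.compl₁₂_apply, LinearMap.add_apply, LinearMap.smul_apply,
      LinearMap.id_apply, LinearMap.smulRight_apply, map_add, map_smul, smul_eq_mul, hκ, hv', hv,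
      LinearMap.zero_apply, form_swap hκ v p]
    linear_combination (-(s * (y - 1))) * hf p q
  have h2 := relPf_compl₁₂ b hB N
  rw [h1, relPf_smul b hB', hN, det_smul_id_add_smulRight b] at h2
  have hdet : s * (s ^ Fintype.card (Fin n × Fin 2)
      + ((y - 1) • f) v * s ^ (Fintype.card (Fin n × Fin 2) - 1)) = s ^ (2 * n + 1) * y := by
    rw [LinearMap.smul_apply, smul_eq_mul, Fintype.card_prod, Fintype.card_fin, Fintype.card_fin]
    -- For `n = 0` the exponent `card - 1` is truncated to zero, but then `V = 0` and `s = 0`. The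
    -- extra factor `s` in `hdet` covers this case.
    rcases n with _ | n
    · have hs : s = 0 := by
        have hv0 : v = 0 := by
          rw [← b.sum_equivFun v]
          simp
        simp only [s, hv0, map_zero]
      simp [hs]
    · have : (n + 1) * 2 - 1 = 2 * n + 1 := by omega
      rw [this]
      change s * (s ^ ((n + 1) * 2) + (y - 1) * s * s ^ (2 * n + 1)) = _
      ring
  calc s ^ (2 * n + 1) * (relPf b (y • κ + ρ) - y * relPf b (κ + ρ))
      = s * ((s ^ 2) ^ n * relPf b (y • κ + ρ)) - s ^ (2 * n + 1) * y * relPf b (κ + ρ) := by ring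
    _ = 0 := by rw [h2, ← hdet]; ring

end RelativePfaffian

/-! ### Determinants of automorphisms read off from Pfaffians -/

section SpecialLinear

variable {R : Type u} [CommRing R] {P Q : Type u} [AddCommGroup P] [Module R P]
  [AddCommGroup Q] [Module R Q]

variable [Module.Finite R P] [Module.Projective R P]

theorem mem_SL_iff {φ : P ≃ₗ[R] P} : φ ∈ SL R P ↔ projDet R P φ.toLinearMap = 1 := Iff.rfl

theorem mem_SL_of_transvection {φ : P ≃ₗ[R] P} {w : P} {f : Module.Dual R P} (hf : f w = 0)
    (h : ∀ x, φ x = x + f x • w) : φ ∈ SL R P := by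
  obtain ⟨n, i, r, hr⟩ := exists_retraction R P
  have hr' : ∀ x, r (i x) = x := fun x => LinearMap.congr_fun hr x
  have h1 : extendEnd i r φ.toLinearMap = LinearMap.transvection (f ∘ₗ r) (i w) := by
    refine LinearMap.ext fun x => ?_
    simp only [extendEnd, LinearMap.add_apply, LinearMap.comp_apply, LinearMap.sub_apply,
      LinearMap.id_apply, LinearEquiv.coe_coe, h, map_add, map_smul, LinearMap.transvection.apply]
    abel
  rw [mem_SL_iff, projDet_eq R P i r hr, h1, LinearMap.transvection.det, LinearMap.comp_apply, hr',
    hf, add_zero]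

/-- The isomorphism `h` is itself a presentation of `P` as a summand of a free module, and `projDet`
does not depend on the presentation. -/
theorem det_prodMap_id {n : ℕ} (h : (Fin n × Fin 2 → R) ≃ₗ[R] P × Q) (φ : P →ₗ[R] P) :
    LinearMap.det (φ.prodMap (LinearMap.id : Q →ₗ[R] Q)) = projDet R P φ := by
  let e : (Fin (n * 2) → R) ≃ₗ[R] P × Q :=
    (LinearEquiv.funCongrLeft R R finProdFinEquiv).trans h
  rw [projDet_eq R P (e.symm.toLinearMap ∘ₗ LinearMap.inl R P Q)
      (LinearMap.fst R P Q ∘ₗ e.toLinearMap) (by ext; simp),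
    ← LinearMap.det_conj (φ.prodMap (LinearMap.id : Q →ₗ[R] Q)) e.symm]
  congr 1
  refine LinearMap.ext fun x => e.injective ?_
  refine Prod.ext ?_ ?_ <;> simp [extendEnd]

/-- Detects membership in `SL(P)`: between forms of Pfaffian one, an isometry must have determinant
one. -/
theorem relPf_pull {n : ℕ} (h : (Fin n × Fin 2 → R) ≃ₗ[R] P × Q)
    (b : Module.Basis (Fin n × Fin 2) R (P × Q)) (f : AltIso R P) (q : AltIso R Q) (φ : P ≃ₗ[R] P) :
    relPf b ((f.pull φ).perp q).form = projDet R P φ.toLinearMap * relPf b (f.perp q).form := by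
  rw [← det_prodMap_id h, ← relPf_compl₁₂ b (f.perp q).alt]
  rfl

end SpecialLinear

end Vaserstein
end

noncomputable section
namespace Vaserstein

/-! ### Elementary transformations of the forms `V(a, s)` -/

section Symbol

open Module (Dual)

variable {R : Type u} [CommRing R]

namespace AltIso

variable {P : Type u} [AddCommGroup P] [Module R P]

theorem pull_mul (f : AltIso R P) (φ ψ : P ≃ₗ[R] P) : f.pull (φ * ψ) = (f.pull φ).pull ψ := rfl

theorem pull_one (f : AltIso R P) : f.pull (1 : P ≃ₗ[R] P) = f := rfl

end AltIso

variable (R) in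
/-- The subgroup generated by the transvections along unimodular vectors. -/
def transvectionGroup (W : Type u) [AddCommGroup W] [Module R W] : Subgroup (W ≃ₗ[R] W) :=
  Subgroup.closure {φ | ∃ (w : W) (f a : Dual R W), a w = 1 ∧ f w = 0 ∧ ∀ x, φ x = x + f x • w}

theorem hasTransvection_transvectionGroup {W : Type u} [AddCommGroup W] [Module R W] {w : W}
    {f a : Dual R W} (ha : a w = 1) (hf : f w = 0) :
    HasTransvection (transvectionGroup R W) w f :=
  ⟨LinearEquiv.transvection hf, Subgroup.subset_closure ⟨w, f, a, ha, hf, fun _ => rfl⟩,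
    fun _ => rfl⟩

/-- Conjugating moves `w` to `g w`, which stays unimodular. Normality is what makes the later action
well defined. -/
theorem conj_mem_transvectionGroup {W : Type u} [AddCommGroup W] [Module R W] {φ : W ≃ₗ[R] W}
    (hφ : φ ∈ transvectionGroup R W) (g : W ≃ₗ[R] W) :
    g * φ * g⁻¹ ∈ transvectionGroup R W := by
  have h : transvectionGroup R W ≤ (transvectionGroup R W).comap (MulAut.conj g).toMonoidHom := by
    conv_lhs => rw [transvectionGroup]
    rw [Subgroup.closure_le]
    rintro φ ⟨w, f, a, ha, hf, h⟩
    refine Subgroup.subset_closure ⟨g w, f ∘ₗ g⁻¹.toLinearMap, a ∘ₗ g⁻¹.toLinearMap, ?_, ?_,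
      fun x => ?_⟩
    · simpa [LinearEquiv.coe_inv] using ha
    · simpa [LinearEquiv.coe_inv] using hf
    · simp [LinearEquiv.mul_apply, h, LinearEquiv.coe_inv]
  exact h hφ

theorem transvectionGroup_le_SL {W : Type u} [AddCommGroup W] [Module R W] [Module.Finite R W]
    [Module.Projective R W] : transvectionGroup R W ≤ SL R W := by
  rw [transvectionGroup, Subgroup.closure_le]
  rintro φ ⟨w, f, a, -, hf, h⟩
  exact mem_SL_of_transvection hf h

variable {P₀ : Type u} [AddCommGroup P₀] [Module R P₀]

/-- The Plücker relation for forms on projective modules of rank two. -/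
theorem plucker [Module.Finite R P₀] [Module.Projective R P₀]
    (hP : ∀ p : PrimeSpectrum R, Module.rankAtStalk P₀ p = 2)
    {B : P₀ →ₗ[R] P₀ →ₗ[R] R} (hB : ∀ p, B p p = 0) (u v p q : P₀) :
    B u v * B p q = B u p * B v q - B u q * B v p := by
  have h := congrArg (B u) (cyclic_identity hP hB p q v)
  simp only [map_add, map_smul, smul_eq_mul, map_zero] at h
  rw [form_swap hB v q] at h
  linear_combination h

/-- The values of `χ₀` generate the unit ideal, so one of them is outside `m`. The frame forms are
pairings with the two vectors, and the expansion is `cyclic_identity`. -/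
theorem exists_frame [Module.Finite R P₀] [Module.Projective R P₀]
    (hP : ∀ p : PrimeSpectrum R, Module.rankAtStalk P₀ p = 2) (θ₀ : R ≃ₗ[R] ⋀[R]^2 P₀)
    (m : Ideal R) (hm : m.IsPrime) :
    ∃ s ∉ m, ∃ (v₁ v₂ : P₀) (l₁ l₂ : Dual R P₀), l₁ v₁ = s ∧ l₁ v₂ = 0 ∧ l₂ v₁ = 0 ∧ l₂ v₂ = s ∧
      ∀ x, s • x = l₁ x • v₁ + l₂ x • v₂ := by
  have hex : ∃ x : P₀ × P₀, chi0Form θ₀ x.1 x.2 ∉ m := by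
    by_contra! hcon
    refine hm.ne_top (top_le_iff.1 ?_)
    rw [← chi0Form_span θ₀, Ideal.span_le]
    rintro _ ⟨x, rfl⟩
    exact hcon x
  obtain ⟨⟨v₁, v₂⟩, hs⟩ := hex
  refine ⟨chi0Form θ₀ v₁ v₂, hs, v₁, v₂, (chi0Form θ₀).flip v₂, chi0Form θ₀ v₁, rfl,
    chi0Form_alt θ₀ _, chi0Form_alt θ₀ _, rfl, fun x => ?_⟩
  have h := cyclic_identity hP (chi0Form_alt θ₀) v₁ v₂ x
  rw [form_swap (chi0Form_alt θ₀) x v₂, form_swap (chi0Form_alt θ₀) v₁ x] at h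
  rw [LinearMap.flip_apply, ← sub_eq_zero, ← h]
  module

theorem hasFrames_two [Module.Finite R P₀] [Module.Projective R P₀]
    (hP : ∀ p : PrimeSpectrum R, Module.rankAtStalk P₀ p = 2) (θ₀ : R ≃ₗ[R] ⋀[R]^2 P₀) :
    HasFrames R P₀ 2 := by
  intro m hm
  obtain ⟨s, hs, v₁, v₂, l₁, l₂, h11, h12, h21, h22, hx⟩ := exists_frame hP θ₀ m hm
  refine ⟨s, hs, ![v₁, v₂], ![l₁, l₂], fun i j => ?_, fun x => ?_⟩
  · fin_cases i <;> fin_cases j <;> simp [h11, h12, h21, h22]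
  · simp [Fin.sum_univ_two, hx]

/-- Transvections of `P₀ ⊕ R` along unimodular vectors are elementary. -/
theorem hasTransvection_elemGroup [Module.Finite R P₀] [Module.Projective R P₀]
    (hP : ∀ p : PrimeSpectrum R, Module.rankAtStalk P₀ p = 2) (θ₀ : R ≃ₗ[R] ⋀[R]^2 P₀)
    {w : P₀ × R} {a f : Dual R (P₀ × R)} (ha : a w = 1) (hf : f w = 0) :
    HasTransvection (elemGroup R P₀ R) w f := by
  refine hasTransvection_of_unimodular (e := (0, 1)) (d := LinearMap.snd R P₀ R) (by simp) ?_ ?_ ?_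
    ha hf
  · intro f hf
    refine ⟨LinearEquiv.transvection hf, Subgroup.subset_closure (Or.inr
      ⟨f ∘ₗ LinearMap.inl R P₀ R, fun x => ?_⟩), fun _ => rfl⟩
    have : f x = f (x.1, 0) := by
      have h1 : x = (x.1, 0) + x.2 • ((0, 1) : P₀ × R) := by ext <;> simp
      rw [h1, map_add, map_smul, hf]
      simp
    rw [LinearEquiv.transvection.apply, this]
    simp
  · intro u hu
    have hu' : u.2 = 0 := hu
    refine ⟨LinearEquiv.transvection hu, Subgroup.subset_closure (Or.inl
      ⟨LinearMap.toSpanSingleton R P₀ u.1, fun x => ?_⟩), fun _ => rfl⟩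
    rw [LinearEquiv.transvection.apply]
    ext <;> simp [hu']
  · intro m hm
    obtain ⟨s, hs, v₁, v₂, l₁, l₂, h11, h12, h21, h22, hx⟩ := exists_frame hP θ₀ m hm
    refine ⟨s, hs, 2, ![(v₁, 0), (v₂, 0)],
      ![l₁ ∘ₗ LinearMap.fst R P₀ R, l₂ ∘ₗ LinearMap.fst R P₀ R], le_rfl, ?_, ?_, ?_, ?_⟩
    · intro i; fin_cases i <;> simp
    · intro i; fin_cases i <;> simp
    · intro i j; fin_cases i <;> fin_cases j <;> simp [h11, h12, h21, h22]
    · intro x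
      ext <;> simp [Fin.sum_univ_two, hx]

/-- Transvections of `P₀ ⊕ R ⊕ R` along unimodular vectors are elementary. -/
theorem transvectionGroup_le_closure [Module.Finite R P₀] [Module.Projective R P₀]
    (hP : ∀ p : PrimeSpectrum R, Module.rankAtStalk P₀ p = 2) (θ₀ : R ≃ₗ[R] ⋀[R]^2 P₀) :
    transvectionGroup R (P₀ × R × R) ≤ Subgroup.closure
      ({φ | ∃ f : Dual R (P₀ × R × R), f (0, 0, 1) = 0 ∧ ∀ x, φ x = x + f x • (0, 0, 1)} ∪
       {φ | ∃ u : P₀ × R × R, u.2.2 = 0 ∧ ∀ x, φ x = x + x.2.2 • u}) := by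
  rw [transvectionGroup, Subgroup.closure_le]
  rintro φ ⟨w, f, a, ha, hf, h⟩
  obtain ⟨ψ, hψ, h'⟩ := hasTransvection_of_unimodular
    (H := Subgroup.closure
      ({φ | ∃ f : Dual R (P₀ × R × R), f (0, 0, 1) = 0 ∧ ∀ x, φ x = x + f x • (0, 0, 1)} ∪
       {φ | ∃ u : P₀ × R × R, u.2.2 = 0 ∧ ∀ x, φ x = x + x.2.2 • u}))
    (e := ((0, 0, 1) : P₀ × R × R)) (d := LinearMap.snd R R R ∘ₗ LinearMap.snd R P₀ (R × R))
    (by simp)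
    (fun f hf => ⟨LinearEquiv.transvection hf,
      Subgroup.subset_closure (Or.inl ⟨f, hf, fun _ => rfl⟩), fun _ => rfl⟩)
    (fun u hu => ⟨LinearEquiv.transvection hu,
      Subgroup.subset_closure (Or.inr ⟨u, hu, fun _ => rfl⟩), fun _ => rfl⟩)
    (fun m hm => by
      obtain ⟨s, hs, v₁, v₂, l₁, l₂, h11, h12, h21, h22, hx⟩ := exists_frame hP θ₀ m hm
      refine ⟨s, hs, 3, ![(v₁, 0, 0), (v₂, 0, 0), (0, 1, 0)],
        ![l₁ ∘ₗ LinearMap.fst R P₀ (R × R), l₂ ∘ₗ LinearMap.fst R P₀ (R × R),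
          s • LinearMap.fst R R R ∘ₗ LinearMap.snd R P₀ (R × R)], by norm_num, ?_, ?_, ?_, ?_⟩
      · intro i; fin_cases i <;> simp
      · intro i; fin_cases i <;> simp
      · intro i j; fin_cases i <;> fin_cases j <;> simp [h11, h12, h21, h22]
      · intro x
        ext <;> simp [Fin.sum_univ_three, hx]) ha hf
  obtain rfl : φ = ψ := LinearEquiv.ext fun x => by rw [h, h']
  exact hψ

theorem lastRow_apply (χ : AltIso R (P₀ × R × R)) (x : P₀ × R) :
    (lastRow χ).1 x = χ.form (x.1, x.2, 0) (0, 0, 1) := rfl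

theorem UmE.mk_eq_mk {a b : Um R (P₀ × R)} :
    UmE.mk a = UmE.mk b ↔ ∃ φ ∈ elemGroup R P₀ R, b.1 = a.1 ∘ₗ φ.toLinearMap :=
  Quotient.eq (r := elemSetoid R P₀ R)

/-- The vector of `P₀ ⊕ R` dual to `e₄` with respect to a form on `P₀ ⊕ R ⊕ R`. -/
theorem exists_radical (χ : AltIso R (P₀ × R × R)) :
    ∃ w : P₀ × R, (∀ x, χ.form (w.1, w.2, 0) x = x.2.2) ∧ (lastRow χ).1 w = 1 := by
  obtain ⟨w, hw⟩ := χ.bij.2 (LinearMap.snd R R R ∘ₗ LinearMap.snd R P₀ (R × R))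
  have h0 : w.2.2 = 0 := by
    -- As `w` represents the `e₄`-coordinate, `χ(w, w) = 0` says that this coordinate of `w`
    -- vanishes.
    have := χ.alt w
    rwa [hw] at this
  have hw' : w = (w.1, w.2.1, 0) := by ext <;> simp [h0]
  have h1 : ∀ x, χ.form (w.1, w.2.1, 0) x = x.2.2 := fun x => by rw [← hw', hw]; rfl
  exact ⟨(w.1, w.2.1), h1, by rw [lastRow_apply, h1]⟩

/-- It suffices to treat transvections along `e₄` and those that add `u` to `e₄`. The former leave
the last row unchanged. The latter add `χ(-, u)` to it, which is the effect of the transvection of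
`P₀ ⊕ R` along the vector `w` dual to `e₄`, and that one is elementary. -/
theorem mk_lastRow_pull [Module.Finite R P₀] [Module.Projective R P₀]
    (hP : ∀ p : PrimeSpectrum R, Module.rankAtStalk P₀ p = 2) (θ₀ : R ≃ₗ[R] ⋀[R]^2 P₀)
    {τ : (P₀ × R × R) ≃ₗ[R] (P₀ × R × R)} (hτ : τ ∈ transvectionGroup R (P₀ × R × R))
    (χ : AltIso R (P₀ × R × R)) : UmE.mk (lastRow (χ.pull τ)) = UmE.mk (lastRow χ) := by
  have hτ' := transvectionGroup_le_closure hP θ₀ hτ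
  clear hτ
  induction hτ' using Subgroup.closure_induction generalizing χ with
  | mem τ h =>
    rcases h with ⟨f, hf, h⟩ | ⟨u, hu, h⟩
    · congr 1
      refine Subtype.ext (LinearMap.ext fun x => ?_)
      rw [lastRow_apply, lastRow_apply, AltIso.pull_form, h, h, hf]
      simp only [map_add, map_smul, LinearMap.add_apply, LinearMap.smul_apply, χ.alt, zero_smul,
        smul_zero, add_zero]
    · obtain ⟨w, hw, hw1⟩ := exists_radical χ
      let f : Dual R (P₀ × R) := χ.form.flip u ∘ₗ LinearMap.prod (LinearMap.fst R P₀ R)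
        (LinearMap.prod (LinearMap.snd R P₀ R) 0)
      have hf : ∀ x, f x = χ.form (x.1, x.2, 0) u := fun x => rfl
      obtain ⟨φ, hφ, hφx⟩ := hasTransvection_elemGroup hP θ₀ hw1 (f := f) (by rw [hf, hw, hu])
      symm
      refine UmE.mk_eq_mk.2 ⟨φ, hφ, LinearMap.ext fun x => ?_⟩
      rw [LinearMap.comp_apply, LinearEquiv.coe_coe, hφx, map_add, map_smul, hw1, hf,
        lastRow_apply, lastRow_apply, AltIso.pull_form, h, h]
      simp
  | one => rfl
  | mul σ τ _ _ h1 h2 =>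
    rw [AltIso.pull_mul, h2, h1]
  | inv τ _ h =>
    have h1 := h (χ.pull τ⁻¹)
    rw [← AltIso.pull_mul, inv_mul_cancel, AltIso.pull_one] at h1
    exact h1.symm

/-! ### The volume form and the dependence of `V(a, s)` on `s` and on the orbit of `a` -/

variable (θ₀ : R ≃ₗ[R] ⋀[R]^2 P₀)

theorem volForm_cyclic (u v w : P₀ × R) : volForm θ₀ u v w = volForm θ₀ v w u := by
  simp only [volForm_apply]
  ring

theorem volForm_swap (u v w : P₀ × R) : volForm θ₀ u w v = - volForm θ₀ u v w :=
  form_swap (volForm_alt θ₀ u) v w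

theorem volForm_self_left (u v : P₀ × R) : volForm θ₀ u u v = 0 := by
  rw [volForm_cyclic, volForm_cyclic θ₀ u v u, volForm_alt]

theorem volForm_self_right (u v : P₀ × R) : volForm θ₀ u v u = 0 := by
  rw [volForm_cyclic, volForm_alt]

theorem exists_sect (a : Um R (P₀ × R)) {w : P₀ × R} (hw : a.1 w = 1) :
    ∃ s : Sect a, s.1 1 = w :=
  ⟨⟨LinearMap.toSpanSingleton R _ w, by ext; simp [hw]⟩, by simp⟩

instance nonempty_sect (a : Um R (P₀ × R)) : Nonempty (Sect a) := by
  obtain ⟨w, hw⟩ := a.2 1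
  obtain ⟨s, -⟩ := exists_sect a hw
  exact ⟨s⟩

theorem exists_ker_decomposition (a : Um R (P₀ × R)) (s : Sect a) (x : P₀ × R) :
    ∃ k : LinearMap.ker a.1, x = (k : P₀ × R) + a.1 x • s.1 1 := by
  refine ⟨(splitEquiv a s x).1, ?_⟩
  rw [← map_smul, smul_eq_mul, mul_one]
  exact ((splitEquiv a s).symm_apply_apply x).symm

variable [Module.Finite R P₀] [Module.Projective R P₀]
  (hP : ∀ p : PrimeSpectrum R, Module.rankAtStalk P₀ p = 2)

theorem chiA_form (a : Um R (P₀ × R)) (s : Sect a) (p q : LinearMap.ker a.1) :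
    (chiA hP θ₀ a s).form p q = volForm θ₀ (s.1 1) p q := rfl

/-- The projection to `ker a` disappears because `s(1)` already fills one slot of the volume form.
-/
theorem vForm_form (a : Um R (P₀ × R)) (s : Sect a) (x y : P₀ × R × R) :
    (vForm hP θ₀ a s).form x y = volForm θ₀ (s.1 1) (x.1, x.2.1) (y.1, y.2.1)
      + a.1 (x.1, x.2.1) * y.2.2 - x.2.2 * a.1 (y.1, y.2.1) := by
  have h : ∀ z : P₀ × R, s.1 (a.1 z) = a.1 z • s.1 1 := fun z => by
    rw [← map_smul, smul_eq_mul, mul_one]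
  have h1 : (vForm hP θ₀ a s).form x y
      = volForm θ₀ (s.1 1) ((x.1, x.2.1) - s.1 (a.1 (x.1, x.2.1)))
        ((y.1, y.2.1) - s.1 (a.1 (y.1, y.2.1)))
        + (a.1 (x.1, x.2.1) * y.2.2 - x.2.2 * a.1 (y.1, y.2.1)) := rfl
  rw [h1, h, h]
  simp only [map_sub, map_smul, LinearMap.sub_apply, LinearMap.smul_apply, volForm_self_left,
    volForm_self_right, smul_zero, sub_zero]
  ring

theorem lastRow_vForm (a : Um R (P₀ × R)) (s : Sect a) : lastRow (vForm hP θ₀ a s) = a := by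
  refine Subtype.ext (LinearMap.ext fun x => ?_)
  have h0 : volForm θ₀ (s.1 1) x ((0, 0) : P₀ × R) = 0 := map_zero _
  rw [lastRow_apply, vForm_form]
  simp [h0]

/-- Two sections differ by an element `k` of `ker a`. As the volume form vanishes on this kernel of
rank two, contracting it with `k` gives the wedge of `a` with a linear form, which a transvection
along `e₄` absorbs. -/
theorem exists_pull_of_sect (a : Um R (P₀ × R)) (s s' : Sect a) :
    ∃ τ ∈ transvectionGroup R (P₀ × R × R), vForm hP θ₀ a s' = (vForm hP θ₀ a s).pull τ := by
  set t := s.1 1 with ht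
  set k := s'.1 1 - t with hk
  have hkk : k ∈ LinearMap.ker a.1 := by simp [hk, ht, Sect.apply]
  let f : Dual R (P₀ × R × R) := volForm θ₀ k t ∘ₗ LinearMap.prod (LinearMap.fst R P₀ (R × R))
    (LinearMap.fst R R R ∘ₗ LinearMap.snd R P₀ (R × R))
  have hf : ∀ x, f x = volForm θ₀ k t (x.1, x.2.1) := fun x => rfl
  obtain ⟨τ, hτ, hx⟩ := hasTransvection_transvectionGroup (w := ((0, 0, 1) : P₀ × R × R)) (f := f)
    (a := LinearMap.snd R R R ∘ₗ LinearMap.snd R P₀ (R × R)) (by simp) (by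
      rw [hf]; exact map_zero _)
  refine ⟨τ, hτ, AltIso.ext_form fun x y => ?_⟩
  have key : ∀ p q, volForm θ₀ k p q
      = a.1 p * volForm θ₀ k t q - volForm θ₀ k t p * a.1 q := by
    intro p q
    obtain ⟨kp, hp⟩ := exists_ker_decomposition a s p
    obtain ⟨kq, hq⟩ := exists_ker_decomposition a s q
    generalize a.1 p = α at *
    generalize a.1 q = β at *
    rw [← ht] at hp hq
    have h0 := volForm_ker hP θ₀ a s kp kq ⟨k, hkk⟩
    simp only at h0
    have h1 := volForm_swap θ₀ k t kp
    rw [hp, hq]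
    simp only [map_add, map_smul, LinearMap.add_apply, LinearMap.smul_apply, smul_eq_mul, h0,
      volForm_alt, h1]
    ring
  have hs' : s'.1 1 = t + k := by simp [hk]
  have hadd : ∀ p q, volForm θ₀ (t + k) p q = volForm θ₀ t p q + volForm θ₀ k p q := by
    intro p q
    rw [volForm_cyclic, map_add, ← volForm_cyclic θ₀ t, ← volForm_cyclic θ₀ k]
  rw [vForm_form, hs', hadd, key, AltIso.pull_form, vForm_form, hx, hx, hf, hf]
  simp only [Prod.fst_add, Prod.snd_add, Prod.smul_fst, Prod.smul_snd, smul_zero, add_zero,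
    smul_eq_mul, mul_one, ← ht]
  ring_nf

/-- Elementary equivalent unimodular elements have forms that differ by transvections. -/
theorem exists_pull_of_mk_eq {a a' : Um R (P₀ × R)} (h : UmE.mk a = UmE.mk a') (s : Sect a)
    (s' : Sect a') :
    ∃ τ ∈ transvectionGroup R (P₀ × R × R), vForm hP θ₀ a' s' = (vForm hP θ₀ a s).pull τ := by
  obtain ⟨g, hg, hag⟩ := UmE.mk_eq_mk.1 h
  clear h
  rw [elemGroup] at hg
  -- A volume preserving `g` extends by the identity on `e₄` to a map that carries `V(a, s)` to the
  -- form of `a ∘ g` and the transported section.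
  have lift : ∀ {a a' : Um R (P₀ × R)} (s : Sect a) (s' : Sect a')
      (g : (P₀ × R) ≃ₗ[R] (P₀ × R)), a'.1 = a.1 ∘ₗ g.toLinearMap →
      (∀ u v w, volForm θ₀ (g u) (g v) (g w) = volForm θ₀ u v w) →
      ∀ {w : P₀ × R × R} {f : Dual R (P₀ × R × R)},
      HasTransvection (transvectionGroup R (P₀ × R × R)) w f →
      (∀ x, ((x + f x • w).1, (x + f x • w).2.1) = g (x.1, x.2.1)) →
      (∀ x, (x + f x • w).2.2 = x.2.2) →
      ∃ τ ∈ transvectionGroup R (P₀ × R × R), vForm hP θ₀ a' s' = (vForm hP θ₀ a s).pull τ := by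
    intro a a' s s' g hag hvol w f hT h1 h2
    obtain ⟨t, ht⟩ := exists_sect a' (w := g.symm (s.1 1)) (by simp [hag, Sect.apply])
    obtain ⟨τ, hτ, hx⟩ := hT
    obtain ⟨σ, hσ, hσ'⟩ := exists_pull_of_sect θ₀ hP a' t s'
    refine ⟨τ * σ, mul_mem hτ hσ, ?_⟩
    have : vForm hP θ₀ a' t = (vForm hP θ₀ a s).pull τ := by
      have hag' : ∀ z, a'.1 z = a.1 (g z) := fun z => LinearMap.congr_fun hag z
      refine AltIso.ext_form fun x y => ?_
      rw [vForm_form, AltIso.pull_form, vForm_form, hx, hx, h1, h1, h2, h2, hag', hag', ht, ← hvol,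
        g.apply_symm_apply]
    rw [hσ', this, AltIso.pull_mul]
  induction hg using Subgroup.closure_induction generalizing a a' with
  | mem g hg =>
    rcases hg with ⟨v, hv⟩ | ⟨l, hl⟩
    -- The vector `(v 1, 0, 0)` need not be unimodular, so it is written as the sum of the
    -- unimodular vectors `(v 1, 0, 1)` and `(0, 0, -1)`.
    · have h1 := hasTransvection_transvectionGroup (w := ((v 1, 0, 1) : P₀ × R × R))
        (f := LinearMap.fst R R R ∘ₗ LinearMap.snd R P₀ (R × R))
        (a := LinearMap.snd R R R ∘ₗ LinearMap.snd R P₀ (R × R)) (by simp) (by simp)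
      have h2 := hasTransvection_transvectionGroup (w := ((0, 0, -1) : P₀ × R × R))
        (f := LinearMap.fst R R R ∘ₗ LinearMap.snd R P₀ (R × R))
        (a := -LinearMap.snd R R R ∘ₗ LinearMap.snd R P₀ (R × R)) (by simp) (by simp)
      have hv1 : ∀ r, v r = r • v 1 := fun r => by rw [← map_smul, smul_eq_mul, mul_one]
      refine lift s s' g hag (fun p q r => ?_) (h1.add_left h2 (by simp)) (fun x => ?_)
        (fun x => ?_)
      · have e1 := form_swap (chi0Form_alt θ₀) (v 1) p.1
        have e2 := form_swap (chi0Form_alt θ₀) (v 1) q.1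
        have e3 := form_swap (chi0Form_alt θ₀) (v 1) r.1
        simp only [hv, volForm_apply, Prod.fst_add, Prod.snd_add, map_add, LinearMap.add_apply,
          hv1 p.2, hv1 q.2, hv1 r.2, map_smul, LinearMap.smul_apply, smul_eq_mul, chi0Form_alt,
          e1, e2, e3, add_zero]
        ring
      · rw [hv]
        ext <;> simp [hv1 x.2.1]
      · simp
    · refine lift s s' g hag (fun p q r => ?_) (hasTransvection_transvectionGroup
        (w := ((0, 1, 0) : P₀ × R × R)) (f := l ∘ₗ LinearMap.fst R P₀ (R × R))
        (a := LinearMap.fst R R R ∘ₗ LinearMap.snd R P₀ (R × R)) (by simp) (by simp))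
        (fun x => ?_) (fun x => ?_)
      · have hc : ∀ p q r : P₀, l r * chi0Form θ₀ p q + l p * chi0Form θ₀ q r
            + l q * chi0Form θ₀ r p = 0 := fun p q r => by
          have := congrArg l (cyclic_identity hP (chi0Form_alt θ₀) p q r)
          simp only [map_add, map_smul, smul_eq_mul, map_zero] at this
          linear_combination this
        simp only [hl, volForm_apply, Prod.fst_add, Prod.snd_add, add_zero]
        linear_combination hc q.1 r.1 p.1
      · rw [hl]
        ext <;> simp
      · simp
  | one =>
    obtain rfl : a' = a := Subtype.ext hag
    exact exists_pull_of_sect θ₀ hP a' s s'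
  | mul g g' _ _ h1 h2 =>
    let b : Um R (P₀ × R) := ⟨a.1 ∘ₗ g.toLinearMap, a.2.comp g.surjective⟩
    obtain ⟨t⟩ := nonempty_sect b
    obtain ⟨τ, hτ, h3⟩ := h1 (a' := b) s t rfl
    obtain ⟨σ, hσ, h4⟩ := h2 (a := b) t s' (by rw [hag]; rfl)
    exact ⟨τ * σ, mul_mem hτ hσ, by rw [h4, h3, AltIso.pull_mul]⟩
  | inv g _ h1 =>
    have h2 : a.1 = a'.1 ∘ₗ g.toLinearMap := by
      rw [hag]
      ext1
      · ext1 x; simp [LinearEquiv.coe_inv]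
      · ext1; simp [LinearEquiv.coe_inv]
    obtain ⟨τ, hτ, h3⟩ := h1 s' s h2
    refine ⟨τ⁻¹, inv_mem hτ, ?_⟩
    rw [h3, ← AltIso.pull_mul, mul_inv_cancel, AltIso.pull_one]

end Symbol

end Vaserstein
end

noncomputable section
namespace Vaserstein

/-! ### Pfaffians of the forms `V(a, s)` -/

section SymbolPfaffian

open Module (Dual)

variable {R : Type u} [CommRing R]

section Extend

variable {W Q : Type u} [AddCommGroup W] [Module R W] [AddCommGroup Q] [Module R Q]

/-- The orthogonal sum of a bilinear form and a non-degenerate alternating form. -/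
def extendForm (B : W →ₗ[R] W →ₗ[R] R) (q : AltIso R Q) : (W × Q) →ₗ[R] (W × Q) →ₗ[R] R :=
  B.compl₁₂ (LinearMap.fst R W Q) (LinearMap.fst R W Q) +
    q.form.compl₁₂ (LinearMap.snd R W Q) (LinearMap.snd R W Q)

theorem extendForm_apply (B : W →ₗ[R] W →ₗ[R] R) (q : AltIso R Q) (x y : W × Q) :
    extendForm B q x y = B x.1 y.1 + q.form x.2 y.2 := rfl

theorem perp_form_eq_extendForm (f : AltIso R W) (q : AltIso R Q) :
    (f.perp q).form = extendForm f.form q := rfl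

variable {n : ℕ} (b : Module.Basis (Fin n × Fin 2) R (W × Q)) (q : AltIso R Q)

theorem relPf_extendForm_of_transvection {B B' : W →ₗ[R] W →ₗ[R] R} (hB : ∀ v, B v v = 0)
    (f : Dual R W) (v : W) (h : ∀ x y, B' x y = B (x + f x • v) (y + f y • v)) :
    relPf b (extendForm B' q) = (1 + f v) * relPf b (extendForm B q) := by
  have h1 := relPf_compl₁₂_transvection b (B := extendForm B q)
    (fun x => by rw [extendForm_apply, hB, q.alt, add_zero]) (f ∘ₗ LinearMap.fst R W Q) (v, 0)
  rw [LinearMap.comp_apply, LinearMap.fst_apply] at h1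
  rw [← h1]
  congr 1
  refine LinearMap.ext fun x => LinearMap.ext fun y => ?_
  rw [LinearMap.compl₁₂_apply, LinearMap.transvection.apply, LinearMap.transvection.apply,
    extendForm_apply, extendForm_apply, h]
  simp

theorem pow_mul_relPf_extendForm_smul_add {κ ρ : W →ₗ[R] W →ₗ[R] R} (hκ : ∀ v, κ v v = 0)
    (hρ : ∀ v, ρ v v = 0) (y : R) (f : Dual R W) (v : W)
    (hf : ∀ p q, f v * κ p q = f p * κ v q - f q * κ v p) (hv : ∀ x, ρ v x = 0) :
    f v ^ (2 * n + 1) *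
      (relPf b (extendForm (y • κ + ρ) q) - y * relPf b (extendForm (κ + ρ) q)) = 0 := by
  have h := pow_mul_relPf_smul_add b
    (κ := κ.compl₁₂ (LinearMap.fst R W Q) (LinearMap.fst R W Q)) (ρ := extendForm ρ q)
    (fun x => hκ _) (fun x => by rw [extendForm_apply, hρ, q.alt, add_zero]) y
    (f ∘ₗ LinearMap.fst R W Q) (v, 0) (fun x y => hf _ _)
    (LinearMap.ext fun x => by rw [extendForm_apply, hv]; simp)
  have e : ∀ B C : W →ₗ[R] W →ₗ[R] R, extendForm (B + C) q
      = B.compl₁₂ (LinearMap.fst R W Q) (LinearMap.fst R W Q) + extendForm C q := fun B C =>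
    (add_assoc (B.compl₁₂ (LinearMap.fst R W Q) (LinearMap.fst R W Q))
      (C.compl₁₂ (LinearMap.fst R W Q) (LinearMap.fst R W Q)) _)
  rw [e, e]
  exact h

end Extend

variable {P₀ : Type u} [AddCommGroup P₀] [Module R P₀] (θ₀ : R ≃ₗ[R] ⋀[R]^2 P₀)

/-- The alternating form on `P₀ ⊕ R ⊕ R` given by `w` and `a`; for `a w = 1` it is `V(a, s)` with
`s 1 = w`. -/
def symbolForm (w : P₀ × R) (a : Dual R (P₀ × R)) :
    (P₀ × R × R) →ₗ[R] (P₀ × R × R) →ₗ[R] R :=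
  let π : (P₀ × R × R) →ₗ[R] (P₀ × R) := LinearMap.prod (LinearMap.fst R P₀ (R × R))
    (LinearMap.fst R R R ∘ₗ LinearMap.snd R P₀ (R × R))
  let e : Dual R (P₀ × R × R) := LinearMap.snd R R R ∘ₗ LinearMap.snd R P₀ (R × R)
  (volForm θ₀ w).compl₁₂ π π + ((a ∘ₗ π).smulRight e - e.smulRight (a ∘ₗ π))

theorem symbolForm_apply (w : P₀ × R) (a : Dual R (P₀ × R)) (x y : P₀ × R × R) :
    symbolForm θ₀ w a x y = volForm θ₀ w (x.1, x.2.1) (y.1, y.2.1)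
      + (a (x.1, x.2.1) * y.2.2 - x.2.2 * a (y.1, y.2.1)) := rfl

theorem symbolForm_alt (w : P₀ × R) (a : Dual R (P₀ × R)) (x : P₀ × R × R) :
    symbolForm θ₀ w a x x = 0 := by
  rw [symbolForm_apply, volForm_alt]
  ring

variable [Module.Finite R P₀] [Module.Projective R P₀]
  (hP : ∀ p : PrimeSpectrum R, Module.rankAtStalk P₀ p = 2)

theorem vForm_eq_symbolForm (a : Um R (P₀ × R)) (s : Sect a) :
    (vForm hP θ₀ a s).form = symbolForm θ₀ (s.1 1) a.1 := by
  refine LinearMap.ext fun x => LinearMap.ext fun y => ?_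
  rw [vForm_form, symbolForm_apply]
  ring

variable {Q : Type u} [AddCommGroup Q] [Module R Q] {n : ℕ}
  (b : Module.Basis (Fin n × Fin 2) R ((P₀ × R × R) × Q)) (q : AltIso R Q)

/-- The rescaling lemma applies with `f = χ₀(u, -)` for all `u`, `v`, and the values `χ₀(u, v)`
generate the unit ideal. -/
theorem relPf_smul_chi0 (y : R) :
    relPf b (extendForm (y • (chi0Form θ₀).compl₁₂ (LinearMap.fst R P₀ (R × R))
        (LinearMap.fst R P₀ (R × R)) +
      (AltIso.psi2 R).form.compl₁₂ (LinearMap.snd R P₀ (R × R)) (LinearMap.snd R P₀ (R × R))) q)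
    = y * relPf b (((chi0 hP θ₀).perp (AltIso.psi2 R)).perp q).form := by
  rw [← sub_eq_zero]
  refine eq_zero_of_span_pow_mul (chi0Form_span θ₀) (2 * n + 1) ?_
  rintro _ ⟨⟨u, v⟩, rfl⟩
  exact pow_mul_relPf_extendForm_smul_add b q
    (κ := (chi0Form θ₀).compl₁₂ (LinearMap.fst R P₀ (R × R)) (LinearMap.fst R P₀ (R × R)))
    (ρ := (AltIso.psi2 R).form.compl₁₂ (LinearMap.snd R P₀ (R × R)) (LinearMap.snd R P₀ (R × R)))
    (fun _ => chi0Form_alt θ₀ _) (fun _ => (AltIso.psi2 R).alt _) y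
    (chi0Form θ₀ u ∘ₗ LinearMap.fst R P₀ (R × R)) (v, 0)
    (fun x y => plucker hP (chi0Form_alt θ₀) u v x.1 y.1)
    (fun x => by simp)

/-- The map sending `e₃` to `w`, of determinant `w.2`, followed by a shear of determinant one, turns
the symbol form into `w.2 χ₀ ⟂ ψ₂`, whose Pfaffian is `w.2`. -/
theorem mul_relPf_symbolForm
    (h0 : relPf b (((chi0 hP θ₀).perp (AltIso.psi2 R)).perp q).form = 1)
    {w : P₀ × R} {a : Dual R (P₀ × R)} (ha : a w = 1) :
    w.2 * relPf b (extendForm (symbolForm θ₀ w a) q) = w.2 := by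
  have h1 := relPf_smul_chi0 θ₀ hP b q w.2
  rw [h0, mul_one] at h1
  set B₀ : (P₀ × R × R) →ₗ[R] (P₀ × R × R) →ₗ[R] R :=
    w.2 • (chi0Form θ₀).compl₁₂ (LinearMap.fst R P₀ (R × R)) (LinearMap.fst R P₀ (R × R)) +
      (AltIso.psi2 R).form.compl₁₂ (LinearMap.snd R P₀ (R × R)) (LinearMap.snd R P₀ (R × R))
    with hB₀
  set a₀ : Dual R (P₀ × R × R) := a ∘ₗ LinearMap.inl R P₀ R ∘ₗ LinearMap.fst R P₀ (R × R) with ha₀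
  set e : Dual R (P₀ × R × R) := LinearMap.snd R R R ∘ₗ LinearMap.snd R P₀ (R × R) with he
  have hB₀' : ∀ x y, B₀ x y
      = w.2 * chi0Form θ₀ x.1 y.1 + (x.2.1 * y.2.2 - x.2.2 * y.2.1) := fun x y => rfl
  have hB₁ : ∀ x y, (B₀ + (a₀.smulRight e - e.smulRight a₀)) x y
      = B₀ x y + (a (x.1, 0) * y.2.2 - x.2.2 * a (y.1, 0)) := fun x y => rfl
  have h2 := relPf_extendForm_of_transvection b q (symbolForm_alt θ₀ w a)
    (B' := B₀ + (a₀.smulRight e - e.smulRight a₀))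
    (LinearMap.fst R R R ∘ₗ LinearMap.snd R P₀ (R × R)) (w.1, w.2 - 1, 0) (fun x y => by
      have e1 : ∀ z : P₀ × R × R, ((z + z.2.1 • ((w.1, w.2 - 1, 0) : P₀ × R × R)).1,
          (z + z.2.1 • ((w.1, w.2 - 1, 0) : P₀ × R × R)).2.1)
          = (z.1, (0 : R)) + z.2.1 • w := fun z => by
        ext
        · simp
        · simp; ring
      have e2 : ∀ z : P₀ × R × R, (z + z.2.1 • ((w.1, w.2 - 1, 0) : P₀ × R × R)).2.2 = z.2.2 :=
        fun z => by simp
      have e3 : volForm θ₀ w (x.1, 0) (y.1, 0) = w.2 * chi0Form θ₀ x.1 y.1 := by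
        simp [volForm_apply]
      rw [hB₁, hB₀', symbolForm_apply]
      simp only [LinearMap.comp_apply, LinearMap.fst_apply,
        LinearMap.snd_apply, e1, e2, map_add, map_smul, LinearMap.add_apply,
        LinearMap.smul_apply, ha, volForm_self_left, volForm_self_right, e3, smul_eq_mul]
      ring)
  have h3 := relPf_extendForm_of_transvection b q (B := B₀ + (a₀.smulRight e - e.smulRight a₀))
    (B' := B₀) (fun x => by rw [hB₁, hB₀', chi0Form_alt]; ring) (-a₀) (0, 1, 0) (fun x y => by
      rw [hB₁, hB₀', hB₀']
      simp [ha₀]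
      ring)
  have h4 : (-a₀) (0, 1, 0) = 0 := by
    rw [LinearMap.neg_apply, ha₀, LinearMap.comp_apply, LinearMap.comp_apply, LinearMap.fst_apply,
      map_zero, map_zero, neg_zero]
  have h5 : 1 + (LinearMap.fst R R R ∘ₗ LinearMap.snd R P₀ (R × R)) (w.1, w.2 - 1, 0) = w.2 := by
    simp
  rw [h1, h2, h4, h5, add_zero, one_mul] at h3
  exact h3.symm

/-- The factor `w.2` may be a zero divisor. Shears along `e₃` keep the Pfaffian and replace `w.2` by
`w.2 + l(w.1)`. Since `a w = 1`, the choices `l = 0` and `l = A` already yield coefficients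
generating the unit ideal. -/
theorem relPf_symbolForm
    (h0 : relPf b (((chi0 hP θ₀).perp (AltIso.psi2 R)).perp q).form = 1)
    {w : P₀ × R} {a : Dual R (P₀ × R)} (ha : a w = 1) :
    relPf b (extendForm (symbolForm θ₀ w a) q) = 1 := by
  obtain ⟨A, c, hA⟩ : ∃ (A : Dual R P₀) (c : R), ∀ z, a z = A z.1 + c * z.2 := by
    refine ⟨a ∘ₗ LinearMap.inl R P₀ R, a (0, 1), fun z => ?_⟩
    have : z = (z.1, 0) + z.2 • ((0, 1) : P₀ × R) := by ext <;> simp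
    conv_lhs => rw [this, map_add, map_smul]
    rw [smul_eq_mul, mul_comm]
    rfl
  have key : ∀ l : Dual R P₀, (w.2 + l w.1) * relPf b (extendForm (symbolForm θ₀ w a) q)
      = w.2 + l w.1 := by
    intro l
    have h1 := mul_relPf_symbolForm θ₀ hP b q h0 (w := (w.1, w.2 + l w.1))
      (a := a - c • (l ∘ₗ LinearMap.fst R P₀ R)) (by
        rw [hA] at ha
        simp [hA]
        linear_combination ha)
    have h2 := relPf_extendForm_of_transvection b q (B' := symbolForm θ₀ w a)
      (symbolForm_alt θ₀ (w.1, w.2 + l w.1) (a - c • (l ∘ₗ LinearMap.fst R P₀ R)))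
      (l ∘ₗ LinearMap.fst R P₀ (R × R)) (0, 1, 0) (fun x y => by
        have h3 := congrArg l (cyclic_identity hP (chi0Form_alt θ₀) x.1 y.1 w.1)
        simp only [map_add, map_smul, smul_eq_mul, map_zero] at h3
        simp [symbolForm_apply, volForm_apply, hA]
        linear_combination (-1 : R) * h3)
    rw [h2]
    simpa using h1
  have h1 := key 0
  have h2 := key A
  simp only [LinearMap.zero_apply, add_zero] at h1
  rw [hA] at ha
  linear_combination h2 + (c - 1) * h1 - (relPf b (extendForm (symbolForm θ₀ w a) q) - 1) * ha

theorem relPf_vForm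
    (h0 : relPf b (((chi0 hP θ₀).perp (AltIso.psi2 R)).perp q).form = 1)
    (a : Um R (P₀ × R)) (s : Sect a) :
    relPf b ((vForm hP θ₀ a s).perp q).form = 1 := by
  rw [perp_form_eq_extendForm, vForm_eq_symbolForm]
  exact relPf_symbolForm θ₀ hP b q h0 (s.apply 1)

end SymbolPfaffian

end Vaserstein
end

noncomputable section
namespace Vaserstein

/-! ### Forms of Pfaffian one -/

section PfaffianOne

open Module (Dual)

variable {R : Type u} [CommRing R] {P₀ : Type u} [AddCommGroup P₀] [Module R P₀]

/-- Alternating forms on a projective module of rank two are multiples of a unimodular one. -/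
theorem exists_eq_mul_of_span [Module.Finite R P₀] [Module.Projective R P₀]
    (hP : ∀ p : PrimeSpectrum R, Module.rankAtStalk P₀ p = 2)
    {B C : P₀ →ₗ[R] P₀ →ₗ[R] R} (hB : ∀ p, B p p = 0) (hC : ∀ p, C p p = 0)
    (h1 : Ideal.span (Set.range fun x : P₀ × P₀ => B x.1 x.2) = ⊤) :
    ∃ y : R, ∀ p q, C p q = y * B p q := by
  -- Where `B u v` is invertible, `u` and `v` form a basis and the ratio is `C u v / B u v`. The
  -- steps below patch these ratios.
  have h2 : ∀ u v p q, B u v ^ 2 * C p q = B u v * B p q * C u v := by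
    intro u v p q
    have e : ∀ p, B u v • p = B p v • u + B u p • v := by
      intro p
      have h := cyclic_identity hP hB u v p
      rw [form_swap hB p v, form_swap hB u p] at h
      rw [← sub_eq_zero, ← h]
      module
    have e1 : C (B u v • p) (B u v • q) = B u v ^ 2 * C p q := by
      simp only [map_smul, LinearMap.smul_apply, smul_eq_mul]
      ring
    rw [← e1, e, e]
    simp only [map_add, map_smul, LinearMap.add_apply, LinearMap.smul_apply, smul_eq_mul, hC,
      form_swap hC u v]
    have h3 := plucker hP hB u v p q
    rw [form_swap hB q v, form_swap hB p v] at h3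
    linear_combination (-C u v) * h3
  have h3 : ∀ u v p q, B u v * C p q = B p q * C u v := by
    intro u v p q
    rw [← sub_eq_zero]
    refine eq_zero_of_span_pow_mul h1 2 ?_
    rintro _ ⟨⟨x, y⟩, rfl⟩
    linear_combination B u v * h2 x y p q - B p q * h2 x y u v
  have h4 : ∀ r ∈ Ideal.span (Set.range fun x : P₀ × P₀ => B x.1 x.2),
      ∃ y : R, ∀ p q, r * C p q = y * B p q := by
    intro r hr
    induction hr using Submodule.span_induction with
    | mem x hx =>
      obtain ⟨⟨u, v⟩, rfl⟩ := hx
      exact ⟨C u v, fun p q => by rw [h3, mul_comm]⟩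
    | zero => exact ⟨0, fun p q => by rw [zero_mul, zero_mul]⟩
    | add x y _ _ hx hy =>
      obtain ⟨c, hc⟩ := hx
      obtain ⟨d, hd⟩ := hy
      exact ⟨c + d, fun p q => by rw [add_mul, add_mul, hc, hd]⟩
    | smul x y _ hy =>
      obtain ⟨d, hd⟩ := hy
      exact ⟨x * d, fun p q => by rw [smul_eq_mul, mul_assoc, mul_assoc, hd]⟩
  obtain ⟨y, hy⟩ := h4 1 (by rw [h1]; trivial)
  exact ⟨y, fun p q => by rw [← hy, one_mul]⟩

variable [Module.Finite R P₀] [Module.Projective R P₀]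

/-- The vector `w` dual to `e₄` gives a section of the last row, and every pairing involving `w` or
`e₄` is then prescribed. On the kernel, of rank two, `χ` must be a multiple `y` of the volume form.
-/
theorem exists_form_eq_smul_symbolForm
    (hP : ∀ p : PrimeSpectrum R, Module.rankAtStalk P₀ p = 2) (θ₀ : R ≃ₗ[R] ⋀[R]^2 P₀)
    (χ : AltIso R (P₀ × R × R)) :
    ∃ (t : Sect (lastRow χ)) (y : R), χ.form
      = y • symbolForm θ₀ (t.1 1) 0 + symbolForm θ₀ 0 (lastRow χ).1 := by
  obtain ⟨w, hw, hw1⟩ := exists_radical χ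
  obtain ⟨t, ht⟩ := exists_sect (lastRow χ) hw1
  have := ker_finite (lastRow χ) t
  have := ker_projective (lastRow χ) t
  let j : (P₀ × R) →ₗ[R] (P₀ × R × R) := LinearMap.prod (LinearMap.fst R P₀ R)
    (LinearMap.prod (LinearMap.snd R P₀ R) 0)
  have hj : ∀ z : P₀ × R, (z.1, z.2, (0 : R)) = j z := fun _ => rfl
  let i := (LinearMap.ker (lastRow χ).1).subtype
  obtain ⟨y, hy⟩ := exists_eq_mul_of_span (ker_rank hP (lastRow χ) t)
    (C := χ.form.compl₁₂ (j ∘ₗ i) (j ∘ₗ i)) (fun p => volForm_alt θ₀ _ _)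
    (fun p => χ.alt _) (volForm_ker_span hP θ₀ (lastRow χ) t)
  have hy' : ∀ p q : LinearMap.ker (lastRow χ).1, χ.form (j p) (j q) = y * volForm θ₀ w p q := by
    intro p q
    rw [← ht]
    exact hy p q
  refine ⟨t, y, LinearMap.ext fun p => LinearMap.ext fun q => ?_⟩
  have hdec : ∀ x : P₀ × R × R, ∃ k : LinearMap.ker (lastRow χ).1,
      (x.1, x.2.1) = (k : P₀ × R) + (lastRow χ).1 (x.1, x.2.1) • w ∧
      x = j k + (lastRow χ).1 (x.1, x.2.1) • j w + x.2.2 • ((0, 0, 1) : P₀ × R × R) := by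
    intro x
    obtain ⟨k, hk⟩ := exists_ker_decomposition (lastRow χ) t (x.1, x.2.1)
    rw [ht] at hk
    refine ⟨k, hk, ?_⟩
    rw [← map_smul, ← map_add, ← hk, ← hj]
    ext <;> simp
  obtain ⟨k, hk1, hk2⟩ := hdec p
  obtain ⟨l, hl1, hl2⟩ := hdec q
  have hw' : ∀ x, χ.form (j w) x = x.2.2 := hw
  have hk0 : ∀ k : LinearMap.ker (lastRow χ).1, χ.form (j k) (0, 0, 1) = 0 := fun k => k.2
  have hj0 : ∀ z, (j z).2.2 = 0 := fun z => rfl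
  have hv0 : ∀ u v, volForm θ₀ 0 u v = 0 := fun u v => by simp [volForm_apply]
  rw [LinearMap.add_apply, LinearMap.add_apply, LinearMap.smul_apply, LinearMap.smul_apply,
    symbolForm_apply, symbolForm_apply, ht, hv0]
  conv_lhs => rw [hk2, hl2]
  conv_rhs => enter [1, 2, 1]; rw [hk1, hl1]
  generalize (lastRow χ).1 (p.1, p.2.1) = α
  generalize (lastRow χ).1 (q.1, q.2.1) = β
  simp only [map_add, map_smul, LinearMap.add_apply, LinearMap.smul_apply, smul_eq_mul, hy', hw',
    hk0, hj0, χ.alt, form_swap χ.alt (j w) (j _), form_swap χ.alt (j _) (0, 0, 1),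
    volForm_self_left, volForm_self_right, LinearMap.zero_apply]
  ring

variable (hP : ∀ p : PrimeSpectrum R, Module.rankAtStalk P₀ p = 2) (θ₀ : R ≃ₗ[R] ⋀[R]^2 P₀)
  {Q : Type u} [AddCommGroup Q] [Module R Q] {n : ℕ}
  (b : Module.Basis (Fin n × Fin 2) R ((P₀ × R × R) × Q)) (q : AltIso R Q)

/-- A non-degenerate alternating form of Pfaffian one is of the form `V(a, s)`. -/
theorem exists_eq_vForm (h0 : relPf b (((chi0 hP θ₀).perp (AltIso.psi2 R)).perp q).form = 1)
    {χ : AltIso R (P₀ × R × R)} (hχ : relPf b (χ.perp q).form = 1) :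
    ∃ t : Sect (lastRow χ), χ = vForm hP θ₀ (lastRow χ) t := by
  obtain ⟨t, y, hy⟩ := exists_form_eq_smul_symbolForm hP θ₀ χ
  have := ker_finite (lastRow χ) t
  have := ker_projective (lastRow χ) t
  have h1 := relPf_symbolForm θ₀ hP b q h0 (t.apply 1)
  have hv0 : ∀ u v, volForm θ₀ 0 u v = 0 := fun u v => by simp [volForm_apply]
  have h2 : symbolForm θ₀ (t.1 1) (lastRow χ).1
      = symbolForm θ₀ (t.1 1) 0 + symbolForm θ₀ 0 (lastRow χ).1 := by
    refine LinearMap.ext fun x => LinearMap.ext fun z => ?_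
    rw [LinearMap.add_apply, LinearMap.add_apply, symbolForm_apply, symbolForm_apply,
      symbolForm_apply, hv0]
    simp
  rw [perp_form_eq_extendForm, hy] at hχ
  -- The scalar `y` is the Pfaffian of `χ`: rescaling the rank two part compares `χ` with the symbol
  -- form of Pfaffian one.
  have hy1 : 1 - y = 0 := by
    refine eq_zero_of_span_pow_mul (volForm_ker_span hP θ₀ (lastRow χ) t) (2 * n + 1) ?_
    rintro _ ⟨⟨k, l⟩, rfl⟩
    have h3 := pow_mul_relPf_extendForm_smul_add b q (symbolForm_alt θ₀ (t.1 1) 0)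
      (symbolForm_alt θ₀ 0 (lastRow χ).1) y
      (symbolForm θ₀ (t.1 1) 0 (k.1.1, k.1.2, 0)) (l.1.1, l.1.2, 0) (fun p r => by
        have e : ∀ p r, symbolForm θ₀ (t.1 1) 0 p r
            = volForm θ₀ (t.1 1) (p.1, p.2.1) (r.1, r.2.1) := fun p r => by
          rw [symbolForm_apply]; simp
        obtain ⟨p', hp⟩ := exists_ker_decomposition (lastRow χ) t (p.1, p.2.1)
        obtain ⟨r', hr⟩ := exists_ker_decomposition (lastRow χ) t (r.1, r.2.1)
        have h4 := plucker (ker_rank hP (lastRow χ) t) (chiA hP θ₀ (lastRow χ) t).alt k l p' r'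
        simp only [chiA_form] at h4
        simp only [e]
        rw [hp, hr]
        simp only [map_add, map_smul, LinearMap.add_apply, LinearMap.smul_apply,
          volForm_self_left, volForm_self_right, smul_zero, add_zero]
        exact h4) (fun x => by
        have h5 : (lastRow χ).1 (l.1.1, l.1.2) = 0 := l.2
        rw [symbolForm_apply, hv0, h5]
        simp)
    rw [hχ, ← h2, h1, mul_one, symbolForm_apply] at h3
    simpa using h3
  refine ⟨t, AltIso.ext_form fun u v => ?_⟩
  rw [vForm_eq_symbolForm, h2, hy, ← sub_eq_zero.1 hy1, one_smul]

end PfaffianOne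

end Vaserstein
end

noncomputable section
namespace Vaserstein

/-! ### The action of `SL(P₀ ⊕ R ⊕ R)` and the Vaserstein symbol -/

section Action

variable {R : Type u} [CommRing R] {P₀ : Type u} [AddCommGroup P₀] [Module R P₀]
  [Module.Finite R P₀] [Module.Projective R P₀]
  (hP : ∀ p : PrimeSpectrum R, Module.rankAtStalk P₀ p = 2) (θ₀ : R ≃ₗ[R] ⋀[R]^2 P₀)

/-- A complement of `χ₀ ⟂ ψ₂` to a hyperbolic form, with the induced basis. -/
theorem exists_complement : ∃ (n : ℕ) (Q : Type u) (_ : AddCommGroup Q) (_ : Module R Q)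
    (_ : Module.Finite R Q) (_ : Module.Projective R Q) (q : AltIso R Q)
    (h : (Fin n × Fin 2 → R) ≃ₗ[R] (P₀ × R × R) × Q),
    AltIso.psi R n = (((chi0 hP θ₀).perp (AltIso.psi2 R)).perp q).pull h ∧
    ∀ f : AltIso R ((P₀ × R × R) × Q),
      (f.pull h).pfaffian = relPf ((Pi.basisFun R (Fin n × Fin 2)).map h) f.form := by
  obtain ⟨n, Q, _, _, _, _, q, h, hq⟩ :=
    ((chi0 hP θ₀).perp (AltIso.psi2 R)).exists_perp_isometric_psi
  refine ⟨n, Q, _, _, inferInstance, inferInstance, q, h, hq, fun f => ?_⟩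
  refine Finset.sum_congr rfl fun σ _ => ?_
  simp [pfTerm]

/-- Since `V(a, s)` has Pfaffian one, its pullback has Pfaffian `det φ`. -/
theorem projDet_pull_vForm {a : Um R (P₀ × R)} (s : Sect a) (φ : (P₀ × R × R) ≃ₗ[R] (P₀ × R × R)) :
    (projDet R (P₀ × R × R) φ.toLinearMap = 1 → ∃ t : Sect (lastRow ((vForm hP θ₀ a s).pull φ)),
      (vForm hP θ₀ a s).pull φ = vForm hP θ₀ _ t) ∧
    ∀ {a' : Um R (P₀ × R)} (s' : Sect a'), vForm hP θ₀ a' s' = (vForm hP θ₀ a s).pull φ →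
      projDet R (P₀ × R × R) φ.toLinearMap = 1 := by
  obtain ⟨n, Q, _, _, _, _, q, h, hq, hpf⟩ := exists_complement hP θ₀
  set b := (Pi.basisFun R (Fin n × Fin 2)).map h
  have h0 : relPf b (((chi0 hP θ₀).perp (AltIso.psi2 R)).perp q).form = 1 := by
    rw [← hpf, ← hq, AltIso.pfaffian_psi]
  have h1 := relPf_pull h b (vForm hP θ₀ a s) q φ
  rw [relPf_vForm θ₀ hP b q h0, mul_one] at h1
  refine ⟨fun h2 => exists_eq_vForm hP θ₀ b q h0 (h1.trans h2), fun s' h2 => ?_⟩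
  rw [← h1, ← h2, relPf_vForm θ₀ hP b q h0]

theorem exists_pull_eq_vForm {a : Um R (P₀ × R)} (s : Sect a)
    {φ : (P₀ × R × R) ≃ₗ[R] (P₀ × R × R)} (hφ : φ ∈ SL R (P₀ × R × R)) :
    ∃ t : Sect (lastRow ((vForm hP θ₀ a s).pull φ)),
      (vForm hP θ₀ a s).pull φ = vForm hP θ₀ _ t :=
  (projDet_pull_vForm hP θ₀ s φ).1 hφ

theorem mem_SL_of_vForm_eq_pull {a a' : Um R (P₀ × R)} {s : Sect a} {s' : Sect a'}
    {φ : (P₀ × R × R) ≃ₗ[R] (P₀ × R × R)} (h : vForm hP θ₀ a' s' = (vForm hP θ₀ a s).pull φ) :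
    φ ∈ SL R (P₀ × R × R) :=
  (projDet_pull_vForm hP θ₀ s φ).2 s' h

/-- The Vaserstein symbol lies in `Ṽ_SL(R)`. -/
theorem cls_vForm_mem (a : Um R (P₀ × R)) (s : Sect a) :
    cls ((chi0 hP θ₀).perp (AltIso.psi2 R)) (vForm hP θ₀ a s) ∈ VSLtilde R := by
  obtain ⟨n, Q, _, _, _, _, q, h, hq, hpf⟩ := exists_complement hP θ₀
  -- Adding `[Q, q, q] = 0` and transporting along `h` turns the symbol into a class relative to
  -- `ψ_{2n}`.
  refine AddSubgroup.subset_closure ⟨n, ((vForm hP θ₀ a s).perp q).pull h, ?_, ?_⟩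
  · rw [hpf]
    refine relPf_vForm θ₀ hP _ q ?_ a s
    rw [← hpf, ← hq, AltIso.pfaffian_psi]
  · rw [hq, cls_pull, cls_perp, cls_self, add_zero]

/-- The two forms differ by some `τ`, which normality moves past `φ`, where it no longer affects the
class of the last row. -/
theorem mk_lastRow_pull_vForm {a a' : Um R (P₀ × R)} (h : UmE.mk a = UmE.mk a') (s : Sect a)
    (s' : Sect a') (φ : (P₀ × R × R) ≃ₗ[R] (P₀ × R × R)) :
    UmE.mk (lastRow ((vForm hP θ₀ a' s').pull φ)) = UmE.mk (lastRow ((vForm hP θ₀ a s).pull φ)) := by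
  obtain ⟨τ, hτ, h1⟩ := exists_pull_of_mk_eq θ₀ hP h s s'
  have h2 := conj_mem_transvectionGroup hτ φ⁻¹
  rw [inv_inv] at h2
  rw [h1, ← AltIso.pull_mul, show τ * φ = φ * (φ⁻¹ * τ * φ) by group, AltIso.pull_mul,
    mk_lastRow_pull hP θ₀ h2]

theorem cls_vForm_eq {a a' : Um R (P₀ × R)} (h : UmE.mk a = UmE.mk a') (s : Sect a)
    (s' : Sect a') (g : AltIso R (P₀ × R × R)) :
    cls g (vForm hP θ₀ a' s') = cls g (vForm hP θ₀ a s) := by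
  obtain ⟨τ, hτ, h1⟩ := exists_pull_of_mk_eq θ₀ hP h s s'
  rw [h1, cls_pull_of_mem_SL g _ (transvectionGroup_le_SL hτ)]

theorem exists_mem_SL_of_cls_eq [IsNoetherianRing R] (hdim : ringKrullDim R ≤ 4)
    {a a' : Um R (P₀ × R)} {s : Sect a} {s' : Sect a'} {g : AltIso R (P₀ × R × R)}
    (h : cls g (vForm hP θ₀ a' s') = cls g (vForm hP θ₀ a s)) :
    ∃ φ ∈ SL R (P₀ × R × R), vForm hP θ₀ a' s' = (vForm hP θ₀ a s).pull φ := by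
  obtain ⟨T, hT⟩ := exists_isometric_of_cls_eq h
  have hF : HasFrames R (P₀ × R × R) 4 :=
    ((hasFrames_two hP θ₀).prod.prod).congr (LinearEquiv.prodAssoc R P₀ R R)
  -- Cancellation for rank `k = 4` needs `dim R < 5`, which is the bound assumed.
  obtain ⟨φ, hφ⟩ := AltIso.isometric_of_perp _ _ T.f
    (hdim.trans_lt (by norm_num)) hF hT
  exact ⟨φ, mem_SL_of_vForm_eq_pull hP θ₀ hφ, hφ⟩

end Action

end Vaserstein
end

/-! ### The action and the fibres of the symbol -/

open Vaserstein in
theorem theorem3p5 {R : Type u} [CommRing R] [IsNoetherianRing R] (hdim : ringKrullDim R ≤ 4)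
    {P₀ : Type u} [AddCommGroup P₀] [Module R P₀] [Module.Finite R P₀] [Module.Projective R P₀]
    (hrank : ∀ p : PrimeSpectrum R, Module.rankAtStalk P₀ p = 2)
    (θ₀ : R ≃ₗ[R] ⋀[R]^2 P₀) :
    ∃ (act : UmE R P₀ R → SL R (P₀ × R × R) → UmE R P₀ R) (V : UmE R P₀ R → VSLtilde R),
      (∀ (a : Um R (P₀ × R)) (s : Sect a) (φ : SL R (P₀ × R × R)),
        act (UmE.mk a) φ = UmE.mk (lastRow ((vForm hrank θ₀ a s).pull φ.1))) ∧
      (∀ x, act x 1 = x) ∧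
      (∀ x φ ψ, act (act x φ) ψ = act x (φ * ψ)) ∧
      (∀ (a : Um R (P₀ × R)) (s : Sect a),
        (V (UmE.mk a) : VSL R) =
          cls ((chi0 hrank θ₀).perp (AltIso.psi2 R)) (vForm hrank θ₀ a s)) ∧
      ∀ a a' : Um R (P₀ × R),
        V (UmE.mk a) = V (UmE.mk a') ↔ ∃ φ, act (UmE.mk a) φ = UmE.mk a' := by
  -- Action and symbol are defined by chosen representatives and sections. `hact` and `hV` show that
  -- the choices do not matter.
  have hrep : ∀ x : UmE R P₀ R, ∃ a : Um R (P₀ × R), UmE.mk a = x := Quotient.exists_rep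
  choose rep hrep using hrep
  let sect : ∀ a : Um R (P₀ × R), Sect a := fun a => Classical.choice (nonempty_sect a)
  let act : UmE R P₀ R → SL R (P₀ × R × R) → UmE R P₀ R := fun x φ =>
    UmE.mk (lastRow ((vForm hrank θ₀ (rep x) (sect (rep x))).pull φ.1))
  let V : UmE R P₀ R → VSLtilde R := fun x => ⟨_, cls_vForm_mem hrank θ₀ (rep x) (sect (rep x))⟩
  have hact : ∀ (a : Um R (P₀ × R)) (s : Sect a) (φ : SL R (P₀ × R × R)),
      act (UmE.mk a) φ = UmE.mk (lastRow ((vForm hrank θ₀ a s).pull φ.1)) := fun a s φ =>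
    mk_lastRow_pull_vForm hrank θ₀ (hrep (UmE.mk a)).symm s _ φ.1
  have hV : ∀ (a : Um R (P₀ × R)) (s : Sect a), (V (UmE.mk a) : VSL R)
      = cls ((chi0 hrank θ₀).perp (AltIso.psi2 R)) (vForm hrank θ₀ a s) := fun a s =>
    cls_vForm_eq hrank θ₀ (hrep (UmE.mk a)).symm s _ _
  refine ⟨act, V, hact, fun x => ?_, fun x φ ψ => ?_, hV, fun a a' => ⟨fun h => ?_, ?_⟩⟩
  · rw [← hrep x, hact _ (sect _), Subgroup.coe_one, AltIso.pull_one, lastRow_vForm]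
  · obtain ⟨a, rfl⟩ : ∃ a, UmE.mk a = x := ⟨rep x, hrep x⟩
    -- The pulled back form is again `V` of its last row with section `t`. Using this section for
    -- the second step makes acting twice a composition of pullbacks.
    obtain ⟨t, ht⟩ := exists_pull_eq_vForm hrank θ₀ (sect a) φ.2
    rw [hact a (sect a) φ, hact _ t ψ, ← ht, hact a (sect a), Subgroup.coe_mul, AltIso.pull_mul]
  · have h1 := congrArg Subtype.val h
    rw [hV a (sect a), hV a' (sect a')] at h1
    obtain ⟨φ, hφ, h2⟩ := exists_mem_SL_of_cls_eq hrank θ₀ hdim h1.symm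
    refine ⟨⟨φ, hφ⟩, ?_⟩
    rw [hact a (sect a), ← h2, lastRow_vForm]
  · rintro ⟨φ, h⟩
    rw [hact a (sect a)] at h
    obtain ⟨t, ht⟩ := exists_pull_eq_vForm hrank θ₀ (sect a) φ.2
    refine Subtype.ext ?_
    rw [← h, hV a (sect a), hV _ t, ← ht, cls_pull_of_mem_SL _ _ φ.2]
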